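/- **Setting.** Let $\mathcal P$ be a finite or countable collection of pairwise disjoint nonempty open subintervals of $[0,1]$ whose union has full Lebesgue measure, and let $f:\bigcup_{p\in\mathcal P}p\to[0,1]$ be such that, for each $p\in\mathcal P$, $f$ is $C^1$ on $p$, both $f|_p$ and $(1/f')|_p$ extend continuously to $\bar p$, and $\inf_{p\in\mathcal P}\inf_{x\in p}|f'(x)|>1$. Let $\xi:[0,1]\to\mathbb C$ and $\beta\in(0,1]$ be such that $\xi$ is $\beta$-Hölder on each $p\in\mathcal P$ (equivalently, $\xi|_p$ extends to a $\beta$-Hölder function on $\bar p$), with a Hölder constant that does not depend on $p$. Assume that $|f'|^r\in L^1([0,1])$ for some $r\ge 0$, that $\xi f'\in L^\infty([0,1])$, and that for some $\gamma\in[0,1)$ $$\sum_{p\in\mathcal P}\ \sup_{z\in p}\left|\xi(z)\,f'(z)^\gamma\right|^{\frac1{1-\gamma}}<\infty ,$$ where real powers of $f'$ are complex powers, so that $|f'(z)^{t}|=|f'(z)|^{t}$. All $L^p$ spaces are with respect to Lebesgue measure, and $|\cdot|_\infty$ is the $L^\infty$ norm. For $\alpha\in[0,1]$ and $\varphi\in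 C^1([0,1],\mathbb C)$ put $$|\varphi|_\alpha=\sup_{x\in[0,1]}|\varphi(x)|+\sup_{x\ne y\in[0,1]}\frac{|\varphi(x)-\varphi(y)|}{|x-y|^\alpha},$$ and let $\mathcal B_\alpha$ be the space of all $h\in L^1([0,1],\mathbb C)$ with $$\|h\|_\alpha=\sup\left\{\left|\int_0^1 h\,\varphi'\right| : \varphi\in C^1([0,1],\mathbb C),\ |\varphi|_\alpha\le 1\right\}<\infty ,$$ with the norm $\|\cdot\|_\alpha$. Let $\mathcal L_\xi$ be the transfer operator $$\mathcal L_\xi h(x)=\sum_{y\in f^{-1}(x)}\xi(y)h(y).$$ **Theorem.** If $\beta>\frac1{r+1}$, then for every $\alpha$ with $$1>\alpha>\max\left\{\gamma,\ 1-\beta,\ \frac{1-\beta}{1-\beta(1-r)}\right\}$$ the following holds. For each $h\in\mathcal B_\alpha$ the sum defining $\mathcal L_\xi h(x)$ converges absolutely for almost every $x\in[0,1]$, and $\mathcal L_\xi$ is a bounded linear operator on $\mathcal B_\alpha$. Its spectral radius is at most $|\xi f'|_\infty$. Its essential spectral radius, i.e. the supremum of $|z|$ over the $z\in\mathbb C$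 for which $z-\mathcal L_\xi$ is not Fredholm on $\mathcal B_\alpha$, is at most $\min\{|\xi f'|_\infty,\ 8\,|\xi (f')^{\alpha}|_\infty\}$. -/

import Mathlib

open Set MeasureTheory
open scoped ENNReal

noncomputable section

namespace ExpandingMap

/-- Lebesgue measure on `[0,1]`. -/
abbrev leb : Measure ℝ := volume.restrict (Icc (0 : ℝ) 1)

/-- The Hölder norm `|φ|_α = sup |φ(x)| + sup |φ(x) - φ(y)| / |x - y| ^ α` on `[0,1]`
(extended-real valued; the terms with `x = y` vanish). -/
def holderNorm (α : ℝ) (φ : ℝ → ℂ) : ℝ≥0∞ :=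
  (⨆ x ∈ Icc (0 : ℝ) 1, ‖φ x‖ₑ) +
    ⨆ x ∈ Icc (0 : ℝ) 1, ⨆ y ∈ Icc (0 : ℝ) 1, ‖φ x - φ y‖ₑ / ‖x - y‖ₑ ^ α

/-- The pairing `∫₀¹ h φ'`. -/
def pairing (h φ : ℝ → ℂ) : ℂ :=
  ∫ x, h x * derivWithin φ (Icc (0 : ℝ) 1) x ∂leb

/-- The norm `‖h‖_α = sup |∫₀¹ h φ'|` over `φ ∈ C¹([0,1], ℂ)` with `|φ|_α ≤ 1`
(extended-real valued). -/
def bNorm (α : ℝ) (h : Lp ℂ 1 leb) : ℝ≥0∞ :=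
  ⨆ φ : ℝ → ℂ, ⨆ _ : ContDiffOn ℝ 1 φ (Icc (0 : ℝ) 1), ⨆ _ : holderNorm α φ ≤ 1,
    ‖pairing h φ‖ₑ

lemma pairing_le_bNorm {α : ℝ} (h : Lp ℂ 1 leb) {φ : ℝ → ℂ}
    (hφ : ContDiffOn ℝ 1 φ (Icc (0 : ℝ) 1)) (hn : holderNorm α φ ≤ 1) :
    ‖pairing h φ‖ₑ ≤ bNorm α h :=
  le_iSup_of_le φ (le_iSup_of_le hφ (le_iSup_of_le hn le_rfl))

lemma continuousOn_derivWithin {φ : ℝ → ℂ} (hφ : ContDiffOn ℝ 1 φ (Icc (0 : ℝ) 1)) :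
    ContinuousOn (derivWithin φ (Icc (0 : ℝ) 1)) (Icc (0 : ℝ) 1) :=
  hφ.continuousOn_derivWithin (uniqueDiffOn_Icc zero_lt_one) le_rfl

lemma integrable_pairing (h : Lp ℂ 1 leb) {φ : ℝ → ℂ}
    (hφ : ContDiffOn ℝ 1 φ (Icc (0 : ℝ) 1)) :
    Integrable (fun x => h x * derivWithin φ (Icc (0 : ℝ) 1) x) leb := by
  have hc := continuousOn_derivWithin hφ
  obtain ⟨C, hC⟩ := isCompact_Icc.exists_bound_of_continuousOn hc
  refine (L1.integrable_coeFn h).mul_bdd (c := C) ?_ ?_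
  · exact hc.aestronglyMeasurable measurableSet_Icc
  · exact (ae_restrict_iff' measurableSet_Icc).2 (Filter.Eventually.of_forall hC)

lemma bNorm_add_le (α : ℝ) (h g : Lp ℂ 1 leb) : bNorm α (h + g) ≤ bNorm α h + bNorm α g := by
  refine iSup_le fun φ => iSup_le fun hφ => iSup_le fun hn => ?_
  have : pairing (h + g : Lp ℂ 1 leb) φ = pairing h φ + pairing g φ := by
    unfold pairing
    rw [← integral_add (integrable_pairing h hφ) (integrable_pairing g hφ)]
    refine integral_congr_ae ?_
    filter_upwards [Lp.coeFn_add h g] with x hx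
    rw [hx, Pi.add_apply, add_mul]
  rw [this]
  exact (enorm_add_le _ _).trans
    (add_le_add (pairing_le_bNorm h hφ hn) (pairing_le_bNorm g hφ hn))

lemma bNorm_smul (α : ℝ) (c : ℂ) (h : Lp ℂ 1 leb) : bNorm α (c • h) = ‖c‖ₑ * bNorm α h := by
  have key : ∀ φ, pairing (c • h : Lp ℂ 1 leb) φ = c * pairing h φ := by
    intro φ
    unfold pairing
    rw [← integral_const_mul]
    refine integral_congr_ae ?_
    filter_upwards [Lp.coeFn_smul c h] with x hx
    rw [hx, Pi.smul_apply, smul_eq_mul, mul_assoc]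
  simp only [bNorm, key, enorm_mul, ENNReal.mul_iSup]

lemma bNorm_zero (α : ℝ) : bNorm α 0 = 0 := by
  simpa using bNorm_smul α 0 0

/-- A `C¹` function is Hölder on `[0,1]`, so a nonzero multiple of it is an admissible test
function. -/
lemma exists_smul_holderNorm_le {α : ℝ} (h0 : 0 ≤ α) (h1 : α ≤ 1) {φ : ℝ → ℂ}
    (hφ : ContDiffOn ℝ 1 φ (Icc (0 : ℝ) 1)) :
    ∃ c : ℂ, c ≠ 0 ∧ holderNorm α (fun x => c * φ x) ≤ 1 := by
  obtain ⟨C, hC⟩ := isCompact_Icc.exists_bound_of_continuousOn (continuousOn_derivWithin hφ)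
  obtain ⟨M, hM⟩ := isCompact_Icc.exists_bound_of_continuousOn hφ.continuousOn
  have hC0 : 0 ≤ C := (norm_nonneg _).trans (hC 0 (by simp))
  have hM0 : 0 ≤ M := (norm_nonneg _).trans (hM 0 (by simp))
  have hL : ∀ x ∈ Icc (0 : ℝ) 1, ∀ y ∈ Icc (0 : ℝ) 1, ‖φ x - φ y‖ ≤ C * ‖x - y‖ :=
    fun x hx y hy => (convex_Icc 0 1).norm_image_sub_le_of_norm_derivWithin_le
      (hφ.differentiableOn one_ne_zero) hC hy hx
  set K : ℝ := M + C + 1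
  have hK : 0 < K := by positivity
  refine ⟨((K⁻¹ : ℝ) : ℂ), by exact_mod_cast (inv_pos.2 hK).ne', ?_⟩
  have hnorm : ‖((K⁻¹ : ℝ) : ℂ)‖ = K⁻¹ := by
    rw [Complex.norm_real, Real.norm_of_nonneg (inv_pos.2 hK).le]
  have hA : (⨆ x ∈ Icc (0 : ℝ) 1, ‖((K⁻¹ : ℝ) : ℂ) * φ x‖ₑ) ≤ ENNReal.ofReal (K⁻¹ * M) := by
    refine iSup₂_le fun x hx => ?_
    rw [← ofReal_norm, norm_mul, hnorm]
    exact ENNReal.ofReal_le_ofReal (mul_le_mul_of_nonneg_left (hM x hx) (inv_pos.2 hK).le)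
  have hB : (⨆ x ∈ Icc (0 : ℝ) 1, ⨆ y ∈ Icc (0 : ℝ) 1,
      ‖((K⁻¹ : ℝ) : ℂ) * φ x - ((K⁻¹ : ℝ) : ℂ) * φ y‖ₑ / ‖x - y‖ₑ ^ α)
      ≤ ENNReal.ofReal (K⁻¹ * C) := by
    refine iSup₂_le fun x hx => iSup₂_le fun y hy => ?_
    refine ENNReal.div_le_of_le_mul ?_
    rw [← mul_sub, ← ofReal_norm, norm_mul, hnorm, ← ofReal_norm (x - y),
      ENNReal.ofReal_rpow_of_nonneg (norm_nonneg _) h0,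
      ← ENNReal.ofReal_mul (by positivity)]
    refine ENNReal.ofReal_le_ofReal ?_
    rw [mul_assoc]
    refine mul_le_mul_of_nonneg_left ((hL x hx y hy).trans ?_) (inv_pos.2 hK).le
    refine mul_le_mul_of_nonneg_left ?_ hC0
    refine Real.self_le_rpow_of_le_one (norm_nonneg _) ?_ h1
    rw [Real.norm_eq_abs, abs_le]
    constructor <;> linarith [hx.1, hx.2, hy.1, hy.2]
  refine (add_le_add hA hB).trans ?_
  rw [← ENNReal.ofReal_add (by positivity) (by positivity), ENNReal.ofReal_le_one, ← mul_add,
    inv_mul_le_iff₀ hK]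
  simp [K]

lemma eq_zero_of_bNorm_eq_zero {α : ℝ} (h0 : 0 ≤ α) (h1 : α ≤ 1) {h : Lp ℂ 1 leb}
    (hz : bNorm α h = 0) : h = 0 := by
  have key : ∀ g : ℝ → ℝ, ContDiff ℝ (⊤ : ℕ∞) g → ∫ x, g x • h x ∂leb = 0 := by
    intro g hg
    set φ : ℝ → ℂ := fun x => ((∫ t in (0 : ℝ)..x, g t : ℝ) : ℂ)
    have hd : ∀ x, HasDerivAt φ (g x : ℂ) x := fun x =>
      (intervalIntegral.integral_hasDerivAt_right (hg.continuous.intervalIntegrable _ _)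
        hg.continuous.stronglyMeasurable.stronglyMeasurableAtFilter
        hg.continuous.continuousAt).ofReal_comp
    have hφ : ContDiff ℝ 1 φ := by
      rw [contDiff_one_iff_deriv]
      refine ⟨fun x => (hd x).differentiableAt, ?_⟩
      rw [funext fun x => (hd x).deriv]
      exact Complex.continuous_ofReal.comp hg.continuous
    obtain ⟨c, hc, hn⟩ := exists_smul_holderNorm_le h0 h1 hφ.contDiffOn
    have hle := pairing_le_bNorm (α := α) h
      ((contDiff_const.mul hφ).contDiffOn (s := Icc (0 : ℝ) 1)) hn
    rw [hz, nonpos_iff_eq_zero, enorm_eq_zero] at hle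
    have : pairing h (fun x => c * φ x) = c * ∫ x, g x • h x ∂leb := by
      unfold pairing
      rw [← integral_const_mul]
      refine setIntegral_congr_fun measurableSet_Icc fun x hx => ?_
      have := (((hd x).const_mul c).hasDerivWithinAt (s := Icc (0 : ℝ) 1)).derivWithin
        (uniqueDiffOn_Icc zero_lt_one x hx)
      simp only [this, Complex.real_smul]
      ring
    rw [this] at hle
    exact (mul_eq_zero.1 hle).resolve_left hc
  have := ae_eq_zero_of_integral_contDiff_smul_eq_zero (μ := leb)
    (L1.integrable_coeFn h).locallyIntegrable (fun g hg _ => key g hg)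
  exact (Lp.eq_zero_iff_ae_eq_zero).2 this

/-- The densities `h ∈ L¹([0,1], ℂ)` with `‖h‖_α < ∞`, as a subspace of `L¹`. -/
def bSubmodule (α : ℝ) : Submodule ℂ (Lp ℂ 1 leb) where
  carrier := {h | bNorm α h ≠ ∞}
  add_mem' {h g} hh hg :=
    ((bNorm_add_le α h g).trans_lt (ENNReal.add_lt_top.2 ⟨hh.lt_top, hg.lt_top⟩)).ne
  zero_mem' := by simp [bNorm_zero]
  smul_mem' c h hh := by
    simpa [bNorm_smul] using ENNReal.mul_ne_top enorm_ne_top hh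

/-- The space `𝓑_α`, `α ∈ [0,1]`. It carries the norm `‖·‖_α`, not the norm of `L¹`. -/
def BSpace (α : unitInterval) : Type := bSubmodule (α : ℝ)

namespace BSpace

variable {α : unitInterval}

instance : AddCommGroup (BSpace α) := inferInstanceAs (AddCommGroup (bSubmodule (α : ℝ)))

instance : Module ℂ (BSpace α) := inferInstanceAs (Module ℂ (bSubmodule (α : ℝ)))

/-- The inclusion of `𝓑_α` into `L¹`. -/
def toL1 : BSpace α →ₗ[ℂ] Lp ℂ 1 leb := (bSubmodule (α : ℝ)).subtype

lemma bNorm_ne_top (h : BSpace α) : bNorm α (toL1 h) ≠ ∞ := h.2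

lemma toL1_injective : Function.Injective (toL1 : BSpace α →ₗ[ℂ] Lp ℂ 1 leb) :=
  Subtype.val_injective

instance : NormedAddCommGroup (BSpace α) :=
  AddGroupNorm.toNormedAddCommGroup
    { toFun := fun h => (bNorm α (toL1 h)).toReal
      map_zero' := by simp [bNorm_zero]
      add_le' := fun h g => by
        rw [← ENNReal.toReal_add (bNorm_ne_top h) (bNorm_ne_top g), map_add]
        exact ENNReal.toReal_mono
          (ENNReal.add_ne_top.2 ⟨bNorm_ne_top h, bNorm_ne_top g⟩) (bNorm_add_le _ _ _)
      neg' := fun h => by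
        have := bNorm_smul (α : ℝ) (-1) (toL1 h)
        rw [neg_one_smul] at this
        simp [this]
      eq_zero_of_map_eq_zero' := fun h hh => by
        have := ((ENNReal.toReal_eq_zero_iff _).1 hh).resolve_right (bNorm_ne_top h)
        have := eq_zero_of_bNorm_eq_zero α.2.1 α.2.2 this
        exact toL1_injective (by rw [this, map_zero]) }

lemma norm_def (h : BSpace α) : ‖h‖ = (bNorm α (toL1 h)).toReal := rfl

instance : NormedSpace ℂ (BSpace α) where
  norm_smul_le c h := by
    rw [norm_def, norm_def, map_smul, bNorm_smul, ENNReal.toReal_mul, toReal_enorm]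

end BSpace

variable {ι : Type*}

/-- The intervals `(a i, b i)` are nonempty, pairwise disjoint, contained in `[0,1]` and fill it
up to a Lebesgue null set. (Such a family is automatically countable.) -/
structure IsPartition (a b : ι → ℝ) : Prop where
  nonneg : ∀ i, 0 ≤ a i
  lt : ∀ i, a i < b i
  le_one : ∀ i, b i ≤ 1
  disjoint : Pairwise fun i j => Disjoint (Ioo (a i) (b i)) (Ioo (a j) (b j))
  full : volume (Icc (0 : ℝ) 1 \ ⋃ i, Ioo (a i) (b i)) = 0

/-- `f` is a piecewise `C¹` expanding map of `[0,1]` with the partition `(a i, b i)`: on each of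
these intervals it is `C¹`, with values in `[0,1]`, and `f` and `1 / f'` extend continuously to
the closed interval; moreover `inf |f'| > 1`. Only the values of `f` on the union of the open
intervals matter. -/
structure IsPiecewiseExpanding (a b : ι → ℝ) (f : ℝ → ℝ) : Prop where
  isPartition : IsPartition a b
  mapsTo : ∀ i, MapsTo f (Ioo (a i) (b i)) (Icc 0 1)
  contDiffOn : ∀ i, ContDiffOn ℝ 1 f (Ioo (a i) (b i))
  extends_map : ∀ i, ∃ g : ℝ → ℝ, ContinuousOn g (Icc (a i) (b i)) ∧
    EqOn g f (Ioo (a i) (b i))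
  extends_inv_deriv : ∀ i, ∃ g : ℝ → ℝ, ContinuousOn g (Icc (a i) (b i)) ∧
    EqOn g (fun x => (deriv f x)⁻¹) (Ioo (a i) (b i))
  expanding : ∃ lam : ℝ, 1 < lam ∧ ∀ i, ∀ x ∈ Ioo (a i) (b i), lam ≤ |deriv f x|

/-- `ξ` is `β`-Hölder on each interval `(a i, b i)`, with a uniform constant (equivalently, its
restriction to each of them extends to a `β`-Hölder function on the closed interval, with a
uniform constant). -/
def IsPiecewiseHolder (a b : ι → ℝ) (β : ℝ) (ξ : ℝ → ℂ) : Prop :=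
  ∃ C : ℝ, ∀ i, ∀ x ∈ Ioo (a i) (b i), ∀ y ∈ Ioo (a i) (b i), ‖ξ x - ξ y‖ ≤ C * |x - y| ^ β

/-- The function `ξ (f') ^ t`, where `(f') ^ t` is a complex power; its modulus is
`|ξ| |f'| ^ t`. -/
def weightPow (f : ℝ → ℝ) (ξ : ℝ → ℂ) (t : ℝ) (x : ℝ) : ℂ :=
  ξ x * ((deriv f x : ℝ) : ℂ) ^ (t : ℂ)

/-- `L` is the transfer operator `𝓛_ξ h (x) = ∑_{y ∈ f⁻¹(x)} ξ(y) h(y)` on `𝓑_α`: for each `h`,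
and almost every `x`, the (countable) sum over the preimages of `x` in the domain
`⋃ i, (a i, b i)` of `f` converges absolutely, to the value at `x` of `L h`. -/
def IsTransferOperator (a b : ι → ℝ) (f : ℝ → ℝ) (ξ : ℝ → ℂ) {α : unitInterval}
    (L : BSpace α →L[ℂ] BSpace α) : Prop :=
  ∀ h : BSpace α, ∀ᵐ x ∂leb,
    HasSum (fun y : {y : ℝ // y ∈ ⋃ i, Ioo (a i) (b i) ∧ f y = x} => ξ y * BSpace.toL1 h y)
      (BSpace.toL1 (L h) x)

/-- The essential spectral radius of a bounded operator: the supremum of `|z|` over the `z ∈ ℂ`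
for which `z - L` is not a Fredholm operator. -/
def essSpectralRadius {E : Type*} [NormedAddCommGroup E] [NormedSpace ℂ E] (L : E →L[ℂ] E) :
    ℝ≥0∞ :=
  ⨆ z ∈ {z : ℂ | ¬ (algebraMap ℂ (E →L[ℂ] E) z - L).IsFredholm}, ‖z‖ₑ

end ExpandingMap

end

noncomputable section

namespace ExpandingMap

/-! ### Finite-rank perturbations, essential norms and spectra -/

section EssentialNorm

variable {E : Type*} [NormedAddCommGroup E] [NormedSpace ℂ E]

/-! The argument goes by duality. Since `∫ (𝓛h) u = ∫ h · ξ|f'|(u ∘ f)`, boundedness on `𝓑_α`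
follows once the primitive of `ξ|f'|(u ∘ f)` is `α`-Hölder with a uniform constant, for all `u = φ'`
with `φ` of Hölder seminorm at most one. The function paired with `h` is then only bounded and
measurable; `enorm_integral_mul_le` shows, by smoothing, that `‖h‖_α` still controls the pairing.

On one branch this primitive is, up to sign, the Young integral `∫ ξ d(φ ∘ f)`. As `f'` may be
unbounded, `φ ∘ f` is not uniformly Hölder. The sewing argument in `exists_young` therefore samples
`ξ` where `|f'|` is largest, so that the bound on `ξ f'` pays for those powers of `|f'|` that the
integrability of `|f'|^r` does not absorb. The outcome bounds an increment over `[x, y]` by `(|ξ(z)|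
|f'(z)|^α + error) (y - x)^α`, where the error tends to zero with `y - x`. The branch constants lie
in `ℓ^{1/(1-α)}`: for the main term this interpolates the `γ` hypothesis with the bound on `ξ f'`,
for the error it is `summable_length_mul`. Hölder's inequality then adds the branches
(`norm_integral_iUnion_le`).

For the essential spectral radius put `θ = |ξ (f')^α|_∞`. The branches outside a large finite set
contribute an operator of small norm. The remaining ones are cut into finitely many cells on which
`ξ` may be replaced by a constant, the constant `0` being used where `|f'|` blows up
(`exists_local_weight`). The error of this replacement is small modulo finite rank, because
subtracting averages over cells leaves a function whose primitive vanishes at the ends of each cell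
(`essNormLE_of_dual`). What is left is a finite system of branches with constant weights. Such
systems compose, their constants multiply, and a system with constant `θ'` has essential norm at
most `8θ'` whatever the number of branches. Its `n`-th power thus has essential norm at most
`8θ'^n`, and the factor `8` disappears as `n` grows: the bound obtained is in fact `θ`, which is at
most both terms of the stated minimum.

For the spectral radius, the Fredholm alternative reduces invertibility of `z^n - L^n` to
injectivity when `|z| > θ`. Eigenvectors lie in `L¹`, where the operator has norm at most `|ξ
f'|_∞`, so there are none with larger `|z|`. -/

/-- `T` is the sum of an operator of norm at most `t` and an operator of finite rank. -/
def EssNormLE (T : E →L[ℂ] E) (t : ℝ) : Prop :=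
  ∃ B F : E →L[ℂ] E, T = B + F ∧ ‖B‖ ≤ t ∧ (F : E →ₗ[ℂ] E).HasFiniteRange

lemma hasFiniteRange_add {F G : E →L[ℂ] E} (hF : (F : E →ₗ[ℂ] E).HasFiniteRange)
    (hG : (G : E →ₗ[ℂ] E).HasFiniteRange) : ((F + G : E →L[ℂ] E) : E →ₗ[ℂ] E).HasFiniteRange := by
  rw [← LinearMap.mem_finiteRange_iff_hasFiniteRange] at *
  exact add_mem hF hG

lemma hasFiniteRange_neg {F : E →L[ℂ] E} (hF : (F : E →ₗ[ℂ] E).HasFiniteRange) :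
    ((-F : E →L[ℂ] E) : E →ₗ[ℂ] E).HasFiniteRange := by
  rw [← LinearMap.mem_finiteRange_iff_hasFiniteRange] at *
  exact neg_mem hF

lemma hasFiniteRange_sub {F G : E →L[ℂ] E} (hF : (F : E →ₗ[ℂ] E).HasFiniteRange)
    (hG : (G : E →ₗ[ℂ] E).HasFiniteRange) : ((F - G : E →L[ℂ] E) : E →ₗ[ℂ] E).HasFiniteRange := by
  rw [sub_eq_add_neg]
  exact hasFiniteRange_add hF (hasFiniteRange_neg hG)

lemma hasFiniteRange_mul_left {F : E →L[ℂ] E} (hF : (F : E →ₗ[ℂ] E).HasFiniteRange)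
    (G : E →L[ℂ] E) : ((G * F : E →L[ℂ] E) : E →ₗ[ℂ] E).HasFiniteRange :=
  hF.comp_left (G : E →ₗ[ℂ] E)

lemma hasFiniteRange_mul_right {F : E →L[ℂ] E} (hF : (F : E →ₗ[ℂ] E).HasFiniteRange)
    (G : E →L[ℂ] E) : ((F * G : E →L[ℂ] E) : E →ₗ[ℂ] E).HasFiniteRange :=
  hF.comp_right (G : E →ₗ[ℂ] E)

lemma hasFiniteRange_add_pow_sub_pow {F : E →L[ℂ] E} (hF : (F : E →ₗ[ℂ] E).HasFiniteRange)
    (X : E →L[ℂ] E) (n : ℕ) :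
    (((X + F) ^ n - X ^ n : E →L[ℂ] E) : E →ₗ[ℂ] E).HasFiniteRange := by
  induction n with
  | zero => simp
  | succ n ih =>
    have : (X + F) ^ (n + 1) - X ^ (n + 1) =
        ((X + F) ^ n - X ^ n) * (X + F) + X ^ n * F := by
      rw [pow_succ, pow_succ]; noncomm_ring
    rw [this]
    exact hasFiniteRange_add (hasFiniteRange_mul_right ih _) (hasFiniteRange_mul_left hF _)

/-- Expanding `(x + y) ^ n` into words, `x ^ n` is the only word without `y`; the norms of the
others add up to the scalar difference. For fixed `n` and bounded `‖x‖` this is small with `‖y‖`. -/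
lemma norm_add_pow_sub_pow_le {R : Type*} [NormedRing R] [NormOneClass R] (x y : R) (n : ℕ) :
    ‖(x + y) ^ n - x ^ n‖ ≤ (‖x‖ + ‖y‖) ^ n - ‖x‖ ^ n := by
  induction n with
  | zero => simp
  | succ n ih =>
    have : (x + y) ^ (n + 1) - x ^ (n + 1) = ((x + y) ^ n - x ^ n) * (x + y) + x ^ n * y := by
      rw [pow_succ, pow_succ]; noncomm_ring
    rw [this]
    calc ‖((x + y) ^ n - x ^ n) * (x + y) + x ^ n * y‖
        ≤ ‖(x + y) ^ n - x ^ n‖ * ‖x + y‖ + ‖x‖ ^ n * ‖y‖ := by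
          refine (norm_add_le _ _).trans (add_le_add (norm_mul_le _ _) ?_)
          refine (norm_mul_le _ _).trans ?_
          gcongr
          exact norm_pow_le _ _
      _ ≤ ((‖x‖ + ‖y‖) ^ n - ‖x‖ ^ n) * (‖x‖ + ‖y‖) + ‖x‖ ^ n * ‖y‖ := by
          gcongr
          · exact (norm_nonneg _).trans ih
          · exact norm_add_le _ _
      _ = _ := by ring

/-- The closed graph of the essential norm estimates: if `L` is approximated, modulo operators of
finite rank, by operators whose powers have essential norm at most `8 θ' ^ n`, then some power of
`L` has essential norm smaller than `‖z‖ ^ n` as soon as `θ < ‖z‖`. -/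
lemma exists_essNormLE_pow [Nontrivial E] {L : E →L[ℂ] E} {θ : ℝ} (hθ : 0 ≤ θ)
    (happ : ∀ ε > 0, ∀ θ' > θ, ∃ A R F : E →L[ℂ] E, L = A + R + F ∧ ‖R‖ ≤ ε ∧
      (F : E →ₗ[ℂ] E).HasFiniteRange ∧ ∀ n : ℕ, n ≠ 0 → EssNormLE (A ^ n) (8 * θ' ^ n))
    {z : ℂ} (hz : θ < ‖z‖) : ∃ n : ℕ, n ≠ 0 ∧ ∃ t < ‖z‖ ^ n, EssNormLE (L ^ n) t := by
  obtain ⟨θ', h1, h2⟩ := exists_between hz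
  have hθ' : 0 ≤ θ' := hθ.trans h1.le
  have hz0 : 0 < ‖z‖ := hθ'.trans_lt h2
  have hev : ∀ᶠ n : ℕ in Filter.atTop, (θ' / ‖z‖) ^ n < 1 / 16 :=
    (tendsto_pow_atTop_nhds_zero_of_lt_one (by positivity)
      ((div_lt_one hz0).2 h2)).eventually_lt_const (by norm_num)
  -- The power `n` depends on `θ'` and `z` only. It is fixed before `ε`, hence before the
  -- decomposition of `L`, so `ε` may be chosen according to `n`.
  obtain ⟨n, hn, hn0⟩ := (hev.and (Filter.eventually_gt_atTop 0)).exists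
  have hn' : 8 * θ' ^ n < ‖z‖ ^ n / 2 := by
    rw [div_pow, div_lt_iff₀ (by positivity)] at hn
    linarith
  have hcont : Filter.Tendsto (fun ε : ℝ => (8 * θ' + ε) ^ n - (8 * θ') ^ n)
      (nhdsWithin 0 (Ioi 0)) (nhds ((8 * θ' + 0) ^ n - (8 * θ') ^ n)) :=
    ((by fun_prop : Continuous fun ε : ℝ => (8 * θ' + ε) ^ n - (8 * θ') ^ n).tendsto
      0).mono_left nhdsWithin_le_nhds
  simp only [add_zero, sub_self] at hcont
  obtain ⟨ε, hε, hε0⟩ := ((hcont.eventually_lt_const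
    (show (0 : ℝ) < ‖z‖ ^ n / 2 by positivity)).and self_mem_nhdsWithin).exists
  obtain ⟨A, R, F, hL, hR, hF, hA⟩ := happ ε hε0 θ' h1
  -- There is no bound on `‖A‖` itself. The case of exponent one replaces `A`, modulo finite rank,
  -- by `A₁` with `‖A₁‖ ≤ 8 * θ'`, a bound independent of `ε`.
  obtain ⟨A₁, F₁, hA1, hA1n, hF1⟩ := hA 1 one_ne_zero
  obtain ⟨Aₙ, Fₙ, hAn, hAnn, hFn⟩ := hA n hn0.ne'
  rw [pow_one] at hA1
  rw [pow_one] at hA1n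
  refine ⟨n, hn0.ne', 8 * θ' ^ n + ((8 * θ' + ε) ^ n - (8 * θ') ^ n), by linarith,
    Aₙ + ((A₁ + R) ^ n - A₁ ^ n), L ^ n - (Aₙ + ((A₁ + R) ^ n - A₁ ^ n)), by abel, ?_, ?_⟩
  · refine (norm_add_le _ _).trans (add_le_add hAnn
      ((norm_add_pow_sub_pow_le A₁ R n).trans ?_))
    have hmono : ∀ k : ℕ, ∀ x y : ℝ, 0 ≤ x → 0 ≤ y → x ≤ 8 * θ' → y ≤ ε →
        (x + y) ^ k - x ^ k ≤ (8 * θ' + ε) ^ k - (8 * θ') ^ k := by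
      intro k x y hx hy hx' hy'
      have h3 : (x + y) ^ k ≤ (x + ε) ^ k := by gcongr
      have h4 : (x + ε) ^ k - x ^ k ≤ (8 * θ' + ε) ^ k - (8 * θ') ^ k := by
        induction k with
        | zero => simp
        | succ k ih =>
          have ih' := ih (by gcongr)
          have h5 : x ^ k ≤ (8 * θ') ^ k := by gcongr
          have h6 : 0 ≤ (x + ε) ^ k - x ^ k := by
            have : x ^ k ≤ (x + ε) ^ k := by gcongr; have : 0 < ε := hε0; linarith
            linarith
          have e1 : (x + ε) ^ (k + 1) - x ^ (k + 1) =
            ((x + ε) ^ k - x ^ k) * (x + ε) + x ^ k * ε := by ring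
          have e2 : (8 * θ' + ε) ^ (k + 1) - (8 * θ') ^ (k + 1) =
            ((8 * θ' + ε) ^ k - (8 * θ') ^ k) * (8 * θ' + ε) + (8 * θ') ^ k * ε := by ring
          rw [e1, e2]
          have : 0 < ε := hε0
          gcongr
          exact h6.trans ih'
      linarith
    exact hmono n _ _ (norm_nonneg _) (norm_nonneg _) hA1n hR
  -- Modulo finite rank, `L ^ n` is `(A₁ + R) ^ n`, and `A₁ ^ n` is `A ^ n`, hence `Aₙ`.
  · have e : L ^ n - (Aₙ + ((A₁ + R) ^ n - A₁ ^ n)) =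
        (((A₁ + R) + (F₁ + F)) ^ n - (A₁ + R) ^ n) - ((A₁ + F₁) ^ n - A₁ ^ n) + Fₙ := by
      have h3 : L = (A₁ + R) + (F₁ + F) := by rw [hL, hA1]; abel
      have h4 : (A₁ + F₁) ^ n = Aₙ + Fₙ := by rw [← hA1, hAn]
      rw [h4, ← h3]; abel
    rw [e]
    exact hasFiniteRange_add (hasFiniteRange_sub
      (hasFiniteRange_add_pow_sub_pow (hasFiniteRange_add hF1 hF) _ _)
      (hasFiniteRange_add_pow_sub_pow hF1 _ _)) hFn

lemma isUnit_algebraMap_sub [CompleteSpace E] [Nontrivial E] {B : E →L[ℂ] E} {w : ℂ}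
    (h : ‖B‖ < ‖w‖) : IsUnit (algebraMap ℂ (E →L[ℂ] E) w - B) := by
  by_contra hn
  have : w ∈ spectrum ℂ B := hn
  exact absurd (spectrum.norm_le_norm_of_mem this) (not_le.2 h)

/-- The factorisation `z ^ n - L ^ n = Q (z - L) = (z - L) Q`, with `Q` the geometric sum, transfers
invertibility modulo finite rank from `z ^ n - L ^ n` to `z - L`. For the former it holds because `z
^ n - B` is invertible when `‖B‖ < ‖z‖ ^ n`. -/
lemma isFredholm_of_essNormLE_pow [CompleteSpace E] [Nontrivial E] {L : E →L[ℂ] E} {n : ℕ}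
    {t : ℝ} (hL : EssNormLE (L ^ n) t) {z : ℂ} (ht : t < ‖z‖ ^ n) :
    (algebraMap ℂ (E →L[ℂ] E) z - L).IsFredholm := by
  obtain ⟨B, F, hBF, hB, hF⟩ := hL
  obtain ⟨U, hU⟩ := isUnit_algebraMap_sub (B := B) (w := z ^ n)
    (by rw [norm_pow]; exact hB.trans_lt ht)
  set Z : E →L[ℂ] E := algebraMap ℂ (E →L[ℂ] E) z
  have hcomm : Commute Z L := Algebra.commutes z L
  set Q : E →L[ℂ] E := ∑ i ∈ Finset.range n, Z ^ i * L ^ (n - 1 - i)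
  have hQ : Q * (Z - L) = Z ^ n - L ^ n := hcomm.geom_sum₂_mul n
  have hQ' : (Z - L) * Q = Z ^ n - L ^ n := hcomm.mul_geom_sum₂ n
  set V : E →L[ℂ] E := ↑U⁻¹
  have hUe : (U : E →L[ℂ] E) = Z ^ n - L ^ n + F := by
    rw [hU, hBF, map_pow]; abel
  have hVU : V * (Z ^ n - L ^ n) = 1 - V * F := by
    rw [eq_sub_iff_add_eq, ← mul_add, ← hUe]; exact U.inv_mul
  have hUV : (Z ^ n - L ^ n) * V = 1 - F * V := by
    rw [eq_sub_iff_add_eq, ← add_mul, ← hUe]; exact U.mul_inv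
  have hl : V * Q * (Z - L) = 1 - V * F := by rw [mul_assoc, hQ, hVU]
  have hr : (Z - L) * (Q * V) = 1 - F * V := by rw [← mul_assoc, hQ', hUV]
  -- `V * Q` is a left inverse and `Q * V` a right inverse modulo finite rank. As in any quotient
  -- algebra they then agree, so `V * Q` is a quasi-inverse on both sides.
  have hdiff : (Z - L) * (V * Q) - 1 =
      -(F * V) + (Z - L) * (V * (Q * (F * V))) - (Z - L) * (V * F * (Q * V)) := by
    have h1 : V * Q * ((Z - L) * (Q * V)) = V * Q - V * Q * (F * V) := by
      rw [hr, mul_sub, mul_one]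
    have h2 : V * Q * ((Z - L) * (Q * V)) = Q * V - V * F * (Q * V) := by
      rw [← mul_assoc, hl, sub_mul, one_mul]
    have h3 : V * Q = Q * V - V * F * (Q * V) + V * Q * (F * V) := by
      rw [← h2, h1]; abel
    calc (Z - L) * (V * Q) - 1
        = (Z - L) * (Q * V - V * F * (Q * V) + V * Q * (F * V)) - 1 := by rw [← h3]
      _ = (Z - L) * (Q * V) - 1 - (Z - L) * (V * F * (Q * V)) +
          (Z - L) * (V * (Q * (F * V))) := by noncomm_ring
      _ = _ := by rw [hr]; abel
  refine ContinuousLinearMap.IsFredholm.of_isQuasiInverse (v := V * Q) ⟨?_, ?_⟩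
  · refine LinearMap.FiniteRangeSetoid.equiv_iff_hasFiniteRange.2 ?_
    have : (((V * Q : E →L[ℂ] E) : E →ₗ[ℂ] E) ∘ₗ ((Z - L : E →L[ℂ] E) : E →ₗ[ℂ] E) -
      LinearMap.id) = ((-(V * F) : E →L[ℂ] E) : E →ₗ[ℂ] E) := by
      have : V * Q * (Z - L) - 1 = -(V * F) := by rw [hl]; abel
      rw [← this]; rfl
    rw [this]
    exact hasFiniteRange_neg (hasFiniteRange_mul_left hF _)
  · refine LinearMap.FiniteRangeSetoid.equiv_iff_hasFiniteRange.2 ?_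
    have : (((Z - L : E →L[ℂ] E) : E →ₗ[ℂ] E) ∘ₗ ((V * Q : E →L[ℂ] E) : E →ₗ[ℂ] E) -
      LinearMap.id) = (((Z - L) * (V * Q) - 1 : E →L[ℂ] E) : E →ₗ[ℂ] E) := rfl
    rw [this, hdiff]
    have hFV := hasFiniteRange_mul_right hF V
    exact hasFiniteRange_sub (hasFiniteRange_add (hasFiniteRange_neg hFV)
      (hasFiniteRange_mul_left (hasFiniteRange_mul_left (hasFiniteRange_mul_left hFV _) _) _))
      (hasFiniteRange_mul_left (hasFiniteRange_mul_right (hasFiniteRange_mul_left hF _) _) _)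

/-- This is the Fredholm alternative: `z ^ n - L ^ n` is an invertible operator times identity minus
finite rank, so injectivity gives bijectivity. The spectral mapping property for powers then yields
the claim for `z` itself. -/
lemma notMem_spectrum_of_essNormLE_pow [CompleteSpace E] [Nontrivial E] {L : E →L[ℂ] E} {n : ℕ}
    {t : ℝ} (hL : EssNormLE (L ^ n) t) {z : ℂ} (ht : t < ‖z‖ ^ n)
    (hinj : ∀ x, (L ^ n) x = z ^ n • x → x = 0) : z ∉ spectrum ℂ L := by
  obtain ⟨B, F, hBF, hB, hF⟩ := hL
  obtain ⟨U, hU⟩ := isUnit_algebraMap_sub (B := B) (w := z ^ n)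
    (by rw [norm_pow]; exact hB.trans_lt ht)
  intro hz
  refine absurd (spectrum.pow_mem_pow L n hz) ?_
  rw [spectrum.mem_iff, not_not]
  set W : E →L[ℂ] E := algebraMap ℂ (E →L[ℂ] E) (z ^ n)
  have hW : W - L ^ n = (U : E →L[ℂ] E) * (1 - (↑U⁻¹ : E →L[ℂ] E) * F) := by
    rw [mul_sub, mul_one, Units.mul_inv_cancel_left, hU, hBF]; abel
  have hker : (W - L ^ n).ker = ⊥ := by
    rw [Submodule.eq_bot_iff]
    intro x hx
    refine hinj x ?_
    have h1 : W x - (L ^ n) x = 0 := hx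
    rw [sub_eq_zero] at h1
    rw [← h1]
    simp [W, Algebra.algebraMap_eq_smul_one]
  have hsurj : Function.Surjective (1 - (↑U⁻¹ : E →L[ℂ] E) * F : E →L[ℂ] E) := by
    set G : E →L[ℂ] E := (↑U⁻¹ : E →L[ℂ] E) * F
    have hG : (G : E →ₗ[ℂ] E).HasFiniteRange := hasFiniteRange_mul_left hF _
    have hinj' : Function.Injective (1 - G : E →L[ℂ] E) := by
      refine (injective_iff_map_eq_zero _).2 fun x hx => ?_
      have : x ∈ (W - L ^ n).ker := by
        change (W - L ^ n) x = 0
        rw [hW]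
        change (U : E →L[ℂ] E) ((1 - G : E →L[ℂ] E) x) = 0
        rw [hx, map_zero]
      rwa [hker, Submodule.mem_bot] at this
    let S := (G : E →ₗ[ℂ] E).range
    have : FiniteDimensional ℂ S := Module.Finite.of_fg hG.fg_range
    have hmem : ∀ y ∈ S, (1 - G : E →L[ℂ] E) y ∈ S := fun y hy => by
      change y - G y ∈ S
      exact S.sub_mem hy ⟨y, rfl⟩
    let D : S →ₗ[ℂ] S := ((1 - G : E →L[ℂ] E) : E →ₗ[ℂ] E).restrict hmem
    have hD : Function.Injective D := fun x y hxy => Subtype.ext (hinj' (congrArg Subtype.val hxy))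
    intro y
    obtain ⟨s, hs⟩ := (LinearMap.injective_iff_surjective.1 hD) ⟨G y, y, rfl⟩
    -- `1 - G` preserves the finite-dimensional range of `G`, where injectivity allows solving `(1 -
    -- G) s = G y`. Then `(1 - G) (y + s) = y`.
    refine ⟨y + s, ?_⟩
    have hs' : (s : E) - G s = G y := congrArg Subtype.val hs
    change y + s - G (y + s) = y
    rw [map_add, ← hs']; abel
  have hrange : (W - L ^ n).range = ⊤ := by
    rw [LinearMap.range_eq_top, hW]
    intro y
    obtain ⟨x, hx⟩ := hsurj ((↑U⁻¹ : E →L[ℂ] E) y)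
    refine ⟨x, ?_⟩
    change (U : E →L[ℂ] E) ((1 - (↑U⁻¹ : E →L[ℂ] E) * F : E →L[ℂ] E) x) = y
    rw [hx]
    change ((U : E →L[ℂ] E) * (↑U⁻¹ : E →L[ℂ] E)) y = y
    rw [U.mul_inv]; rfl
  rw [ContinuousLinearMap.isUnit_iff_bijective]
  exact ⟨LinearMap.ker_eq_bot.1 hker, LinearMap.range_eq_top.1 hrange⟩

end EssentialNorm

end ExpandingMap

/-! ### Test functions and pairings -/

namespace ExpandingMap

/-- `φ` is a globally defined `C¹` function with bounded derivative `u`, and its `α`-Hölder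
seminorm on `[0,1]` is at most one. -/
structure IsTest (α : ℝ) (φ u : ℝ → ℂ) : Prop where
  continuous : Continuous u
  bounded : ∃ C : ℝ, ∀ x, ‖u x‖ ≤ C
  hasDerivAt : ∀ x, HasDerivAt φ (u x) x
  holder : ∀ x ∈ Icc (0 : ℝ) 1, ∀ y ∈ Icc (0 : ℝ) 1, ‖φ x - φ y‖ ≤ |x - y| ^ α

lemma norm_sub_le_of_holderNorm_le {α : ℝ} (h0 : 0 ≤ α) {φ : ℝ → ℂ} (hφ : holderNorm α φ ≤ 1)
    {x y : ℝ} (hx : x ∈ Icc (0 : ℝ) 1) (hy : y ∈ Icc (0 : ℝ) 1) :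
    ‖φ x - φ y‖ ≤ |x - y| ^ α := by
  rcases eq_or_ne x y with rfl | hxy
  · simp only [sub_self, norm_zero]; positivity
  have h1 : ‖φ x - φ y‖ₑ / ‖x - y‖ₑ ^ α ≤ 1 := by
    refine le_trans ?_ (le_add_self.trans hφ)
    exact le_iSup₂_of_le x hx (le_iSup₂_of_le y hy le_rfl)
  have hne : ‖x - y‖ₑ ≠ 0 := by simpa [sub_eq_zero] using hxy
  have h2 : ‖φ x - φ y‖ₑ ≤ ‖x - y‖ₑ ^ α := by
    have h3 : ‖x - y‖ₑ ^ α ≠ 0 := by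
      simp [ENNReal.rpow_eq_zero_iff, hne, enorm_ne_top]
    have h4 : ‖x - y‖ₑ ^ α ≠ ∞ := ENNReal.rpow_ne_top_of_nonneg h0 enorm_ne_top
    simpa using (ENNReal.div_le_iff h3 h4).1 h1
  rw [← ofReal_norm, ← ofReal_norm, Real.norm_eq_abs,
    ENNReal.ofReal_rpow_of_nonneg (abs_nonneg _) h0] at h2
  exact (ENNReal.ofReal_le_ofReal_iff (by positivity)).1 h2

/-- Only the derivative on `[0,1]` enters the pairing. Extending it by constants beyond the
endpoints and integrating gives a test function differentiable at every real point, to which the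
ordinary chain rule applies. -/
lemma exists_isTest {α : ℝ} (h0 : 0 ≤ α) {φ : ℝ → ℂ} (hφ : ContDiffOn ℝ 1 φ (Icc (0 : ℝ) 1))
    (hn : holderNorm α φ ≤ 1) :
    ∃ Φ u : ℝ → ℂ, IsTest α Φ u ∧ EqOn u (derivWithin φ (Icc (0 : ℝ) 1)) (Icc 0 1) := by
  have hc := continuousOn_derivWithin hφ
  set u : ℝ → ℂ := IccExtend (zero_le_one' ℝ)
    ((Icc (0 : ℝ) 1).domRestrict (derivWithin φ (Icc (0 : ℝ) 1)))
  have hu : Continuous u := hc.domRestrict.Icc_extend'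
  have hue : EqOn u (derivWithin φ (Icc (0 : ℝ) 1)) (Icc 0 1) := fun x hx => by
    simp only [u, IccExtend_of_mem (zero_le_one' ℝ) _ hx, domRestrict_apply]
  obtain ⟨C, hC⟩ := isCompact_Icc.exists_bound_of_continuousOn hc
  have hd : ∀ x, HasDerivAt (fun x => φ 0 + ∫ t in (0 : ℝ)..x, u t) (u x) x := fun x =>
    (intervalIntegral.integral_hasDerivAt_right (hu.intervalIntegrable _ _)
      hu.stronglyMeasurable.stronglyMeasurableAtFilter hu.continuousAt).const_add _
  have heq : ∀ x ∈ Icc (0 : ℝ) 1, φ 0 + ∫ t in (0 : ℝ)..x, u t = φ x := by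
    intro x hx
    rw [intervalIntegral.integral_eq_sub_of_hasDerivAt_of_le (f := φ) hx.1
      (hφ.continuousOn.mono (Icc_subset_Icc_right hx.2)) ?_ (hu.intervalIntegrable _ _)]
    · abel
    · intro y hy
      have hy' : y ∈ Icc (0 : ℝ) 1 := ⟨hy.1.le, hy.2.le.trans hx.2⟩
      rw [hue hy']
      exact ((hφ.differentiableOn one_ne_zero) y hy').hasDerivWithinAt.hasDerivAt
        (Icc_mem_nhds hy.1 (hy.2.trans_le hx.2))
  refine ⟨fun x => φ 0 + ∫ t in (0 : ℝ)..x, u t, u, ⟨hu, ⟨C, ?_⟩, hd, ?_⟩, hue⟩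
  · intro x
    exact hC _ (Subtype.prop (projIcc (0 : ℝ) 1 (zero_le_one' ℝ) x))
  · intro x hx y hy
    simp only [heq x hx, heq y hy]
    exact norm_sub_le_of_holderNorm_le h0 hn hx hy

lemma bNorm_le_of_isTest {α : ℝ} (h0 : 0 ≤ α) (k : Lp ℂ 1 leb) {B : ℝ}
    (hB : ∀ φ u : ℝ → ℂ, IsTest α φ u → ‖∫ x, k x * u x ∂leb‖ ≤ B) :
    bNorm α k ≤ ENNReal.ofReal B := by
  refine iSup_le fun φ => iSup_le fun hφ => iSup_le fun hn => ?_
  obtain ⟨Φ, u, hΦ, hu⟩ := exists_isTest h0 hφ hn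
  rw [← ofReal_norm]
  refine ENNReal.ofReal_le_ofReal (le_trans (le_of_eq ?_) (hB Φ u hΦ))
  congr 1
  exact setIntegral_congr_fun measurableSet_Icc fun x hx => by simp only [hu hx]

/-- The norm of a test function is a supremum plus a seminorm. When each is at most `K`, dividing by
`2 * K` makes the function admissible; this is the origin of the factor `2` in the later pairing
bounds. -/
lemma enorm_pairing_le {α : ℝ} (h0 : 0 ≤ α) (h : Lp ℂ 1 leb) {φ : ℝ → ℂ}
    (hφ : ContDiffOn ℝ 1 φ (Icc (0 : ℝ) 1)) {K : ℝ} (hK : 0 < K)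
    (h1 : ∀ x ∈ Icc (0 : ℝ) 1, ‖φ x‖ ≤ K)
    (h2 : ∀ x ∈ Icc (0 : ℝ) 1, ∀ y ∈ Icc (0 : ℝ) 1, ‖φ x - φ y‖ ≤ K * |x - y| ^ α) :
    ‖pairing h φ‖ₑ ≤ ENNReal.ofReal (2 * K) * bNorm α h := by
  set c : ℂ := ((2 * K : ℝ) : ℂ)
  have hc : c ≠ 0 := by simp [c, hK.ne']
  have hcn : ‖c⁻¹‖ = (2 * K)⁻¹ := by
    rw [norm_inv, Complex.norm_real, Real.norm_of_nonneg (by positivity)]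
  have hn : holderNorm α (fun x => c⁻¹ * φ x) ≤ 1 := by
    have e : (1 : ℝ≥0∞) = ENNReal.ofReal (1 / 2) + ENNReal.ofReal (1 / 2) := by
      rw [← ENNReal.ofReal_add (by norm_num) (by norm_num)]; norm_num
    rw [e]
    refine add_le_add (iSup₂_le fun x hx => ?_) (iSup₂_le fun x hx => iSup₂_le fun y hy => ?_)
    · rw [← ofReal_norm, norm_mul, hcn]
      refine ENNReal.ofReal_le_ofReal ?_
      rw [mul_inv, mul_assoc, inv_eq_one_div 2]
      have := inv_mul_le_one₀ (a := K) (b := ‖φ x‖) hK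
      have := this.2 (h1 x hx)
      linarith
    · refine ENNReal.div_le_of_le_mul ?_
      rw [← mul_sub, ← ofReal_norm, norm_mul, hcn, ← ofReal_norm (x - y),
        ENNReal.ofReal_rpow_of_nonneg (norm_nonneg _) h0,
        ← ENNReal.ofReal_mul (by positivity)]
      refine ENNReal.ofReal_le_ofReal ?_
      rw [inv_mul_le_iff₀ (by positivity), Real.norm_eq_abs (x - y)]
      refine (h2 x hx y hy).trans (le_of_eq (by ring))
  have h3 : pairing h φ = c * pairing h (fun x => c⁻¹ * φ x) := by
    unfold pairing
    rw [← integral_const_mul]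
    refine setIntegral_congr_fun measurableSet_Icc fun x hx => ?_
    have hd := ((((hφ.differentiableOn one_ne_zero) x hx).hasDerivWithinAt).const_mul
      c⁻¹).derivWithin (uniqueDiffOn_Icc zero_lt_one x hx)
    simp only [hd]
    field_simp
  rw [h3, enorm_mul]
  refine mul_le_mul' (le_of_eq ?_) (pairing_le_bNorm h (contDiffOn_const.mul hφ) hn)
  rw [← ofReal_norm, Complex.norm_real, Real.norm_of_nonneg (by positivity)]

/-- The pairing of `h` with a bounded function whose primitive is Hölder continuous, but which
need not be continuous, is still controlled by `‖h‖_α`. -/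
lemma enorm_integral_mul_le {α : ℝ} (h0 : 0 ≤ α) (h : Lp ℂ 1 leb) {u : ℝ → ℂ}
    (hu : Measurable u) {C : ℝ} (hC : ∀ x, ‖u x‖ ≤ C) {K : ℝ} (hK : 0 < K)
    (hH : ∀ x ∈ Icc (0 : ℝ) 1, ∀ y ∈ Icc (0 : ℝ) 1, x ≤ y →
      ‖∫ t in x..y, u t‖ ≤ K * (y - x) ^ α) :
    ‖∫ x, h x * u x ∂leb‖ₑ ≤ ENNReal.ofReal (2 * K) * bNorm α h := by
  -- With `u` cut off outside `[0,1]`, the primitive `U` is constant on either side. Precomposing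
  -- with the projection `cl` onto `[0,1]` then extends the Hölder bound to the whole line, as
  -- needed for averages that look slightly beyond `1`.
  set v : ℝ → ℂ := (Icc (0 : ℝ) 1).indicator u
  have hv : Measurable v := hu.indicator measurableSet_Icc
  have hvC : ∀ x, ‖v x‖ ≤ C := fun x => (norm_indicator_le_norm_self u x).trans (hC x)
  have hC0 : 0 ≤ C := (norm_nonneg _).trans (hC 0)
  have hvi : Integrable v := by
    rw [integrable_indicator_iff measurableSet_Icc]
    exact Measure.integrableOn_of_bounded (M := C) (by simp) hu.aestronglyMeasurable
      (Filter.Eventually.of_forall hC)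
  have hvI : ∀ x y, IntervalIntegrable v volume x y := fun x y => hvi.intervalIntegrable
  set U : ℝ → ℂ := fun x => ∫ t in (0 : ℝ)..x, v t
  have hUc : Continuous U := intervalIntegral.continuous_primitive hvI 0
  have hUd : ∀ x y, U y - U x = ∫ t in x..y, v t := fun x y =>
    intervalIntegral.integral_interval_sub_left (hvI _ _) (hvI _ _)
  have hUL : ∀ x y, ‖U y - U x‖ ≤ C * |y - x| := fun x y => by
    rw [hUd]
    exact intervalIntegral.norm_integral_le_of_norm_le_const fun t _ => hvC t
  set cl : ℝ → ℝ := fun x => max 0 (min 1 x)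
  have hcl : ∀ x, cl x ∈ Icc (0 : ℝ) 1 := fun x =>
    ⟨le_max_left _ _, max_le zero_le_one (min_le_left _ _)⟩
  have hclU : ∀ x, U (cl x) = U x := by
    intro x
    rw [← sub_eq_zero, hUd]
    rcases le_total x 0 with hx | hx
    · have : cl x = 0 := by simp [cl, hx]
      rw [this, intervalIntegral.integral_of_le hx]
      rw [← integral_Ico_eq_integral_Ioc]
      refine setIntegral_eq_zero_of_forall_eq_zero fun t ht => ?_
      exact indicator_of_notMem (fun h => not_lt.2 h.1 ht.2) u
    · rcases le_total x 1 with hx1 | hx1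
      · have : cl x = x := by simp [cl, hx, hx1]
        rw [this, intervalIntegral.integral_same]
      · have : cl x = 1 := by simp [cl, hx1]
        rw [this, intervalIntegral.integral_symm, intervalIntegral.integral_of_le hx1, neg_eq_zero]
        refine setIntegral_eq_zero_of_forall_eq_zero fun t ht => ?_
        exact indicator_of_notMem (fun h => not_lt.2 h.2 ht.1) u
  have hclL : ∀ x y, |cl x - cl y| ≤ |x - y| := fun x y => by
    refine (abs_max_sub_max_le_max _ _ _ _).trans ?_
    rw [sub_self, abs_zero, max_eq_right (abs_nonneg _)]
    refine (abs_min_sub_min_le_max _ _ _ _).trans ?_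
    rw [sub_self, abs_zero, max_eq_right (abs_nonneg _)]
  have hUH1 : ∀ x ∈ Icc (0 : ℝ) 1, ∀ y ∈ Icc (0 : ℝ) 1, x ≤ y →
      ‖U y - U x‖ ≤ K * |y - x| ^ α := by
    intro x hx y hy hxy
    rw [hUd, abs_of_nonneg (sub_nonneg.2 hxy)]
    refine le_trans (le_of_eq ?_) (hH x hx y hy hxy)
    congr 1
    refine intervalIntegral.integral_congr fun t ht => ?_
    rw [uIcc_of_le hxy] at ht
    have hmem : t ∈ Icc (0 : ℝ) 1 := ⟨hx.1.trans ht.1, ht.2.trans hy.2⟩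
    simp only [v, indicator_of_mem hmem]
  have hUH : ∀ x y, ‖U y - U x‖ ≤ K * |y - x| ^ α := by
    intro x y
    rw [← hclU x, ← hclU y]
    have h1 : |cl y - cl x| ^ α ≤ |y - x| ^ α :=
      Real.rpow_le_rpow (abs_nonneg _) (hclL y x) h0
    refine le_trans ?_ (mul_le_mul_of_nonneg_left h1 hK.le)
    rcases le_total (cl x) (cl y) with h | h
    · exact hUH1 _ (hcl x) _ (hcl y) h
    · rw [norm_sub_rev, abs_sub_comm]
      exact hUH1 _ (hcl y) _ (hcl x) h
  have hUK : ∀ x, ‖U x‖ ≤ K := by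
    intro x
    have hU0 : U 0 = 0 := intervalIntegral.integral_same
    rw [← hclU x]
    have := hUH 0 (cl x)
    rw [hU0, sub_zero, sub_zero] at this
    refine this.trans (mul_le_of_le_one_right hK.le ?_)
    exact Real.rpow_le_one (abs_nonneg _) (by rw [abs_of_nonneg (hcl x).1]; exact (hcl x).2) h0
  -- Steklov averages
  set δ : ℕ → ℝ := fun n => 1 / ((n : ℝ) + 1)
  have hδ : ∀ n, 0 < δ n := fun n => by positivity
  have hδ0 : Filter.Tendsto δ Filter.atTop (nhds 0) := tendsto_one_div_add_atTop_nhds_zero_nat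
  set d : ℕ → ℝ → ℂ := fun n x => ((δ n)⁻¹ : ℝ) • (U (x + δ n) - U x)
  set Φ : ℕ → ℝ → ℂ := fun n x => ((δ n)⁻¹ : ℝ) • ∫ s in (0 : ℝ)..δ n, U (s + x)
  have hΦd : ∀ n x, HasDerivAt (Φ n) (d n x) x := by
    intro n x
    have e : ∀ x, ∫ s in (0 : ℝ)..δ n, U (s + x) =
        (∫ s in (0 : ℝ)..(x + δ n), U s) - ∫ s in (0 : ℝ)..x, U s := by
      intro x
      rw [intervalIntegral.integral_comp_add_right, zero_add, add_comm (δ n) x,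
        intervalIntegral.integral_interval_sub_left (hUc.intervalIntegrable _ _)
          (hUc.intervalIntegrable _ _)]
    have hP : ∀ y, HasDerivAt (fun y => ∫ s in (0 : ℝ)..y, U s) (U y) y := fun y =>
      intervalIntegral.integral_hasDerivAt_right (hUc.intervalIntegrable _ _)
        hUc.stronglyMeasurable.stronglyMeasurableAtFilter hUc.continuousAt
    have h1 := (((hP (x + δ n)).comp_add_const x (δ n)).sub (hP x)).const_smul ((δ n)⁻¹ : ℝ)
    refine h1.congr_of_eventuallyEq (Filter.Eventually.of_forall fun y => ?_)
    simp only [Φ, e]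
    rfl
  have hdc : ∀ n, Continuous (d n) := fun n => by fun_prop
  have hΦC : ∀ n, ContDiffOn ℝ 1 (Φ n) (Icc (0 : ℝ) 1) := by
    intro n
    refine ContDiff.contDiffOn (contDiff_one_iff_deriv.2
      ⟨fun x => (hΦd n x).differentiableAt, ?_⟩)
    rw [funext fun x => (hΦd n x).deriv]
    exact hdc n
  have hav : ∀ n (F : ℝ → ℂ) (M : ℝ), (∀ s, ‖F s‖ ≤ M) →
      ‖((δ n)⁻¹ : ℝ) • ∫ s in (0 : ℝ)..δ n, F s‖ ≤ M := by
    intro n F M hM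
    rw [norm_smul, norm_inv, Real.norm_of_nonneg (hδ n).le, inv_mul_le_iff₀ (hδ n)]
    refine (intervalIntegral.norm_integral_le_of_norm_le_const fun t _ => hM t).trans ?_
    rw [sub_zero, abs_of_pos (hδ n), mul_comm]
  have hbound : ∀ n, ‖∫ x, h x * d n x ∂leb‖ₑ ≤ ENNReal.ofReal (2 * K) * bNorm α h := by
    intro n
    refine le_trans (le_of_eq ?_) (enorm_pairing_le h0 h (hΦC n) hK (fun x _ => ?_)
      fun x _ y _ => ?_)
    · congr 1
      refine setIntegral_congr_fun measurableSet_Icc fun x hx => ?_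
      simp only [((hΦd n x).hasDerivWithinAt.derivWithin (uniqueDiffOn_Icc zero_lt_one x hx))]
    · exact hav n _ _ fun s => hUK _
    · have : Φ n x - Φ n y = ((δ n)⁻¹ : ℝ) • ∫ s in (0 : ℝ)..δ n, (U (s + x) - U (s + y)) := by
        simp only [Φ]
        rw [← smul_sub, ← intervalIntegral.integral_sub]
        · exact (by fun_prop : Continuous fun s => U (s + x)).intervalIntegrable _ _
        · exact (by fun_prop : Continuous fun s => U (s + y)).intervalIntegrable _ _
      rw [this]
      refine hav n _ _ fun s => (hUH _ _).trans (le_of_eq ?_)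
      congr 3
      ring
  -- The averages inherit the supremum and Hölder bounds of `U`. Their derivatives are difference
  -- quotients of `U`, bounded by `C` and convergent to `u` almost everywhere on `[0,1]` by Lebesgue
  -- differentiation.
  have hlim : Filter.Tendsto (fun n => ∫ x, h x * d n x ∂leb) Filter.atTop
      (nhds (∫ x, h x * u x ∂leb)) := by
    refine tendsto_integral_of_dominated_convergence (fun x => ‖h x‖ * C) ?_ ?_ ?_ ?_
    · exact fun n => (L1.integrable_coeFn h).aestronglyMeasurable.mul
        (hdc n).aestronglyMeasurable
    · exact (L1.integrable_coeFn h).norm.mul_const C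
    · refine fun n => Filter.Eventually.of_forall fun x => ?_
      rw [norm_mul]
      gcongr
      rw [norm_smul, norm_inv, Real.norm_of_nonneg (hδ n).le, inv_mul_le_iff₀ (hδ n)]
      refine (hUL _ _).trans (le_of_eq ?_)
      rw [add_sub_cancel_left, abs_of_pos (hδ n), mul_comm]
    · have hae := LocallyIntegrable.ae_hasDerivAt_integral hvi.locallyIntegrable
      filter_upwards [ae_restrict_of_ae hae, ae_restrict_mem measurableSet_Icc] with x hx hxI
      have h1 : HasDerivAt U (u x) x := by
        have := hx 0
        rwa [show v x = u x from indicator_of_mem hxI u] at this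
      refine Filter.Tendsto.const_mul _ ?_
      have h2 : Filter.Tendsto δ Filter.atTop (nhdsWithin 0 {0}ᶜ) :=
        tendsto_nhdsWithin_iff.2 ⟨hδ0, Filter.Eventually.of_forall fun n => (hδ n).ne'⟩
      exact h1.tendsto_slope_zero.comp h2
  exact le_of_tendsto hlim.enorm (Filter.Eventually.of_forall hbound)

/-! ### The Banach space `𝓑_α` and its embedding in `L¹` -/

namespace BSpace

variable {α : unitInterval}

/-- The element of `𝓑_α` given by an element of `L¹` of finite norm. -/
def mk (k : Lp ℂ 1 leb) (hk : bNorm α k ≠ ∞) : BSpace α := (⟨k, hk⟩ : bSubmodule α)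

@[simp] lemma toL1_mk (k : Lp ℂ 1 leb) (hk : bNorm α k ≠ ∞) : toL1 (mk k hk) = k := rfl

lemma ofReal_norm_eq (h : BSpace α) : ENNReal.ofReal ‖h‖ = bNorm α (toL1 h) := by
  rw [norm_def, ENNReal.ofReal_toReal (bNorm_ne_top h)]

lemma norm_le_of_isTest (h : BSpace α) {B : ℝ} (hB0 : 0 ≤ B)
    (hB : ∀ φ u : ℝ → ℂ, IsTest α φ u → ‖∫ x, toL1 h x * u x ∂leb‖ ≤ B) : ‖h‖ ≤ B := by
  have := bNorm_le_of_isTest α.2.1 (toL1 h) hB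
  rw [← ofReal_norm_eq] at this
  exact (ENNReal.ofReal_le_ofReal_iff hB0).1 this

lemma norm_integral_mul_le (h : BSpace α) {u : ℝ → ℂ} (hu : Measurable u) {C : ℝ}
    (hC : ∀ x, ‖u x‖ ≤ C) {K : ℝ} (hK : 0 ≤ K)
    (hH : ∀ x ∈ Icc (0 : ℝ) 1, ∀ y ∈ Icc (0 : ℝ) 1, x ≤ y →
      ‖∫ t in x..y, u t‖ ≤ K * (y - x) ^ (α : ℝ)) :
    ‖∫ x, toL1 h x * u x ∂leb‖ ≤ 2 * K * ‖h‖ := by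
  -- Rescaling a test function requires a positive constant; the value `K = 0` is reached by letting
  -- `K'` decrease to `K`.
  have key : ∀ K' > K, ‖∫ x, toL1 h x * u x ∂leb‖ ≤ 2 * K' * ‖h‖ := by
    intro K' hK'
    have h1 := enorm_integral_mul_le α.2.1 (toL1 h) hu hC (hK.trans_lt hK')
      fun x hx y hy hxy => (hH x hx y hy hxy).trans
        (mul_le_mul_of_nonneg_right hK'.le (Real.rpow_nonneg (sub_nonneg.2 hxy) _))
    have hK0 : 0 < K' := hK.trans_lt hK'
    rw [← ofReal_norm_eq, ← ofReal_norm, ← ENNReal.ofReal_mul (by positivity)] at h1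
    exact (ENNReal.ofReal_le_ofReal_iff (by positivity)).1 h1
  have hlim : Filter.Tendsto (fun K' : ℝ => 2 * K' * ‖h‖) (nhdsWithin K (Ioi K))
      (nhds (2 * K * ‖h‖)) :=
    ((by fun_prop : Continuous fun K' : ℝ => 2 * K' * ‖h‖).tendsto K).mono_left
      nhdsWithin_le_nhds
  exact ge_of_tendsto hlim (Filter.eventually_of_mem self_mem_nhdsWithin key)

lemma norm_integral_test_le (h : BSpace α) {φ u : ℝ → ℂ} (hφ : IsTest α φ u) :
    ‖∫ x, toL1 h x * u x ∂leb‖ ≤ 2 * ‖h‖ := by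
  obtain ⟨C, hC⟩ := hφ.bounded
  have := norm_integral_mul_le h hφ.continuous.measurable hC zero_le_one fun x hx y hy hxy => by
    rw [intervalIntegral.integral_eq_sub_of_hasDerivAt (fun t _ => hφ.hasDerivAt t)
      (hφ.continuous.intervalIntegrable _ _), one_mul]
    have := hφ.holder y hy x hx
    rwa [abs_of_nonneg (sub_nonneg.2 hxy)] at this
  simpa using this

/-- Pair with the conjugate phase of `h`: it is bounded by one, so its primitive is `1`-Lipschitz,
hence `α`-Hölder with constant one on `[0,1]`. -/
lemma norm_toL1_le (h : BSpace α) : ‖toL1 h‖ ≤ 2 * ‖h‖ := by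
  have hm : Measurable (toL1 h : ℝ → ℂ) := (Lp.stronglyMeasurable _).measurable
  set u : ℝ → ℂ := fun x => (starRingEnd ℂ) (toL1 h x) / ((‖toL1 h x‖ : ℝ) : ℂ)
  have hu : Measurable u := (Complex.continuous_conj.measurable.comp hm).div
    (Complex.measurable_ofReal.comp hm.norm)
  have hu1 : ∀ x, ‖u x‖ ≤ 1 := fun x => by
    simp only [u, norm_div, Complex.norm_real, RCLike.norm_conj, norm_norm]
    exact div_self_le_one _
  have h1 := norm_integral_mul_le h hu hu1 zero_le_one fun x hx y hy hxy => by
    refine (intervalIntegral.norm_integral_le_of_norm_le_const fun t _ => hu1 t).trans ?_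
    rw [abs_of_nonneg (sub_nonneg.2 hxy), one_mul, one_mul]
    exact Real.self_le_rpow_of_le_one (sub_nonneg.2 hxy) (by linarith [hx.1, hy.2]) α.2.2
  have h2 : ∫ x, toL1 h x * u x ∂leb = ((∫ x, ‖toL1 h x‖ ∂leb : ℝ) : ℂ) := by
    rw [← integral_complex_ofReal]
    refine integral_congr_ae (Filter.Eventually.of_forall fun x => ?_)
    simp only [u]
    rw [← mul_div_assoc, Complex.mul_conj, Complex.normSq_eq_norm_sq]
    by_cases hx : ‖toL1 h x‖ = 0
    · simp [hx]
    · push_cast; field_simp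
  rw [h2, Complex.norm_real, ← L1.norm_eq_integral_norm, norm_norm] at h1
  simpa using h1

/-- The inclusion of `𝓑_α` into `L¹` as a continuous linear map. -/
def toL1CLM : BSpace α →L[ℂ] Lp ℂ 1 leb := toL1.mkContinuous 2 norm_toL1_le

@[simp] lemma toL1CLM_apply (h : BSpace α) : toL1CLM h = toL1 h := rfl

lemma integrable_mul_of_bounded (k : Lp ℂ 1 leb) {u : ℝ → ℂ}
    (hu : Measurable u) {C : ℝ} (hC : ∀ x, ‖u x‖ ≤ C) : Integrable (fun x => k x * u x) leb :=
  (L1.integrable_coeFn k).mul_bdd (c := C) hu.aestronglyMeasurable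
    (Filter.Eventually.of_forall hC)

/-- Integration of elements of `L¹` against a bounded function. -/
lemma exists_integral_clm {u : ℝ → ℂ} (hu : Measurable u) {C : ℝ} (hC : ∀ x, ‖u x‖ ≤ C) :
    ∃ Λ : Lp ℂ 1 leb →L[ℂ] ℂ, ∀ k, Λ k = ∫ x, k x * u x ∂leb := by
  refine ⟨LinearMap.mkContinuous
    { toFun := fun k => ∫ x, k x * u x ∂leb
      map_add' := fun k l => ?_
      map_smul' := fun c k => ?_ } C fun k => ?_, fun k => rfl⟩
  · rw [← integral_add (integrable_mul_of_bounded k hu hC) (integrable_mul_of_bounded l hu hC)]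
    refine integral_congr_ae ?_
    filter_upwards [Lp.coeFn_add k l] with x hx
    rw [hx, Pi.add_apply, add_mul]
  · rw [RingHom.id_apply, smul_eq_mul, ← integral_const_mul]
    refine integral_congr_ae ?_
    filter_upwards [Lp.coeFn_smul c k] with x hx
    rw [hx, Pi.smul_apply, smul_eq_mul, mul_assoc]
  · change ‖∫ x, k x * u x ∂leb‖ ≤ C * ‖k‖
    rw [L1.norm_eq_integral_norm, ← integral_const_mul]
    refine norm_integral_le_of_norm_le ((L1.integrable_coeFn k).norm.const_mul C)
      (Filter.Eventually.of_forall fun x => ?_)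
    rw [norm_mul, mul_comm]
    gcongr
    exact hC x

/-- A Cauchy sequence converges in `L¹`, and every test functional is continuous there. The norm is
therefore lower semicontinuous under `L¹` convergence, which identifies the `L¹` limit as the limit
in `𝓑_α`. -/
instance : CompleteSpace (BSpace α) := by
  refine Metric.complete_of_cauchySeq_tendsto fun s hs => ?_
  have hs1 : CauchySeq fun n => toL1CLM (s n) :=
    hs.map (toL1CLM (α := α)).uniformContinuous
  obtain ⟨k, hk⟩ := cauchySeq_tendsto_of_complete hs1
  have key : ∀ ε > 0, ∃ N, ∀ n ≥ N, bNorm α (k - toL1 (s n)) ≤ ENNReal.ofReal (2 * ε) := by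
    intro ε hε
    obtain ⟨N, hN⟩ := Metric.cauchySeq_iff.1 hs ε hε
    refine ⟨N, fun n hn => bNorm_le_of_isTest α.2.1 _ fun φ u hφ => ?_⟩
    obtain ⟨C, hC⟩ := hφ.bounded
    obtain ⟨Λ, hΛ⟩ := exists_integral_clm hφ.continuous.measurable hC
    rw [← hΛ]
    have hlim : Filter.Tendsto (fun m => Λ (toL1CLM (s m) - toL1 (s n))) Filter.atTop
        (nhds (Λ (k - toL1 (s n)))) :=
      (Λ.continuous.tendsto _).comp (hk.sub_const _)
    refine le_of_tendsto hlim.norm (Filter.eventually_atTop.2 ⟨N, fun m hm => ?_⟩)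
    rw [toL1CLM_apply, ← map_sub, hΛ]
    refine (norm_integral_test_le _ hφ).trans ?_
    have := hN m hm n hn
    rw [dist_eq_norm] at this
    linarith
  have hkB : bNorm α k ≠ ∞ := by
    obtain ⟨N, hN⟩ := key 1 one_pos
    have h1 := bNorm_add_le α (k - toL1 (s N)) (toL1 (s N))
    rw [sub_add_cancel] at h1
    refine (h1.trans_lt (ENNReal.add_lt_top.2 ⟨?_, (bNorm_ne_top _).lt_top⟩)).ne
    exact (hN N le_rfl).trans_lt ENNReal.ofReal_lt_top
  refine ⟨mk k hkB, Metric.tendsto_atTop.2 fun ε hε => ?_⟩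
  obtain ⟨N, hN⟩ := key (ε / 4) (by positivity)
  refine ⟨N, fun n hn => ?_⟩
  rw [dist_eq_norm, norm_sub_rev]
  have h1 := hN n hn
  have h2 : ENNReal.ofReal ‖mk k hkB - s n‖ ≤ ENNReal.ofReal (2 * (ε / 4)) := by
    rw [ofReal_norm_eq, map_sub]; exact h1
  have h3 := (ENNReal.ofReal_le_ofReal_iff (by positivity)).1 h2
  linarith

/-- An operator on `L¹` satisfying an a priori estimate restricts to `𝓑_α`. -/
lemma exists_restrict (T : Lp ℂ 1 leb →L[ℂ] Lp ℂ 1 leb) {B : ℝ} (hB : 0 ≤ B)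
    (hT : ∀ h : BSpace α, ∀ φ u : ℝ → ℂ, IsTest α φ u →
      ‖∫ x, T (toL1 h) x * u x ∂leb‖ ≤ B * ‖h‖) :
    ∃ T' : BSpace α →L[ℂ] BSpace α, (∀ h, toL1 (T' h) = T (toL1 h)) ∧ ‖T'‖ ≤ B := by
  have hfin : ∀ h : BSpace α, T (toL1 h) ∈ bSubmodule α := fun h =>
    ((bNorm_le_of_isTest α.2.1 _ (hT h)).trans_lt ENNReal.ofReal_lt_top).ne
  let S : BSpace α →ₗ[ℂ] BSpace α :=
    LinearMap.codRestrict (bSubmodule α) ((T : Lp ℂ 1 leb →ₗ[ℂ] Lp ℂ 1 leb) ∘ₗ toL1) hfin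
  have hS : ∀ h, toL1 (S h) = T (toL1 h) := fun h => rfl
  refine ⟨S.mkContinuous B fun h => ?_, hS, LinearMap.mkContinuous_norm_le _ hB _⟩
  exact norm_le_of_isTest _ (by positivity) fun φ u hφ => by rw [hS]; exact hT h φ u hφ

end BSpace

end ExpandingMap

/-! ### The partition and the monotone branches -/

namespace ExpandingMap

variable {ι : Type*}

lemma IsPartition.countable {a b : ι → ℝ} (h : IsPartition a b) : Countable ι :=
  Pairwise.countable_of_isOpen_disjoint h.disjoint (fun _ => isOpen_Ioo)
    fun i => nonempty_Ioo.2 (h.lt i)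

lemma IsPartition.subset {a b : ι → ℝ} (h : IsPartition a b) (i : ι) :
    Ioo (a i) (b i) ⊆ Icc 0 1 :=
  fun _ hx => ⟨(h.nonneg i).trans hx.1.le, hx.2.le.trans (h.le_one i)⟩

lemma isOpen_iUnion_Ioo (a b : ι → ℝ) : IsOpen (⋃ i, Ioo (a i) (b i)) :=
  isOpen_iUnion fun _ => isOpen_Ioo

lemma measurableSet_iUnion_Ioo (a b : ι → ℝ) : MeasurableSet (⋃ i, Ioo (a i) (b i)) :=
  (isOpen_iUnion_Ioo a b).measurableSet

lemma IsPartition.leb_eq {a b : ι → ℝ} (h : IsPartition a b) :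
    leb = volume.restrict (⋃ i, Ioo (a i) (b i)) := by
  refine (Measure.restrict_congr_set ?_).symm
  refine (ae_eq_set.2 ⟨?_, h.full⟩)
  rw [sdiff_eq_empty.2 (iUnion_subset fun i => h.subset i), measure_empty]

lemma IsPartition.lintegral_leb {a b : ι → ℝ} (h : IsPartition a b) (g : ℝ → ℝ≥0∞) :
    ∫⁻ x, g x ∂leb = ∫⁻ x in ⋃ i, Ioo (a i) (b i), g x := by rw [h.leb_eq]

lemma IsPartition.integral_leb {a b : ι → ℝ} (h : IsPartition a b) (g : ℝ → ℂ) :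
    ∫ x, g x ∂leb = ∫ x in ⋃ i, Ioo (a i) (b i), g x := by rw [h.leb_eq]

lemma IsPartition.ae_mem {a b : ι → ℝ} (h : IsPartition a b) :
    ∀ᵐ x ∂leb, x ∈ ⋃ i, Ioo (a i) (b i) := by
  rw [h.leb_eq]
  exact ae_restrict_mem (measurableSet_iUnion_Ioo a b)

namespace IsPiecewiseExpanding

variable {a b : ι → ℝ} {f : ℝ → ℝ}

lemma hasDerivAt (hf : IsPiecewiseExpanding a b f) {i : ι} {x : ℝ} (hx : x ∈ Ioo (a i) (b i)) :
    HasDerivAt f (deriv f x) x :=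
  (((hf.contDiffOn i).contDiffAt (isOpen_Ioo.mem_nhds hx)).differentiableAt
    one_ne_zero).hasDerivAt

lemma continuousOn_deriv (hf : IsPiecewiseExpanding a b f) (i : ι) :
    ContinuousOn (deriv f) (Ioo (a i) (b i)) :=
  (hf.contDiffOn i).continuousOn_deriv_of_isOpen isOpen_Ioo le_rfl

lemma one_le_abs_deriv (hf : IsPiecewiseExpanding a b f) {i : ι} {x : ℝ}
    (hx : x ∈ Ioo (a i) (b i)) : 1 ≤ |deriv f x| := by
  obtain ⟨lam, h1, h2⟩ := hf.expanding
  exact h1.le.trans (h2 i x hx)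

lemma deriv_ne_zero (hf : IsPiecewiseExpanding a b f) {i : ι} {x : ℝ}
    (hx : x ∈ Ioo (a i) (b i)) : deriv f x ≠ 0 :=
  abs_pos.1 (zero_lt_one.trans_le (hf.one_le_abs_deriv hx))

lemma deriv_sign (hf : IsPiecewiseExpanding a b f) (i : ι) :
    (∀ x ∈ Ioo (a i) (b i), 0 < deriv f x) ∨ ∀ x ∈ Ioo (a i) (b i), deriv f x < 0 := by
  have h := isPreconnected_Ioo.image _ (hf.continuousOn_deriv i)
  by_contra hcon
  push Not at hcon
  obtain ⟨⟨x, hx, hx0⟩, y, hy, hy0⟩ := hcon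
  obtain ⟨z, hz, hz0⟩ := h.ordConnected.out (mem_image_of_mem _ hx) (mem_image_of_mem _ hy)
    ⟨hx0, hy0⟩
  exact hf.deriv_ne_zero hz hz0

lemma injOn (hf : IsPiecewiseExpanding a b f) (i : ι) : InjOn f (Ioo (a i) (b i)) := by
  have hc := (hf.contDiffOn i).continuousOn
  rcases hf.deriv_sign i with h | h
  · refine (strictMonoOn_of_deriv_pos (convex_Ioo _ _) hc fun x hx => ?_).injOn
    rw [interior_Ioo] at hx
    exact h x hx
  · refine (strictAntiOn_of_deriv_neg (convex_Ioo _ _) hc fun x hx => ?_).injOn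
    rw [interior_Ioo] at hx
    exact h x hx

lemma continuousOn (hf : IsPiecewiseExpanding a b f) :
    ContinuousOn f (⋃ i, Ioo (a i) (b i)) := by
  intro x hx
  obtain ⟨i, hi⟩ := mem_iUnion.1 hx
  exact (hf.hasDerivAt hi).continuousAt.continuousWithinAt

end IsPiecewiseExpanding

/-! ### The transfer operator on `L¹` -/

/-- The function `η |f'| ψ ∘ f` on the domain of `f`, extended by zero. -/
def pullback (a b : ι → ℝ) (f : ℝ → ℝ) (η ψ : ℝ → ℂ) : ℝ → ℂ :=
  (⋃ i, Ioo (a i) (b i)).indicator fun x => η x * ((|deriv f x| : ℝ) : ℂ) * ψ (f x)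

/-- The contribution of the `i`-th branch to the transfer operator. -/
def branchTransfer (a b : ι → ℝ) (f : ℝ → ℝ) (η : ℝ → ℂ) (i : ι) (h : ℝ → ℂ) : ℝ → ℂ :=
  Function.extend ((Ioo (a i) (b i)).domRestrict f) (fun y => η y * h y) 0

section Transfer

variable {a b : ι → ℝ} {f : ℝ → ℝ} {η : ℝ → ℂ} {ρ : ℝ}

lemma measurable_indicator_comp (hf : IsPiecewiseExpanding a b f) {ψ : ℝ → ℂ}
    (hψ : Measurable ψ) : Measurable ((⋃ i, Ioo (a i) (b i)).indicator fun x => ψ (f x)) := by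
  have hm : Measurable ((⋃ i, Ioo (a i) (b i)).domRestrict f) :=
    (continuousOn_iff_continuous_domRestrict.1 hf.continuousOn).measurable
  refine measurable_of_restrict_of_restrict_compl (measurableSet_iUnion_Ioo a b) ?_ ?_
  · have : (⋃ i, Ioo (a i) (b i)).domRestrict ((⋃ i, Ioo (a i) (b i)).indicator fun x => ψ (f x))
      = ψ ∘ (⋃ i, Ioo (a i) (b i)).domRestrict f := by
      ext x; simp
    rw [this]
    exact hψ.comp hm
  · have : (⋃ i, Ioo (a i) (b i))ᶜ.domRestrict
      ((⋃ i, Ioo (a i) (b i)).indicator fun x => ψ (f x)) = fun _ => 0 := by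
      ext x; simp only [domRestrict_apply]; exact indicator_of_notMem x.2 _
    rw [this]
    exact measurable_const

lemma measurable_pullback (hf : IsPiecewiseExpanding a b f) (hη : Measurable η) {ψ : ℝ → ℂ}
    (hψ : Measurable ψ) : Measurable (pullback a b f η ψ) := by
  have : pullback a b f η ψ = fun x => (η x * ((|deriv f x| : ℝ) : ℂ)) *
      (⋃ i, Ioo (a i) (b i)).indicator (fun x => ψ (f x)) x := by
    ext x
    by_cases hx : x ∈ ⋃ i, Ioo (a i) (b i)
    · rw [pullback, indicator_of_mem hx, indicator_of_mem hx]
    · rw [pullback, indicator_of_notMem hx, indicator_of_notMem hx, mul_zero]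
  rw [this]
  refine (hη.mul (Complex.measurable_ofReal.comp ?_)).mul (measurable_indicator_comp hf hψ)
  exact (measurable_deriv f).abs

lemma norm_pullback_le (hρ0 : 0 ≤ ρ)
    (hρ : ∀ x ∈ ⋃ i, Ioo (a i) (b i), ‖η x‖ * |deriv f x| ≤ ρ) {ψ : ℝ → ℂ} {C : ℝ}
    (hψ : ∀ x, ‖ψ x‖ ≤ C) (x : ℝ) : ‖pullback a b f η ψ x‖ ≤ ρ * C := by
  have hC : 0 ≤ C := (norm_nonneg _).trans (hψ 0)
  by_cases hx : x ∈ ⋃ i, Ioo (a i) (b i)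
  · rw [pullback, indicator_of_mem hx, norm_mul, norm_mul, Complex.norm_real,
      Real.norm_eq_abs, abs_abs]
    exact mul_le_mul (hρ x hx) (hψ _) (norm_nonneg _) hρ0
  · rw [pullback, indicator_of_notMem hx, norm_zero]
    positivity

lemma branchTransfer_apply (hf : IsPiecewiseExpanding a b f) (η h : ℝ → ℂ) {i : ι} {y : ℝ}
    (hy : y ∈ Ioo (a i) (b i)) : branchTransfer a b f η i h (f y) = η y * h y :=
  (injOn_iff_injective.1 (hf.injOn i)).extend_apply (fun y : Ioo (a i) (b i) => η y * h y) 0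
    ⟨y, hy⟩

lemma branchTransfer_of_notMem (η h : ℝ → ℂ) {i : ι} {x : ℝ}
    (hx : x ∉ f '' Ioo (a i) (b i)) : branchTransfer a b f η i h x = 0 := by
  refine Function.extend_apply' _ _ _ ?_
  rintro ⟨y, hy⟩
  exact hx ⟨y, y.2, hy⟩

lemma measurable_branchTransfer (hf : IsPiecewiseExpanding a b f) (hη : Measurable η)
    {h : ℝ → ℂ} (hh : Measurable h) (i : ι) : Measurable (branchTransfer a b f η i h) :=
  (ContinuousOn.measurableEmbedding measurableSet_Ioo (hf.contDiffOn i).continuousOn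
    (hf.injOn i)).measurable_extend ((hη.mul hh).comp measurable_subtype_coe) measurable_const

lemma measurableSet_image_branch (hf : IsPiecewiseExpanding a b f) (i : ι) :
    MeasurableSet (f '' Ioo (a i) (b i)) :=
  measurableSet_Ioo.image_of_continuousOn_injOn (hf.contDiffOn i).continuousOn (hf.injOn i)

lemma lintegral_branchTransfer (hf : IsPiecewiseExpanding a b f) (η h : ℝ → ℂ) (i : ι) :
    ∫⁻ x, ‖branchTransfer a b f η i h x‖ₑ ∂leb =
      ∫⁻ y in Ioo (a i) (b i), ENNReal.ofReal |deriv f y| * ‖η y * h y‖ₑ := by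
  have hsub : f '' Ioo (a i) (b i) ⊆ Icc 0 1 := (hf.mapsTo i).image_subset
  have h1 : ∫⁻ x, ‖branchTransfer a b f η i h x‖ₑ ∂leb =
      ∫⁻ x in f '' Ioo (a i) (b i), ‖branchTransfer a b f η i h x‖ₑ := by
    rw [← lintegral_indicator measurableSet_Icc,
      ← lintegral_indicator (measurableSet_image_branch hf i)]
    refine lintegral_congr fun x => ?_
    by_cases hx : x ∈ f '' Ioo (a i) (b i)
    · rw [indicator_of_mem hx, indicator_of_mem (hsub hx)]
    · have h0 : ‖branchTransfer a b f η i h x‖ₑ = 0 := by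
        rw [branchTransfer_of_notMem _ _ hx, enorm_zero]
      rw [indicator_of_notMem hx]
      exact indicator_apply_eq_zero.2 fun _ => h0
  rw [h1, lintegral_image_eq_lintegral_abs_deriv_mul measurableSet_Ioo
    (fun x hx => (hf.hasDerivAt hx).hasDerivWithinAt) (hf.injOn i)]
  refine setLIntegral_congr_fun measurableSet_Ioo fun y hy => ?_
  simp only [branchTransfer_apply hf η h hy]

lemma integral_branchTransfer (hf : IsPiecewiseExpanding a b f) (η h ψ : ℝ → ℂ) (i : ι) :
    ∫ x, branchTransfer a b f η i h x * ψ x ∂leb =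
      ∫ y in Ioo (a i) (b i), h y * pullback a b f η ψ y := by
  have hsub : f '' Ioo (a i) (b i) ⊆ Icc 0 1 := (hf.mapsTo i).image_subset
  have h1 : ∫ x, branchTransfer a b f η i h x * ψ x ∂leb =
      ∫ x in f '' Ioo (a i) (b i), branchTransfer a b f η i h x * ψ x := by
    refine (setIntegral_eq_of_subset_of_forall_sdiff_eq_zero measurableSet_Icc hsub
      fun x hx => ?_)
    rw [branchTransfer_of_notMem _ _ hx.2, zero_mul]
  rw [h1, integral_image_eq_integral_abs_deriv_smul measurableSet_Ioo
    (fun x hx => (hf.hasDerivAt hx).hasDerivWithinAt) (hf.injOn i)]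
  refine setIntegral_congr_fun measurableSet_Ioo fun y hy => ?_
  have hyU : y ∈ ⋃ i, Ioo (a i) (b i) := mem_iUnion.2 ⟨i, hy⟩
  simp only [branchTransfer_apply hf η h hy, pullback, indicator_of_mem hyU, Complex.real_smul]
  ring

/-- Changing variables on each branch turns the sum into `∫ |η f'| |h|`. This single estimate yields
both the almost everywhere absolute convergence of the series and the `L¹` bound. -/
lemma tsum_lintegral_branchTransfer_le (hf : IsPiecewiseExpanding a b f)
    (hρ0 : 0 ≤ ρ) (hρ : ∀ x ∈ ⋃ i, Ioo (a i) (b i), ‖η x‖ * |deriv f x| ≤ ρ) (h : Lp ℂ 1 leb) :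
    ∑' i, ∫⁻ x, ‖branchTransfer a b f η i h x‖ₑ ∂leb ≤ ENNReal.ofReal (ρ * ‖h‖) := by
  have := hf.isPartition.countable
  simp_rw [lintegral_branchTransfer hf]
  rw [← lintegral_iUnion (fun _ => measurableSet_Ioo) hf.isPartition.disjoint,
    ENNReal.ofReal_mul hρ0, L1.norm_eq_integral_norm,
    ofReal_integral_eq_lintegral_ofReal (L1.integrable_coeFn h).norm
      (Filter.Eventually.of_forall fun _ => norm_nonneg _),
    ← lintegral_const_mul' _ _ ENNReal.ofReal_ne_top, hf.isPartition.lintegral_leb]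
  refine setLIntegral_mono' (measurableSet_iUnion_Ioo a b) fun x hx => ?_
  rw [← ofReal_norm, ← ENNReal.ofReal_mul (abs_nonneg _), ← ENNReal.ofReal_mul hρ0, norm_mul]
  refine ENNReal.ofReal_le_ofReal ?_
  rw [← mul_assoc, mul_comm |deriv f x|]
  exact mul_le_mul_of_nonneg_right (hρ x hx) (norm_nonneg _)

lemma lp_one_ext {k l : Lp ℂ 1 leb} (h : ∀ ψ : ℝ → ℂ, Measurable ψ → (∀ x, ‖ψ x‖ ≤ 1) →
    ∫ x, k x * ψ x ∂leb = ∫ x, l x * ψ x ∂leb) : k = l := by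
  refine Lp.ext (Integrable.ae_eq_of_forall_setIntegral_eq _ _ (L1.integrable_coeFn k)
    (L1.integrable_coeFn l) fun s hs _ => ?_)
  have h1 := h (s.indicator fun _ => 1) (measurable_const.indicator hs) fun x =>
    (norm_indicator_le_norm_self _ _).trans (by simp)
  have h2 : ∀ k : ℝ → ℂ, ∫ x, k x * s.indicator (fun _ => (1 : ℂ)) x ∂leb =
      ∫ x in s, k x ∂leb := fun k => by
    rw [← integral_indicator hs]
    refine integral_congr_ae (Filter.Eventually.of_forall fun x => ?_)
    by_cases hx : x ∈ s <;> simp [hx]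
  rwa [h2, h2] at h1

/-- The transfer operator with weight `η` on `L¹`. -/
lemma exists_transfer_lp (hf : IsPiecewiseExpanding a b f) (hη : Measurable η)
    (hρ0 : 0 ≤ ρ) (hρ : ∀ x ∈ ⋃ i, Ioo (a i) (b i), ‖η x‖ * |deriv f x| ≤ ρ) :
    ∃ T : Lp ℂ 1 leb →L[ℂ] Lp ℂ 1 leb,
      (∀ h (ψ : ℝ → ℂ), Measurable ψ → (∃ C : ℝ, ∀ x, ‖ψ x‖ ≤ C) →
        ∫ x, T h x * ψ x ∂leb = ∫ x, h x * pullback a b f η ψ x ∂leb) ∧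
      (∀ h, ‖T h‖ ≤ ρ * ‖h‖) ∧
      ∀ h : Lp ℂ 1 leb, ∀ᵐ x ∂leb,
        HasSum (fun y : {y : ℝ // y ∈ ⋃ i, Ioo (a i) (b i) ∧ f y = x} => η y * h y) (T h x) := by
  have := hf.isPartition.countable
  have hmeas : ∀ (h : Lp ℂ 1 leb) i, Measurable (branchTransfer a b f η i h) := fun h i =>
    measurable_branchTransfer hf hη (Lp.stronglyMeasurable _).measurable i
  set t : Lp ℂ 1 leb → ℝ → ℂ := fun h x => ∑' i, branchTransfer a b f η i h x
  have hfin : ∀ h : Lp ℂ 1 leb, ∫⁻ x, ∑' i, ‖branchTransfer a b f η i h x‖ₑ ∂leb ≤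
      ENNReal.ofReal (ρ * ‖h‖) := fun h => by
    rw [lintegral_tsum fun i => (hmeas h i).enorm.aemeasurable]
    exact tsum_lintegral_branchTransfer_le hf hρ0 hρ h
  have hae : ∀ h : Lp ℂ 1 leb, ∀ᵐ x ∂leb, Summable fun i => branchTransfer a b f η i h x :=
    fun h => by
    have h1 := ae_lt_top' (Measurable.aemeasurable <| Measurable.tsum fun i =>
      (hmeas h i).enorm) ((hfin h).trans_lt ENNReal.ofReal_lt_top).ne
    filter_upwards [h1] with x hx
    refine Summable.of_norm ?_
    have h2 : (fun i => ‖branchTransfer a b f η i h x‖) =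
        fun i => (‖branchTransfer a b f η i h x‖ₑ).toReal := by
      ext i; rw [toReal_enorm]
    rw [h2]
    exact ENNReal.summable_toReal hx.ne
  have hle : ∀ h : Lp ℂ 1 leb, ∀ᵐ x ∂leb, ‖t h x‖ₑ ≤ ∑' i, ‖branchTransfer a b f η i h x‖ₑ :=
    fun h => by
    filter_upwards [hae h] with x hx
    exact enorm_tsum_le_tsum_enorm
  have htm : ∀ h, AEStronglyMeasurable (t h) leb := fun h =>
    (Measurable.tsum fun i => hmeas h i).aestronglyMeasurable
  have hti : ∀ h, Integrable (t h) leb := fun h =>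
    ⟨htm h, ((lintegral_mono_ae (hle h)).trans (hfin h)).trans_lt ENNReal.ofReal_lt_top⟩
  have hdual : ∀ h (ψ : ℝ → ℂ), Measurable ψ → (∃ C : ℝ, ∀ x, ‖ψ x‖ ≤ C) →
      ∫ x, (hti h).toL1 (t h) x * ψ x ∂leb = ∫ x, h x * pullback a b f η ψ x ∂leb := by
    rintro h ψ hψ ⟨C, hC⟩
    have hC0 : 0 ≤ C := (norm_nonneg _).trans (hC 0)
    have e1 : ∫ x, (hti h).toL1 (t h) x * ψ x ∂leb =
        ∫ x, ∑' i, branchTransfer a b f η i h x * ψ x ∂leb := by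
      refine integral_congr_ae ?_
      filter_upwards [(hti h).coeFn_toL1] with x hx
      rw [hx, tsum_mul_right]
    rw [e1, integral_tsum]
    · simp_rw [integral_branchTransfer hf]
      rw [hf.isPartition.integral_leb, integral_iUnion (fun _ => measurableSet_Ioo)
        hf.isPartition.disjoint]
      rw [IntegrableOn, ← hf.isPartition.leb_eq]
      exact BSpace.integrable_mul_of_bounded h (measurable_pullback hf hη hψ)
        (norm_pullback_le hρ0 hρ hC)
    · exact fun i => ((hmeas h i).mul hψ).aestronglyMeasurable
    · have h2 : ∑' i, ∫⁻ x, ‖branchTransfer a b f η i h x * ψ x‖ₑ ∂leb ≤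
          ∑' i, (∫⁻ x, ‖branchTransfer a b f η i h x‖ₑ ∂leb) * ENNReal.ofReal C := by
        refine ENNReal.tsum_le_tsum fun i => ?_
        rw [← lintegral_mul_const' _ _ ENNReal.ofReal_ne_top]
        refine lintegral_mono fun x => ?_
        rw [enorm_mul]
        gcongr
        rw [← ofReal_norm]
        exact ENNReal.ofReal_le_ofReal (hC x)
      refine (h2.trans_lt ?_).ne
      rw [ENNReal.tsum_mul_right]
      exact ENNReal.mul_lt_top ((tsum_lintegral_branchTransfer_le hf hρ0 hρ h).trans_lt
        ENNReal.ofReal_lt_top) ENNReal.ofReal_lt_top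
  have hbd : ∀ {ψ : ℝ → ℂ}, (∀ x, ‖ψ x‖ ≤ 1) → ∀ x, ‖pullback a b f η ψ x‖ ≤ ρ * 1 :=
    fun hψ => norm_pullback_le hρ0 hρ hψ
  have hnorm : ∀ h, ‖(hti h).toL1 (t h)‖ ≤ ρ * ‖h‖ := fun h => by
    rw [Integrable.norm_toL1_eq_lintegral_norm]
    refine ENNReal.toReal_le_of_le_ofReal (by positivity) ?_
    simp_rw [ofReal_norm]
    exact (lintegral_mono_ae (hle h)).trans (hfin h)
  let S : Lp ℂ 1 leb →ₗ[ℂ] Lp ℂ 1 leb :=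
    { toFun := fun h => (hti h).toL1 (t h)
      -- Linearity is read off from the dual identity, since bounded measurable functions separate
      -- points of `L¹`.
      map_add' := fun h g => by
        refine lp_one_ext fun ψ hψ hψ1 => ?_
        obtain ⟨Λ, hΛ⟩ := BSpace.exists_integral_clm hψ hψ1
        obtain ⟨Λ', hΛ'⟩ := BSpace.exists_integral_clm (measurable_pullback hf hη hψ) (hbd hψ1)
        rw [hdual _ ψ hψ ⟨1, hψ1⟩, ← hΛ', ← hΛ, map_add, map_add, hΛ', hΛ', hΛ, hΛ,
          hdual _ ψ hψ ⟨1, hψ1⟩, hdual _ ψ hψ ⟨1, hψ1⟩]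
      map_smul' := fun c h => by
        refine lp_one_ext fun ψ hψ hψ1 => ?_
        obtain ⟨Λ, hΛ⟩ := BSpace.exists_integral_clm hψ hψ1
        obtain ⟨Λ', hΛ'⟩ := BSpace.exists_integral_clm (measurable_pullback hf hη hψ) (hbd hψ1)
        rw [hdual _ ψ hψ ⟨1, hψ1⟩, ← hΛ', ← hΛ, map_smul, map_smul, hΛ', hΛ,
          hdual _ ψ hψ ⟨1, hψ1⟩, RingHom.id_apply] }
  refine ⟨S.mkContinuous ρ hnorm, hdual, hnorm, fun h => ?_⟩
  filter_upwards [hae h, (hti h).coeFn_toL1] with x hx hx'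
  have hx'' : (S.mkContinuous ρ hnorm h) x = t h x := hx'
  rw [hx'']
  -- A branch contains at most one preimage of `x`, and a branch without one contributes zero. The
  -- sum over the fibre is thus a reindexing of the sum over branches.
  have hidx : ∀ y : {y : ℝ // y ∈ ⋃ i, Ioo (a i) (b i) ∧ f y = x},
      ∃ i, (y : ℝ) ∈ Ioo (a i) (b i) := fun y => mem_iUnion.1 y.2.1
  choose idx hidx using hidx
  have hinj : Function.Injective idx := fun y z hyz => by
    refine Subtype.ext (hf.injOn (idx y) (hidx y) (hyz ▸ hidx z) ?_)
    rw [y.2.2, z.2.2]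
  have hval : ∀ y, branchTransfer a b f η (idx y) h x = η y * h y := fun y => by
    have := branchTransfer_apply hf η h (hidx y)
    rwa [y.2.2] at this
  have h0 : ∀ i ∉ range idx, branchTransfer a b f η i h x = 0 := fun i hi => by
    refine branchTransfer_of_notMem _ _ ?_
    rintro ⟨y, hy, hyx⟩
    refine hi ⟨⟨y, mem_iUnion.2 ⟨i, hy⟩, hyx⟩, ?_⟩
    by_contra hne
    exact Set.disjoint_left.1 (hf.isPartition.disjoint hne) (hidx _) hy
  have h3 := (hinj.hasSum_iff h0).2 hx.hasSum
  convert h3 using 2 with y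
  exact (hval y).symm

end Transfer

end ExpandingMap

namespace ExpandingMap

/-! ### Sewing and the Young integral along a branch -/

section Young

lemma rpow_add_rpow_le {p x y : ℝ} (hp0 : 0 ≤ p) (hp1 : p ≤ 1) (hx : 0 ≤ x) (hy : 0 ≤ y) :
    x ^ p + y ^ p ≤ 2 * ((x + y) / 2) ^ p := by
  have h := (Real.concaveOn_rpow hp0 hp1).2 (mem_Ici.2 hx) (mem_Ici.2 hy)
    (by norm_num : (0 : ℝ) ≤ 1 / 2) (by norm_num : (0 : ℝ) ≤ 1 / 2) (by norm_num)
  simp only [smul_eq_mul] at h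
  have e : (1 / 2 : ℝ) * x + 1 / 2 * y = (x + y) / 2 := by ring
  rw [e] at h
  linarith

/-- The sewing lemma along midpoints: a quantity that is almost subadditive under bisection, and
that is small on small intervals, is bounded by its defect. -/
lemma le_of_bisection {x₀ y₀ : ℝ} {Err W V : ℝ → ℝ → ℝ} {K C A B β : ℝ} (hK : 0 ≤ K)
    (hB0 : 0 ≤ B) (hB1 : B ≤ 1) (hAB : 1 < A + B) (hβ : 0 < β)
    (hW0 : ∀ u v, x₀ ≤ u → u ≤ v → v ≤ y₀ → 0 ≤ W u v)
    (hW : ∀ u v, x₀ ≤ u → u ≤ v → v ≤ y₀ → W u ((u + v) / 2) + W ((u + v) / 2) v = W u v)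
    (hV : ∀ u v, x₀ ≤ u → u ≤ v → v ≤ y₀ → V u ((u + v) / 2) + V ((u + v) / 2) v = V u v)
    (hdef : ∀ u v, x₀ ≤ u → u ≤ v → v ≤ y₀ → Err u v ≤ K * (v - u) ^ A * W u v ^ B +
      Err u ((u + v) / 2) + Err ((u + v) / 2) v)
    (htriv : ∀ u v, x₀ ≤ u → u ≤ v → v ≤ y₀ → Err u v ≤ C * (v - u) ^ β * V u v)
    (hxy : x₀ ≤ y₀) :
    Err x₀ y₀ ≤ K / (1 - 2 ^ (1 - A - B)) * (y₀ - x₀) ^ A * W x₀ y₀ ^ B := by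
  -- `q` is the gain of one bisection: halving the length gives `2 ^ (-A)`, and concavity of the
  -- power `B` bounds the two halves of `W` by `2 ^ (1 - B)`. Since `1 < A + B`, the defects sum
  -- geometrically; `htriv` makes the remainder at depth `n` vanish in the limit.
  set q : ℝ := 2 ^ (1 - A - B)
  have hq0 : 0 < q := by positivity
  have hq1 : q < 1 := Real.rpow_lt_one_of_one_lt_of_neg one_lt_two (by linarith)
  have key : ∀ n : ℕ, ∀ u v, x₀ ≤ u → u ≤ v → v ≤ y₀ → Err u v ≤
      K * (∑ k ∈ Finset.range n, q ^ k) * (v - u) ^ A * W u v ^ B +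
        C * ((v - u) / 2 ^ n) ^ β * V u v := by
    intro n
    induction n with
    | zero =>
      intro u v hu huv hv
      simpa using htriv u v hu huv hv
    | succ n ih =>
      intro u v hu huv hv
      have h1 := ih u ((u + v) / 2) hu (by linarith) (by linarith)
      have h2 := ih ((u + v) / 2) v (by linarith) (by linarith) hv
      have e1 : (u + v) / 2 - u = (v - u) / 2 := by ring
      have e2 : v - (u + v) / 2 = (v - u) / 2 := by ring
      rw [e1] at h1
      rw [e2] at h2
      have hw := rpow_add_rpow_le hB0 hB1 (hW0 u ((u + v) / 2) hu (by linarith) (by linarith))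
        (hW0 ((u + v) / 2) v (by linarith) (by linarith) hv)
      rw [hW u v hu huv hv] at hw
      set S := ∑ k ∈ Finset.range n, q ^ k
      have hS : 0 ≤ S := Finset.sum_nonneg fun k _ => by positivity
      have hS' : ∑ k ∈ Finset.range (n + 1), q ^ k = 1 + q * S := by
        rw [Finset.sum_range_succ', Finset.mul_sum, add_comm]
        simp [pow_succ, mul_comm]
      have hvu : 0 ≤ v - u := sub_nonneg.2 huv
      have hWuv := hW0 u v hu huv hv
      have e3 : ((v - u) / 2) ^ A * (2 * (W u v / 2) ^ B) = q * ((v - u) ^ A * W u v ^ B) := by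
        rw [Real.div_rpow hvu zero_le_two, Real.div_rpow hWuv zero_le_two]
        simp only [q]
        rw [sub_sub, Real.rpow_sub two_pos, Real.rpow_add two_pos, Real.rpow_one]
        field_simp
      have e4 : ((v - u) / 2) / 2 ^ n = (v - u) / 2 ^ (n + 1) := by
        rw [pow_succ]; field_simp
      rw [e4] at h1 h2
      have h3 : K * S * ((v - u) / 2) ^ A * (W u ((u + v) / 2) ^ B + W ((u + v) / 2) v ^ B) ≤
          K * S * (q * ((v - u) ^ A * W u v ^ B)) := by
        rw [← e3, ← mul_assoc (K * S)]
        exact mul_le_mul_of_nonneg_left hw (by positivity)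
      have h4 := hdef u v hu huv hv
      have h5 := hV u v hu huv hv
      rw [hS', ← h5]
      have : K * (1 + q * S) * (v - u) ^ A * W u v ^ B = K * (v - u) ^ A * W u v ^ B +
          K * S * (q * ((v - u) ^ A * W u v ^ B)) := by ring
      rw [this]
      nlinarith [h1, h2, h3, h4]
  have hlim : Filter.Tendsto (fun n : ℕ => K * (∑ k ∈ Finset.range n, q ^ k) * (y₀ - x₀) ^ A *
      W x₀ y₀ ^ B + C * ((y₀ - x₀) / 2 ^ n) ^ β * V x₀ y₀) Filter.atTop
      (nhds (K * (1 - q)⁻¹ * (y₀ - x₀) ^ A * W x₀ y₀ ^ B + C * 0 * V x₀ y₀)) := by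
    have h1 : Filter.Tendsto (fun n : ℕ => ∑ k ∈ Finset.range n, q ^ k) Filter.atTop
        (nhds (1 - q)⁻¹) := (hasSum_geometric_of_lt_one hq0.le hq1).tendsto_sum_nat
    have h2 : Filter.Tendsto (fun n : ℕ => ((y₀ - x₀) / 2 ^ n) ^ β) Filter.atTop (nhds 0) := by
      have h3 : Filter.Tendsto (fun n : ℕ => (y₀ - x₀) / (2 : ℝ) ^ n) Filter.atTop (nhds 0) :=
        tendsto_const_nhds.div_atTop (tendsto_pow_atTop_atTop_of_one_lt one_lt_two)
      have := h3.rpow_const (p := β) (Or.inr hβ.le)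
      rwa [Real.zero_rpow hβ.ne'] at this
    exact (((h1.const_mul K).mul_const _).mul_const _).add ((h2.const_mul C).mul_const _)
  have := ge_of_tendsto' hlim fun n => key n x₀ y₀ le_rfl hxy le_rfl
  rw [div_eq_mul_inv]
  simpa using this

/-- This is Jensen's inequality for the concave power `t`, obtained by integrating the tangent line
at the mean value `c` of `G`. The bound `1 ≤ G` keeps that mean positive. -/
lemma intervalIntegral_rpow_le {G : ℝ → ℝ} {u v t : ℝ} (huv : u ≤ v)
    (hG : ContinuousOn G (Icc u v)) (hG1 : ∀ x ∈ Icc u v, 1 ≤ G x) (ht0 : 0 ≤ t) (ht1 : t ≤ 1) :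
    ∫ x in u..v, G x ^ t ≤ (v - u) ^ (1 - t) * (∫ x in u..v, G x) ^ t := by
  rcases huv.eq_or_lt with rfl | huv
  · simp only [intervalIntegral.integral_same, sub_self]
    positivity
  have hl : 0 < v - u := sub_pos.2 huv
  have hGi : IntervalIntegrable G volume u v :=
    ContinuousOn.intervalIntegrable (by rwa [uIcc_of_le huv.le])
  set I := ∫ x in u..v, G x
  have hI : 0 < I := by
    have h1 : ∫ x in u..v, (1 : ℝ) ≤ I := intervalIntegral.integral_mono_on huv.le
      intervalIntegrable_const hGi hG1
    rw [intervalIntegral.integral_const, smul_eq_mul, mul_one] at h1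
    linarith
  set c := I / (v - u)
  have hc : 0 < c := by positivity
  have hpt : ∀ x ∈ Icc u v, G x ^ t ≤ c ^ t * (t * (G x / c) + (1 - t)) := by
    intro x hx
    have hGx : 0 ≤ G x := zero_le_one.trans (hG1 x hx)
    have h1 := Real.geom_mean_le_arith_mean2_weighted ht0 (sub_nonneg.2 ht1)
      (div_nonneg hGx hc.le) zero_le_one (by ring)
    rw [Real.one_rpow, mul_one, mul_one] at h1
    calc G x ^ t = c ^ t * (G x / c) ^ t := by
          rw [← Real.mul_rpow hc.le (div_nonneg hGx hc.le)]; field_simp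
      _ ≤ _ := by gcongr
  have hGt : IntervalIntegrable (fun x => G x ^ t) volume u v := by
    refine ContinuousOn.intervalIntegrable ?_
    rw [uIcc_of_le huv.le]
    exact hG.rpow_const fun x _ => Or.inr ht0
  have hint : IntervalIntegrable (fun x => c ^ t * (t * (G x / c) + (1 - t))) volume u v :=
    (((hGi.div_const c).const_mul t).add intervalIntegrable_const).const_mul _
  refine (intervalIntegral.integral_mono_on huv.le hGt hint hpt).trans (le_of_eq ?_)
  rw [intervalIntegral.integral_const_mul, intervalIntegral.integral_add
    ((hGi.div_const c).const_mul t) intervalIntegrable_const, intervalIntegral.integral_const_mul,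
    intervalIntegral.integral_div, intervalIntegral.integral_const]
  change c ^ t * (t * (I / c) + (v - u) • (1 - t)) = _
  have h2 : I / c = v - u := by simp only [c]; field_simp
  have h3 : (v - u) ^ (1 - t) = (v - u) / (v - u) ^ t := by
    rw [Real.rpow_sub hl, Real.rpow_one]
  rw [h2, smul_eq_mul, h3]
  simp only [c]
  rw [Real.div_rpow hI.le hl.le]
  field_simp
  ring

/-- Split `|D| = |D| ^ (1 - r * t) * |D| ^ (r * t)`: the supremum `S` bounds the first factor, and
the preceding integral inequality bounds the second by `∫ |D| ^ r`. The parameter `t` decides how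
much of the derivative is charged to integrability. -/
lemma abs_sub_le_of_deriv {f D : ℝ → ℝ} {u v r t S : ℝ} (huv : u ≤ v)
    (hf : ∀ x ∈ Icc u v, HasDerivAt f (D x) x) (hD : ContinuousOn D (Icc u v))
    (hD1 : ∀ x ∈ Icc u v, 1 ≤ |D x|) (hS : ∀ x ∈ Icc u v, |D x| ≤ S)
    (hr : 0 ≤ r) (ht0 : 0 ≤ t) (ht1 : t ≤ 1) (hrt : r * t ≤ 1) :
    |f v - f u| ≤ S ^ (1 - r * t) * ((v - u) ^ (1 - t) * (∫ x in u..v, |D x| ^ r) ^ t) := by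
  have hu := uIcc_of_le huv
  have hS0 : 0 ≤ S := zero_le_one.trans
    ((hD1 u (left_mem_Icc.2 huv)).trans (hS u (left_mem_Icc.2 huv)))
  have h1 : f v - f u = ∫ x in u..v, D x :=
    (intervalIntegral.integral_eq_sub_of_hasDerivAt (fun x hx => hf x (hu ▸ hx))
      (ContinuousOn.intervalIntegrable (by rwa [hu]))).symm
  have hG : ContinuousOn (fun x => |D x| ^ r) (Icc u v) :=
    hD.abs.rpow_const fun x _ => Or.inr hr
  have hGt : ContinuousOn (fun x => (|D x| ^ r) ^ t) (Icc u v) :=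
    hG.rpow_const fun x _ => Or.inr ht0
  rw [h1]
  have h2 : |∫ x in u..v, D x| ≤ ∫ x in u..v, |D x| :=
    intervalIntegral.abs_integral_le_integral_abs huv
  refine h2.trans ?_
  have h3 : ∫ x in u..v, |D x| ≤ ∫ x in u..v, S ^ (1 - r * t) * (|D x| ^ r) ^ t := by
    refine intervalIntegral.integral_mono_on huv
      (ContinuousOn.intervalIntegrable (by rw [hu]; exact hD.abs))
      (ContinuousOn.intervalIntegrable (by rw [hu]; exact continuousOn_const.mul hGt))
      fun x hx => ?_
    have hpos : 0 < |D x| := zero_lt_one.trans_le (hD1 x hx)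
    calc |D x| = |D x| ^ (1 - r * t) * (|D x| ^ r) ^ t := by
          rw [← Real.rpow_mul hpos.le, ← Real.rpow_add hpos, sub_add_cancel, Real.rpow_one]
      _ ≤ _ := by
          gcongr
          exact hS x hx
  refine h3.trans ?_
  rw [intervalIntegral.integral_const_mul]
  refine mul_le_mul_of_nonneg_left ?_ (by positivity)
  exact intervalIntegral_rpow_le huv hG (fun x hx => Real.one_le_rpow (hD1 x hx) hr) ht0 ht1

lemma le_rpow_mul_rpow {X p q σ : ℝ} (hX : 0 ≤ X) (hp : X ≤ p) (hq : X ≤ q) (h0 : 0 ≤ σ)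
    (h1 : σ ≤ 1) : X ≤ p ^ σ * q ^ (1 - σ) := by
  calc X = X ^ σ * X ^ (1 - σ) := by
        rcases hX.eq_or_lt with rfl | hX
        · rcases h0.eq_or_lt with rfl | h0
          · simp
          · rw [Real.zero_rpow h0.ne', zero_mul]
        · rw [← Real.rpow_add hX, add_sub_cancel, Real.rpow_one]
    _ ≤ _ := mul_le_mul (Real.rpow_le_rpow hX hp h0)
        (Real.rpow_le_rpow hX hq (sub_nonneg.2 h1)) (by positivity)
        (Real.rpow_nonneg (hX.trans hp) _)

/-- Young's estimate for the integral of a Hölder weight against a Hölder test function composed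
with an expanding map of unbounded derivative. -/
lemma exists_young {α β r t C ρ : ℝ} (hα0 : 0 ≤ α) (hα1 : α ≤ 1) (hβ : 0 < β) (hr : 0 ≤ r)
    (ht0 : 0 ≤ t) (ht1 : t ≤ 1) (hrt : r * t ≤ 1) (hC : 0 ≤ C) (hρ0 : 0 ≤ ρ)
    (hexp : 1 < β * (1 - α + α * (r * t)) + α)
    {f D : ℝ → ℝ} {φ u : ℝ → ℂ} {ξ : ℝ → ℂ} {x₀ y₀ : ℝ} (hxy : x₀ ≤ y₀)
    (hφ : IsTest α φ u) (hf : ∀ x ∈ Icc x₀ y₀, HasDerivAt f (D x) x)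
    (hf01 : ∀ x ∈ Icc x₀ y₀, f x ∈ Icc (0 : ℝ) 1)
    (hD : ContinuousOn D (Icc x₀ y₀)) (hD1 : ∀ x ∈ Icc x₀ y₀, 1 ≤ |D x|)
    (hξ : ∀ x ∈ Icc x₀ y₀, ∀ y ∈ Icc x₀ y₀, ‖ξ x - ξ y‖ ≤ C * |x - y| ^ β)
    (hρ : ∀ x ∈ Icc x₀ y₀, ‖ξ x‖ * |D x| ≤ ρ) :
    ∃ z ∈ Icc x₀ y₀, (∀ x ∈ Icc x₀ y₀, |D x| ≤ |D z|) ∧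
      ‖(∫ x in x₀..y₀, ξ x * (u (f x) * ((D x : ℝ) : ℂ))) - ξ z * (φ (f y₀) - φ (f x₀))‖ ≤
      2 * (C ^ (1 - α + α * (r * t)) * (2 * ρ) ^ (α * (1 - r * t))) /
        (1 - 2 ^ (1 - (β * (1 - α + α * (r * t)) + α * (1 - t)) - α * t)) *
        (y₀ - x₀) ^ (β * (1 - α + α * (r * t)) + α * (1 - t)) *
        (∫ x in x₀..y₀, |D x| ^ r) ^ (α * t) := by
  -- The increment of `φ ∘ f` costs a factor `S ^ (α * (1 - r * t))`. The oscillation of `ξ` is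
  -- interpolated between its Hölder bound, with weight `σ`, and `2 * ρ / S`, with weight `1 - σ = α
  -- * (1 - r * t)`, so that the powers of `S` cancel exactly.
  set σ : ℝ := 1 - α + α * (r * t)
  have hσ1 : 1 - σ = α * (1 - r * t) := by simp only [σ]; ring
  have hrt0 : 0 ≤ r * t := by positivity
  have hσle : σ ≤ 1 := by nlinarith [mul_nonneg hα0 (sub_nonneg.2 hrt)]
  have hσ0 : 0 ≤ σ := by simp only [σ]; nlinarith [mul_nonneg hα0 hrt0]
  have hsub : ∀ {u v : ℝ}, x₀ ≤ u → v ≤ y₀ → Icc u v ⊆ Icc x₀ y₀ := fun hu hv =>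
    Icc_subset_Icc hu hv
  -- The sample point on each subinterval maximises `|D|`. Stating its properties as implications
  -- allows one choice for all pairs of reals.
  have hmax : ∀ u v : ℝ, ∃ z, x₀ ≤ u → u ≤ v → v ≤ y₀ →
      z ∈ Icc u v ∧ ∀ x ∈ Icc u v, |D x| ≤ |D z| := by
    intro u v
    by_cases h : x₀ ≤ u ∧ u ≤ v ∧ v ≤ y₀
    · obtain ⟨z, hz, hz'⟩ := isCompact_Icc.exists_isMaxOn (nonempty_Icc.2 h.2.1)
        (hD.mono (hsub h.1 h.2.2)).abs
      exact ⟨z, fun _ _ _ => ⟨hz, fun x hx => hz' hx⟩⟩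
    · exact ⟨0, fun h1 h2 h3 => (h ⟨h1, h2, h3⟩).elim⟩
  choose Z hZ using hmax
  set g : ℝ → ℂ := fun x => φ (f x)
  set g' : ℝ → ℂ := fun x => u (f x) * ((D x : ℝ) : ℂ)
  have hfc : ContinuousOn f (Icc x₀ y₀) := fun x hx => (hf x hx).continuousAt.continuousWithinAt
  have hg : ∀ x ∈ Icc x₀ y₀, HasDerivAt g (g' x) x := fun x hx => by
    have := (hφ.hasDerivAt (f x)).scomp x (hf x hx)
    simpa [g, g', mul_comm, Function.comp_def] using this
  have hg'c : ContinuousOn g' (Icc x₀ y₀) :=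
    (hφ.continuous.comp_continuousOn hfc).mul (Complex.continuous_ofReal.comp_continuousOn hD)
  have hξc : ContinuousOn ξ (Icc x₀ y₀) := by
    intro x hx
    rw [ContinuousWithinAt, tendsto_iff_norm_sub_tendsto_zero]
    have h1 : Filter.Tendsto (fun y => C * |y - x| ^ β) (nhdsWithin x (Icc x₀ y₀)) (nhds 0) := by
      have h2 : Continuous fun y : ℝ => C * |y - x| ^ β :=
        continuous_const.mul ((continuous_abs.comp (continuous_id.sub continuous_const)).rpow_const
          fun _ => Or.inr hβ.le)
      have h3 := (h2.tendsto x).mono_left (nhdsWithin_le_nhds (s := Icc x₀ y₀))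
      simpa [Real.zero_rpow hβ.ne'] using h3
    exact squeeze_zero' (Filter.Eventually.of_forall fun _ => norm_nonneg _)
      (Filter.eventually_of_mem self_mem_nhdsWithin fun y hy => hξ y hy x hx) h1
  have hii : ∀ {F : ℝ → ℂ}, ContinuousOn F (Icc x₀ y₀) → ∀ {u v : ℝ}, x₀ ≤ u → u ≤ v → v ≤ y₀ →
      IntervalIntegrable F volume u v := fun hF _ _ hu huv hv =>
    ContinuousOn.intervalIntegrable (by rw [uIcc_of_le huv]; exact hF.mono (hsub hu hv))
  have hiiR : ∀ {F : ℝ → ℝ}, ContinuousOn F (Icc x₀ y₀) → ∀ {u v : ℝ}, x₀ ≤ u → u ≤ v → v ≤ y₀ →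
      IntervalIntegrable F volume u v := fun hF _ _ hu huv hv =>
    ContinuousOn.intervalIntegrable (by rw [uIcc_of_le huv]; exact hF.mono (hsub hu hv))
  have hW : ContinuousOn (fun x => |D x| ^ r) (Icc x₀ y₀) :=
    hD.abs.rpow_const fun x _ => Or.inr hr
  set K : ℝ := 2 * (C ^ σ * (2 * ρ) ^ (α * (1 - r * t)))
  set Err : ℝ → ℝ → ℝ := fun a b => ‖(∫ x in a..b, ξ x * g' x) - ξ (Z a b) * (g b - g a)‖
  set W : ℝ → ℝ → ℝ := fun a b => ∫ x in a..b, |D x| ^ r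
  set V : ℝ → ℝ → ℝ := fun a b => ∫ x in a..b, ‖g' x‖
  have hgint : ∀ {a b : ℝ}, x₀ ≤ a → a ≤ b → b ≤ y₀ → g b - g a = ∫ x in a..b, g' x :=
    fun ha hab hb => (intervalIntegral.integral_eq_sub_of_hasDerivAt (fun x hx => hg x
      (hsub ha hb (by rwa [uIcc_of_le hab] at hx))) (hii hg'c ha hab hb)).symm
  have hmain : Err x₀ y₀ ≤ K / (1 - 2 ^ (1 - (β * σ + α * (1 - t)) - α * t)) *
      (y₀ - x₀) ^ (β * σ + α * (1 - t)) * W x₀ y₀ ^ (α * t) := by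
    have hB1 : α * t ≤ 1 := by nlinarith
    refine le_of_bisection (C := C) (V := V) (β := β) (by positivity) (by positivity) hB1
      (by nlinarith) hβ ?_ ?_ ?_ ?_ ?_ hxy
    · intro a b ha hab hb
      exact intervalIntegral.integral_nonneg hab fun x _ => by positivity
    · intro a b ha hab hb
      exact intervalIntegral.integral_add_adjacent_intervals
        (hiiR hW ha (by linarith) (by linarith)) (hiiR hW (by linarith) (by linarith) hb)
    · intro a b ha hab hb
      exact intervalIntegral.integral_add_adjacent_intervals
        (hiiR hg'c.norm ha (by linarith) (by linarith))
        (hiiR hg'c.norm (by linarith) (by linarith) hb)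
    · intro a b ha hab hb
      have half : ∀ c d, a ≤ c → c ≤ d → d ≤ b →
          ‖(ξ (Z c d) - ξ (Z a b)) * (g d - g c)‖ ≤ C ^ σ * (2 * ρ) ^ (α * (1 - r * t)) *
            ((b - a) ^ (β * σ + α * (1 - t)) * W a b ^ (α * t)) := by
        intro c d hc hcd hd
        have hcdsub := hsub (ha.trans hc) (hd.trans hb)
        obtain ⟨hz1, hz1'⟩ := hZ c d (ha.trans hc) hcd (hd.trans hb)
        obtain ⟨hz, hz'⟩ := hZ a b ha hab hb
        have hz1ab : Z c d ∈ Icc a b := ⟨hc.trans hz1.1, hz1.2.trans hd⟩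
        set S := |D (Z c d)|
        have hS1 : 1 ≤ S := hD1 _ (hcdsub hz1)
        have hS0 : 0 < S := zero_lt_one.trans_le hS1
        have hSS : S ≤ |D (Z a b)| := hz' _ hz1ab
        have hb1 : ‖ξ (Z c d) - ξ (Z a b)‖ ≤ C * (b - a) ^ β := by
          refine (hξ _ (hsub ha hb hz1ab) _ (hsub ha hb hz)).trans ?_
          gcongr
          rw [abs_le]
          constructor <;> linarith [hz1ab.1, hz1ab.2, hz.1, hz.2]
        -- The maximum of `|D|` over the parent interval is at least `S`, so `‖ξ‖ * |D| ≤ ρ` bounds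
        -- `ξ` by `ρ / S` at both sample points.
        have hb2 : ‖ξ (Z c d) - ξ (Z a b)‖ ≤ 2 * ρ / S := by
          rw [le_div_iff₀ hS0]
          have h1 := hρ _ (hcdsub hz1)
          have h2 := hρ _ (hsub ha hb hz)
          have h3 : ‖ξ (Z a b)‖ * S ≤ ρ :=
            (mul_le_mul_of_nonneg_left hSS (norm_nonneg _)).trans h2
          calc _ ≤ (‖ξ (Z c d)‖ + ‖ξ (Z a b)‖) * S := by gcongr; exact norm_sub_le _ _
            _ ≤ _ := by linarith
        have hb3 := le_rpow_mul_rpow (norm_nonneg _) hb1 hb2 hσ0 hσle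
        have hWcd0 : 0 ≤ W c d := intervalIntegral.integral_nonneg hcd fun x _ => by positivity
        have hWcd : W c d ≤ W a b := by
          refine intervalIntegral.integral_mono_interval hc hcd hd
            (Filter.Eventually.of_forall fun x => by positivity) (hiiR hW ha hab hb)
        have hgd : ‖g d - g c‖ ≤ (S ^ (1 - r * t) * ((d - c) ^ (1 - t) * W c d ^ t)) ^ α := by
          refine (hφ.holder _ (hf01 d (hcdsub (right_mem_Icc.2 hcd))) _
            (hf01 c (hcdsub (left_mem_Icc.2 hcd)))).trans ?_
          gcongr
          exact abs_sub_le_of_deriv hcd (fun x hx => hf x (hcdsub hx)) (hD.mono hcdsub)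
            (fun x hx => hD1 x (hcdsub hx)) hz1' hr ht0 ht1 hrt
        have hdc0 : 0 ≤ d - c := sub_nonneg.2 hcd
        have hba0 : 0 ≤ b - a := sub_nonneg.2 hab
        have e1 : (S ^ (1 - r * t) * ((d - c) ^ (1 - t) * W c d ^ t)) ^ α =
            S ^ (α * (1 - r * t)) * ((d - c) ^ (α * (1 - t)) * W c d ^ (α * t)) := by
          rw [Real.mul_rpow (by positivity) (by positivity),
            Real.mul_rpow (by positivity) (by positivity), ← Real.rpow_mul hS0.le,
            ← Real.rpow_mul hdc0, ← Real.rpow_mul hWcd0]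
          simp only [mul_comm α]
        have e2 : (C * (b - a) ^ β) ^ σ * (2 * ρ / S) ^ (1 - σ) =
            C ^ σ * (b - a) ^ (β * σ) * ((2 * ρ) ^ (α * (1 - r * t)) / S ^ (α * (1 - r * t))) := by
          rw [Real.mul_rpow hC (by positivity), ← Real.rpow_mul hba0, hσ1,
            Real.div_rpow (by positivity) hS0.le]
        rw [e1] at hgd
        rw [e2] at hb3
        have hSp : 0 < S ^ (α * (1 - r * t)) := by positivity
        rcases hba0.eq_or_lt with hba | hba
        · have hdc : d = c := by linarith
          rw [hdc, sub_self, mul_zero, norm_zero]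
          have : 0 ≤ W a b := hWcd0.trans hWcd
          positivity
        · have e3 : (b - a) ^ (β * σ + α * (1 - t)) = (b - a) ^ (β * σ) * (b - a) ^ (α * (1 - t)) :=
            Real.rpow_add hba _ _
          have hα1t : 0 ≤ α * (1 - t) := mul_nonneg hα0 (sub_nonneg.2 ht1)
          calc ‖(ξ (Z c d) - ξ (Z a b)) * (g d - g c)‖
              ≤ (C ^ σ * (b - a) ^ (β * σ) *
                ((2 * ρ) ^ (α * (1 - r * t)) / S ^ (α * (1 - r * t)))) *
                (S ^ (α * (1 - r * t)) * ((d - c) ^ (α * (1 - t)) * W c d ^ (α * t))) := by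
                rw [norm_mul]
                exact mul_le_mul hb3 hgd (norm_nonneg _) (by positivity)
            _ = C ^ σ * (2 * ρ) ^ (α * (1 - r * t)) * ((b - a) ^ (β * σ) *
                ((d - c) ^ (α * (1 - t)) * W c d ^ (α * t))) := by
                field_simp
            _ ≤ C ^ σ * (2 * ρ) ^ (α * (1 - r * t)) * ((b - a) ^ (β * σ) *
                ((b - a) ^ (α * (1 - t)) * W a b ^ (α * t))) := by
                have : d - c ≤ b - a := by linarith
                gcongr
            _ = _ := by rw [e3]; ring
      set m := (a + b) / 2
      have ham : a ≤ m := by simp only [m]; linarith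
      have hmb : m ≤ b := by simp only [m]; linarith
      have hint : (∫ x in a..b, ξ x * g' x) =
          (∫ x in a..m, ξ x * g' x) + ∫ x in m..b, ξ x * g' x :=
        (intervalIntegral.integral_add_adjacent_intervals
          (hii (hξc.mul hg'c) ha ham (hmb.trans hb))
          (hii (hξc.mul hg'c) (ha.trans ham) hmb hb)).symm
      have hdec : (∫ x in a..b, ξ x * g' x) - ξ (Z a b) * (g b - g a) =
          ((ξ (Z a m) - ξ (Z a b)) * (g m - g a) + (ξ (Z m b) - ξ (Z a b)) * (g b - g m)) +
          ((∫ x in a..m, ξ x * g' x) - ξ (Z a m) * (g m - g a)) +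
          ((∫ x in m..b, ξ x * g' x) - ξ (Z m b) * (g b - g m)) := by
        rw [hint]; ring
      have h1 := half a m le_rfl ham hmb
      have h2 := half m b ham hmb le_rfl
      simp only [Err]
      rw [hdec]
      refine (norm_add_le _ _).trans (add_le_add_left ((norm_add_le _ _).trans
        (add_le_add_left ((norm_add_le _ _).trans ((add_le_add h1 h2).trans (le_of_eq ?_))) _)) _)
      simp only [K]; ring
    -- The crude bound required by the bisection argument: the oscillation of `ξ` times the total
    -- variation `V` of `φ ∘ f`. It need not be uniform, since it only controls the remainder in the
    -- limit.
    · intro a b ha hab hb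
      obtain ⟨hz, -⟩ := hZ a b ha hab hb
      simp only [Err, V]
      rw [hgint ha hab hb, ← intervalIntegral.integral_const_mul,
        ← intervalIntegral.integral_sub (hii (F := fun x => ξ x * g' x) (hξc.mul hg'c) ha hab hb)
          ((hii hg'c ha hab hb).const_mul _), ← intervalIntegral.integral_const_mul]
      refine intervalIntegral.norm_integral_le_of_norm_le hab
        (Filter.Eventually.of_forall fun x hx => ?_) ((hiiR hg'c.norm ha hab hb).const_mul _)
      have hxI : x ∈ Icc a b := ⟨hx.1.le, hx.2⟩
      rw [← sub_mul, norm_mul]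
      gcongr
      refine (hξ _ (hsub ha hb hxI) _ (hsub ha hb hz)).trans ?_
      gcongr
      rw [abs_le]
      constructor <;> linarith [hxI.1, hxI.2, hz.1, hz.2]
  obtain ⟨hz, hz'⟩ := hZ x₀ y₀ le_rfl hxy le_rfl
  exact ⟨Z x₀ y₀, hz, hz', hmain⟩

end Young

end ExpandingMap

namespace ExpandingMap

/-! ### Increments on one interval and on countably many -/

section Intervals

lemma intervalIntegral_indicator_eq {q : Set ℝ} (hq : MeasurableSet q) (J : ℝ → ℂ) {x y : ℝ}
    (hxy : x ≤ y) : ∫ t in x..y, q.indicator J t = ∫ t in q ∩ Ioc x y, J t := by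
  rw [intervalIntegral.integral_of_le hxy, integral_indicator hq, Measure.restrict_restrict hq]

/-- A Hölder bound for the increments of a primitive inside an interval extends to the closure
of the interval. -/
lemma norm_integral_indicator_le {q : Set ℝ} (hq : q.OrdConnected) {J : ℝ → ℂ}
    (hJ : Measurable J) {C : ℝ} (hC : ∀ x, ‖J x‖ ≤ C) {H α : ℝ} (hH : 0 ≤ H) (hα : 0 ≤ α)
    (hb : ∀ u ∈ q, ∀ v ∈ q, u ≤ v → ‖∫ t in u..v, J t‖ ≤ H * (v - u) ^ α) {x y : ℝ}
    (hxy : x ≤ y) :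
    ‖∫ t in x..y, q.indicator J t‖ ≤ H * volume.real (q ∩ Ioc x y) ^ α := by
  have hqm : MeasurableSet q := hq.measurableSet
  rw [intervalIntegral_indicator_eq hqm J hxy]
  set s := q ∩ Ioc x y
  have hs : s.OrdConnected := hq.inter ordConnected_Ioc
  rcases s.eq_empty_or_nonempty with h0 | hne
  · rw [h0, setIntegral_empty, norm_zero]
    positivity
  have hbelow : BddBelow s := bddBelow_Ioc.mono inter_subset_right
  have habove : BddAbove s := bddAbove_Ioc.mono inter_subset_right
  -- Up to a null set `s` is `(c, d]`, but `c` and `d` need not belong to `q`. The bound is first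
  -- proved inside, then pushed to the closure one endpoint at a time by continuity of the
  -- primitive.
  set c := sInf s
  set d := sSup s
  have hsub : s ⊆ Icc c d := subset_Icc_csInf_csSup hbelow habove
  have hsup : Ioo c d ⊆ s :=
    IsConnected.Ioo_csInf_csSup_subset ⟨hne, hs.isPreconnected⟩ hbelow habove
  have hcd : c ≤ d := Real.sInf_le_sSup s hbelow habove
  have hae : s =ᵐ[volume] Ioc c d := by
    refine Filter.EventuallyLE.antisymm (hsub.eventuallyLE.trans Ioc_ae_eq_Icc.symm.le)
      (Ioo_ae_eq_Ioc.symm.le.trans hsup.eventuallyLE)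
  rw [setIntegral_congr_set hae, ← intervalIntegral.integral_of_le hcd]
  have hvol : volume.real s = d - c := by
    rw [measureReal_congr hae, Real.volume_real_Ioc_of_le hcd]
  rw [hvol]
  rcases hcd.eq_or_lt with hcd' | hcd'
  · rw [hcd', intervalIntegral.integral_same, norm_zero, sub_self]
    positivity
  have hI : ∀ u v, IntervalIntegrable J volume u v := fun u v =>
    (intervalIntegrable_const (c := C)).mono_fun' hJ.aestronglyMeasurable
      (Filter.Eventually.of_forall hC)
  have hprim : Continuous fun v => ∫ t in (0 : ℝ)..v, J t :=
    intervalIntegral.continuous_primitive hI 0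
  have hD : ∀ u v, ∫ t in u..v, J t = (∫ t in (0 : ℝ)..v, J t) - ∫ t in (0 : ℝ)..u, J t :=
    fun u v => (intervalIntegral.integral_interval_sub_left (hI _ _) (hI _ _)).symm
  have hb' : ∀ u ∈ Ioo c d, ∀ v ∈ Ioo c d, ‖∫ t in u..v, J t‖ ≤ H * |v - u| ^ α := by
    intro u hu v hv
    rcases le_total u v with h | h
    · rw [abs_of_nonneg (sub_nonneg.2 h)]
      exact hb u (hsup hu).1 v (hsup hv).1 h
    · rw [intervalIntegral.integral_symm, norm_neg, abs_sub_comm, abs_of_nonneg (sub_nonneg.2 h)]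
      exact hb v (hsup hv).1 u (hsup hu).1 h
  have hcl : closure (Ioo c d) = Icc c d := closure_Ioo hcd'.ne
  have h1 : ∀ u ∈ Ioo c d, ‖∫ t in u..d, J t‖ ≤ H * |d - u| ^ α := by
    intro u hu
    have hclosed : IsClosed {v : ℝ | ‖∫ t in u..v, J t‖ ≤ H * |v - u| ^ α} := by
      refine isClosed_le ?_ ?_
      · have e : (fun v => ‖∫ t in u..v, J t‖) =
            fun v => ‖(∫ t in (0 : ℝ)..v, J t) - ∫ t in (0 : ℝ)..u, J t‖ :=
          funext fun v => by rw [hD u v]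
        rw [e]
        exact (hprim.sub continuous_const).norm
      · exact continuous_const.mul ((continuous_abs.comp
          (continuous_id.sub continuous_const)).rpow_const fun _ => Or.inr hα)
    have := closure_minimal (fun v hv => hb' u hu v hv) hclosed
    rw [hcl] at this
    exact this (right_mem_Icc.2 hcd)
  have hclosed : IsClosed {u : ℝ | ‖∫ t in u..d, J t‖ ≤ H * |d - u| ^ α} := by
    refine isClosed_le ?_ ?_
    · have e : (fun u => ‖∫ t in u..d, J t‖) =
          fun u => ‖(∫ t in (0 : ℝ)..d, J t) - ∫ t in (0 : ℝ)..u, J t‖ :=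
        funext fun u => by rw [hD u d]
      rw [e]
      exact (continuous_const.sub hprim).norm
    · exact continuous_const.mul ((continuous_abs.comp
        (continuous_const.sub continuous_id)).rpow_const fun _ => Or.inr hα)
  have h2 := closure_minimal (fun u hu => h1 u hu) hclosed
  rw [hcl] at h2
  have h3 : ‖∫ t in c..d, J t‖ ≤ H * |d - c| ^ α := h2 (left_mem_Icc.2 hcd)
  rwa [abs_of_nonneg (sub_nonneg.2 hcd)] at h3

lemma volume_real_inter_Ioc_le (q : Set ℝ) {x y : ℝ} (hxy : x ≤ y) :
    volume.real (q ∩ Ioc x y) ≤ y - x := by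
  refine (measureReal_mono inter_subset_right (by simp)).trans ?_
  rw [Real.volume_real_Ioc_of_le hxy]

/-- Hölder bounds on countably many disjoint intervals combine through Hölder's inequality. -/
lemma norm_integral_iUnion_le {κ : Type*} [Countable κ] {q : κ → Set ℝ}
    (hqm : ∀ k, MeasurableSet (q k)) (hdisj : Pairwise fun i j => Disjoint (q i) (q j))
    {J : ℝ → ℂ} (hJ : Measurable J) {C : ℝ} (hC : ∀ x, ‖J x‖ ≤ C) {H : κ → ℝ} {α : ℝ}
    (hH : ∀ k, 0 ≤ H k) (hα0 : 0 < α) (hα1 : α < 1)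
    (hsum : Summable fun k => H k ^ (1 / (1 - α))) {x y : ℝ} (hxy : x ≤ y)
    (hb : ∀ k, ‖∫ t in x..y, (q k).indicator J t‖ ≤ H k * volume.real (q k ∩ Ioc x y) ^ α) :
    ‖∫ t in x..y, (⋃ k, q k).indicator J t‖ ≤
      (∑' k, H k ^ (1 / (1 - α))) ^ (1 - α) * (y - x) ^ α := by
  have hα1' : 0 < 1 - α := sub_pos.2 hα1
  rw [intervalIntegral_indicator_eq (MeasurableSet.iUnion hqm) J hxy, iUnion_inter]
  have hm : ∀ k, MeasurableSet (q k ∩ Ioc x y) := fun k => (hqm k).inter measurableSet_Ioc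
  have hd : Pairwise fun i j => Disjoint (q i ∩ Ioc x y) (q j ∩ Ioc x y) := fun i j hij =>
    (hdisj hij).mono inter_subset_left inter_subset_left
  have hsubU : (⋃ k, q k ∩ Ioc x y) ⊆ Ioc x y := iUnion_subset fun k => inter_subset_right
  have hJi : IntegrableOn J (⋃ k, q k ∩ Ioc x y) :=
    Measure.integrableOn_of_bounded (M := C)
      ((measure_mono hsubU).trans_lt (by simp)).ne hJ.aestronglyMeasurable
      (Filter.Eventually.of_forall hC)
  have hs := hasSum_integral_iUnion hm hd hJi
  have hvs : Summable fun k => volume.real (q k ∩ Ioc x y) := by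
    refine ENNReal.summable_toReal ?_
    rw [← measure_iUnion hd hm]
    exact ((measure_mono hsubU).trans_lt (by simp)).ne
  have hvt : ∑' k, volume.real (q k ∩ Ioc x y) ≤ y - x := by
    have e : ∑' k, volume.real (q k ∩ Ioc x y) = volume.real (⋃ k, q k ∩ Ioc x y) := by
      rw [measureReal_def, measure_iUnion hd hm, ENNReal.tsum_toReal_eq fun k =>
        ((measure_mono inter_subset_right).trans_lt (by simp)).ne]
      rfl
    rw [e]
    refine (measureReal_mono hsubU (by simp)).trans ?_
    rw [Real.volume_real_Ioc_of_le hxy]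
  -- The conjugate exponent `1 / α` turns `volume ^ α` back into the volume, whose sum over disjoint
  -- pieces is at most `y - x`.
  have hconj : (1 / (1 - α)).HolderConjugate (1 / α) :=
    Real.holderConjugate_one_div hα1' hα0 (by ring)
  have hpow : ∀ k, (volume.real (q k ∩ Ioc x y) ^ α) ^ (1 / α) = volume.real (q k ∩ Ioc x y) :=
    fun k => by
    rw [← Real.rpow_mul measureReal_nonneg, mul_one_div_cancel hα0.ne', Real.rpow_one]
  obtain ⟨h1, h2⟩ := Real.summable_and_inner_le_Lp_mul_Lq_tsum_of_nonneg hconj hH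
    (g := fun k => volume.real (q k ∩ Ioc x y) ^ α)
    (fun k => Real.rpow_nonneg measureReal_nonneg α) hsum (by simpa only [hpow] using hvs)
  simp only [hpow, one_div_one_div] at h2
  rw [← hs.tsum_eq]
  refine (tsum_of_norm_bounded h1.hasSum fun k => ?_).trans (h2.trans ?_)
  · rw [← intervalIntegral_indicator_eq (hqm k) J hxy]
    exact hb k
  · refine mul_le_mul_of_nonneg_left ?_
      (Real.rpow_nonneg (tsum_nonneg fun k => Real.rpow_nonneg (hH k) _) _)
    exact Real.rpow_le_rpow (tsum_nonneg fun k => measureReal_nonneg) hvt hα0.le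

end Intervals

/-! ### Averaging over cells -/

section Averaging

variable {α : unitInterval}

lemma norm_integral_indicator_test_le {q : Set ℝ} (hq : q.OrdConnected) (hq01 : q ⊆ Icc 0 1)
    {φ u : ℝ → ℂ} (hφ : IsTest α φ u) : ‖∫ t in q, u t‖ ≤ 1 := by
  obtain ⟨C, hC⟩ := hφ.bounded
  have h1 := norm_integral_indicator_le hq hφ.continuous.measurable hC zero_le_one α.2.1
    (fun s hs t ht hst => by
      rw [intervalIntegral.integral_eq_sub_of_hasDerivAt (fun t _ => hφ.hasDerivAt t)
        (hφ.continuous.intervalIntegrable _ _), one_mul]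
      have := hφ.holder t (hq01 ht) s (hq01 hs)
      rwa [abs_of_nonneg (sub_nonneg.2 hst)] at this) (by norm_num : (-1 : ℝ) ≤ 1)
  rw [intervalIntegral_indicator_eq hq.measurableSet _ (by norm_num)] at h1
  -- The left end `-1`, rather than `0`, keeps the point `0` inside the half-open interval.
  have h2 : q ∩ Ioc (-1) 1 = q := inter_eq_left.2 fun x hx =>
    ⟨by linarith [(hq01 hx).1], (hq01 hx).2⟩
  rw [h2, one_mul] at h1
  refine h1.trans (Real.rpow_le_one measureReal_nonneg ?_ α.2.1)
  exact (measureReal_mono hq01 (by simp)).trans (by simp)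

/-- The indicator function of an interval is an element of `𝓑_α`. -/
lemma exists_indicator {q : Set ℝ} (hq : q.OrdConnected) (hq01 : q ⊆ Icc 0 1) :
    ∃ e : BSpace α, ∀ J : ℝ → ℂ, ∫ x, BSpace.toL1 e x * J x ∂leb = ∫ x in q, J x := by
  have hm : MeasurableSet q := hq.measurableSet
  set k : Lp ℂ 1 leb := indicatorConstLp 1 hm (measure_ne_top leb q) (1 : ℂ)
  have hk : ∀ J : ℝ → ℂ, ∫ x, k x * J x ∂leb = ∫ x in q, J x := by
    intro J
    have h1 : ∫ x, k x * J x ∂leb = ∫ x, q.indicator J x ∂leb := by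
      refine integral_congr_ae ?_
      filter_upwards [indicatorConstLp_coeFn (p := 1) (hs := hm) (hμs := measure_ne_top leb q)
        (c := (1 : ℂ))] with x hx
      change k x = _ at hx
      rw [hx]
      by_cases h : x ∈ q <;> simp [h]
    rw [h1, integral_indicator hm, Measure.restrict_restrict hm, inter_eq_left.2 hq01]
  have hfin : bNorm α k ≤ ENNReal.ofReal 1 := bNorm_le_of_isTest α.2.1 k fun φ u hφ => by
    rw [hk]
    exact norm_integral_indicator_test_le hq hq01 hφ
  exact ⟨BSpace.mk k (hfin.trans_lt ENNReal.ofReal_lt_top).ne, hk⟩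

lemma hasFiniteRange_smulRight {E : Type*} [NormedAddCommGroup E] [NormedSpace ℂ E]
    (Λ : E →L[ℂ] ℂ) (e : E) : ((Λ.smulRight e : E →L[ℂ] E) : E →ₗ[ℂ] E).HasFiniteRange := by
  have : ((Λ.smulRight e : E →L[ℂ] E) : E →ₗ[ℂ] E) =
      (LinearMap.toSpanSingleton ℂ E e) ∘ₗ (Λ : E →ₗ[ℂ] ℂ) := by
    ext x; simp
  rw [this]
  exact LinearMap.HasFiniteRange.comp_right LinearMap.HasFiniteRange.of_finite_dom _

lemma hasFiniteRange_sum {E : Type*} [NormedAddCommGroup E] [NormedSpace ℂ E] {κ : Type*}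
    (s : Finset κ) (F : κ → E →L[ℂ] E) (hF : ∀ k, ((F k : E →L[ℂ] E) : E →ₗ[ℂ] E).HasFiniteRange) :
    ((∑ k ∈ s, F k : E →L[ℂ] E) : E →ₗ[ℂ] E).HasFiniteRange := by
  classical
  induction s using Finset.induction_on with
  | empty => simp
  | insert k s hk ih => rw [Finset.sum_insert hk]; exact hasFiniteRange_add (hF k) ih

/-- An operator whose dual maps test functions to functions with Hölder primitive on each of
finitely many disjoint intervals is, up to an operator of finite rank, bounded by eight times the
Hölder bound. -/
lemma essNormLE_of_dual {κ : Type*} [Finite κ] {q : κ → Set ℝ}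
    (hq : ∀ k, (q k).OrdConnected) (hq01 : ∀ k, q k ⊆ Icc 0 1)
    (hdisj : Pairwise fun i j => Disjoint (q i) (q j)) {T : BSpace α →L[ℂ] BSpace α}
    {J : (ℝ → ℂ) → ℝ → ℂ} {H : ℝ} (hH : 0 ≤ H) (hα0 : 0 < (α : ℝ))
    (hT : ∀ φ u : ℝ → ℂ, IsTest α φ u → ∀ h, ∫ x, BSpace.toL1 (T h) x * u x ∂leb =
      ∫ x, BSpace.toL1 h x * J u x ∂leb)
    (hJm : ∀ φ u : ℝ → ℂ, IsTest α φ u → Measurable (J u))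
    (hJb : ∀ φ u : ℝ → ℂ, IsTest α φ u → ∃ C : ℝ, ∀ x, ‖J u x‖ ≤ C)
    (hJ0 : ∀ φ u : ℝ → ℂ, IsTest α φ u → ∀ x ∉ ⋃ k, q k, J u x = 0)
    (hJH : ∀ φ u : ℝ → ℂ, IsTest α φ u → ∀ k x y, x ≤ y →
      ‖∫ t in x..y, (q k).indicator (J u) t‖ ≤ H * volume.real (q k ∩ Ioc x y) ^ (α : ℝ)) :
    EssNormLE T (8 * H) := by
  classical
  have := Fintype.ofFinite κ
  have hqm : ∀ k, MeasurableSet (q k) := fun k => (hq k).measurableSet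
  choose e he using fun k => exists_indicator (α := α) (hq k) (hq01 k)
  have hind1 : ∀ k x, ‖(q k).indicator (fun _ => (1 : ℂ)) x‖ ≤ 1 := fun k x =>
    (norm_indicator_le_norm_self _ _).trans (by simp)
  have hindm : ∀ k, Measurable ((q k).indicator fun _ => (1 : ℂ)) := fun k =>
    measurable_const.indicator (hqm k)
  choose Λ hΛ using fun k => BSpace.exists_integral_clm (hindm k) (hind1 k)
  set w : κ → ℂ := fun k => ((volume.real (q k) : ℝ) : ℂ)
  -- `E` replaces a density by its mean on each cell. It has finite rank, so only `T - T * E` needs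
  -- a bound; its dual subtracts from `J u` the mean over each cell. A null cell gets coefficient
  -- zero because the inverse of zero is zero.
  set E : BSpace α →L[ℂ] BSpace α :=
    ∑ k, (((w k)⁻¹ • (Λ k).comp BSpace.toL1CLM).smulRight (e k))
  have hEapp : ∀ h, E h = ∑ k, ((w k)⁻¹ * Λ k (BSpace.toL1 h)) • e k := fun h => by
    simp [E]
  have hE : (E : BSpace α →ₗ[ℂ] BSpace α).HasFiniteRange :=
    hasFiniteRange_sum _ _ fun k => hasFiniteRange_smulRight _ _
  refine ⟨T - T * E, T * E, by abel, ?_, hasFiniteRange_mul_left hE T⟩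
  refine ContinuousLinearMap.opNorm_le_bound _ (by positivity) fun h => ?_
  refine BSpace.norm_le_of_isTest _ (by positivity) fun φ u hφ => ?_
  obtain ⟨C, hC⟩ := hJb φ u hφ
  have hC0 : 0 ≤ C := (norm_nonneg _).trans (hC 0)
  have hm := hJm φ u hφ
  obtain ⟨Λ', hΛ'⟩ := BSpace.exists_integral_clm hm hC
  have happ : (T - T * E) h = T (h - E h) := by
    rw [map_sub]; rfl
  set c : κ → ℂ := fun k => (w k)⁻¹ * ∫ x in q k, J u x
  set V : ℝ → ℂ := fun x => J u x - ∑ k, c k * (q k).indicator (fun _ => (1 : ℂ)) x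
  have hVm : Measurable V :=
    hm.sub (Finset.measurable_sum _ fun k _ => measurable_const.mul (hindm k))
  have hVb : ∀ x, ‖V x‖ ≤ C + ∑ k, ‖c k‖ := fun x => by
    refine (norm_sub_le _ _).trans (add_le_add (hC x) ((norm_sum_le _ _).trans
      (Finset.sum_le_sum fun k _ => ?_)))
    rw [norm_mul]
    exact mul_le_of_le_one_right (norm_nonneg _) (hind1 k x)
  have hVdual : ∫ x, BSpace.toL1 ((T - T * E) h) x * u x ∂leb =
      ∫ x, BSpace.toL1 h x * V x ∂leb := by
    rw [happ, hT φ u hφ, ← hΛ', map_sub, map_sub, hEapp, map_sum, map_sum, hΛ']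
    have e1 : ∀ k, Λ' (BSpace.toL1 (((w k)⁻¹ * Λ k (BSpace.toL1 h)) • e k)) =
        c k * ∫ x, BSpace.toL1 h x * (q k).indicator (fun _ => (1 : ℂ)) x ∂leb := fun k => by
      rw [map_smul, map_smul, hΛ', he, hΛ, smul_eq_mul]
      simp only [c]; ring
    simp_rw [e1]
    have e2 : ∀ x, BSpace.toL1 h x * V x = BSpace.toL1 h x * J u x -
        ∑ k, c k * (BSpace.toL1 h x * (q k).indicator (fun _ => (1 : ℂ)) x) := fun x => by
      simp only [V]
      rw [mul_sub, Finset.mul_sum]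
      congr 1
      exact Finset.sum_congr rfl fun k _ => by ring
    simp_rw [e2]
    have hi : ∀ k, Integrable (fun x => c k * (BSpace.toL1 h x *
        (q k).indicator (fun _ => (1 : ℂ)) x)) leb := fun k =>
      (BSpace.integrable_mul_of_bounded _ (hindm k) (hind1 k)).const_mul _
    rw [integral_sub (BSpace.integrable_mul_of_bounded _ hm hC)
      (integrable_finsetSum _ fun k _ => hi k), integral_finsetSum _ fun k _ => hi k]
    simp_rw [integral_const_mul]
  rw [hVdual]
  have h8 : 8 * H = 2 * (4 * H) := by ring
  rw [h8]
  refine BSpace.norm_integral_mul_le h hVm hVb (by positivity) fun x _ y _ hxy => ?_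
  have hJi : ∀ k, IntervalIntegrable ((q k).indicator (J u)) volume x y := fun k =>
    (intervalIntegrable_const (c := C)).mono_fun' (hm.indicator (hqm k)).aestronglyMeasurable
      (Filter.Eventually.of_forall fun t => (norm_indicator_le_norm_self _ _).trans (hC t))
  have h1i : ∀ k, IntervalIntegrable (fun t => c k * (q k).indicator (fun _ => (1 : ℂ)) t)
      volume x y := fun k =>
    ((intervalIntegrable_const (c := (1 : ℝ))).mono_fun' (hindm k).aestronglyMeasurable
      (Filter.Eventually.of_forall fun t => hind1 k t)).const_mul _
  -- `P k` is the contribution of the cell `k` to the increment from `x` to `y`. As `V` has mean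
  -- zero on the cell, it vanishes unless `x` or `y` lies there. At most two cells remain, each
  -- giving `2 * H`; with the factor `2` of the pairing bound this makes `8 * H`.
  set P : κ → ℂ := fun k => (∫ t in x..y, (q k).indicator (J u) t) -
    c k * ((volume.real (q k ∩ Ioc x y) : ℝ) : ℂ)
  have hVP : ∫ t in x..y, V t = ∑ k, P k := by
    have e1 : ∀ t, V t = ∑ k, ((q k).indicator (J u) t -
        c k * (q k).indicator (fun _ => (1 : ℂ)) t) := fun t => by
      simp only [V]
      rw [Finset.sum_sub_distrib]
      congr 1
      by_cases ht : t ∈ ⋃ k, q k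
      · obtain ⟨k, hk⟩ := mem_iUnion.1 ht
        rw [Finset.sum_eq_single k, indicator_of_mem hk]
        · intro j _ hj
          exact indicator_of_notMem (fun h => Set.disjoint_left.1 (hdisj hj) h hk) _
        · simp
      · rw [hJ0 φ u hφ t ht]
        refine (Finset.sum_eq_zero fun k _ => ?_).symm
        exact indicator_of_notMem (fun h => ht (mem_iUnion.2 ⟨k, h⟩)) _
    simp_rw [e1]
    rw [intervalIntegral.integral_finsetSum fun k _ => (hJi k).sub (h1i k)]
    refine Finset.sum_congr rfl fun k _ => ?_
    rw [intervalIntegral.integral_sub (hJi k) (h1i k), intervalIntegral.integral_const_mul,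
      intervalIntegral_indicator_eq (hqm k) (fun _ => (1 : ℂ)) hxy, setIntegral_const]
    simp [P]
  have hinter : ∀ k, q k ∩ Ioc (-1) 1 = q k := fun k => inter_eq_left.2 fun x hx =>
    ⟨by linarith [(hq01 k hx).1], (hq01 k hx).2⟩
  have hfull : ∀ k, ∫ t in q k, J u t = ∫ t in (-1 : ℝ)..1, (q k).indicator (J u) t := fun k => by
    rw [intervalIntegral_indicator_eq (hqm k) _ (by norm_num), hinter]
  have hfullb : ∀ k, ‖∫ t in q k, J u t‖ ≤ H * volume.real (q k) ^ (α : ℝ) := fun k => by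
    have := hJH φ u hφ k (-1) 1 (by norm_num)
    rwa [← hfull, hinter] at this
  have hPb : ∀ k, ‖P k‖ ≤ 2 * H * (y - x) ^ (α : ℝ) := fun k => by
    have hvle := volume_real_inter_Ioc_le (q k) hxy
    set v := volume.real (q k ∩ Ioc x y)
    have hv0 : 0 ≤ v := measureReal_nonneg
    have hvq : v ≤ volume.real (q k) := measureReal_mono inter_subset_left
      ((measure_mono (hq01 k)).trans_lt (by simp)).ne
    -- The mean over the cell is at most `H` times its length to the power `α - 1`. This exponent is
    -- nonpositive, so the shorter length `v` may be substituted.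
    have h2 : ‖c k * (v : ℂ)‖ ≤ H * v ^ (α : ℝ) := by
      rw [norm_mul, norm_mul, norm_inv, Complex.norm_real, Complex.norm_real,
        Real.norm_of_nonneg measureReal_nonneg, Real.norm_of_nonneg hv0]
      rcases hv0.eq_or_lt with h0 | h0
      · rw [← h0, mul_zero, Real.zero_rpow hα0.ne', mul_zero]
      · have hqp : 0 < volume.real (q k) := h0.trans_le hvq
        calc (volume.real (q k))⁻¹ * ‖∫ x in q k, J u x‖ * v
            ≤ (volume.real (q k))⁻¹ * (H * volume.real (q k) ^ (α : ℝ)) * v := by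
              gcongr; exact hfullb k
          _ = H * v * volume.real (q k) ^ ((α : ℝ) - 1) := by
              rw [Real.rpow_sub_one hqp.ne']; field_simp
          _ ≤ H * v * v ^ ((α : ℝ) - 1) := by
              refine mul_le_mul_of_nonneg_left ?_ (by positivity)
              exact Real.rpow_le_rpow_of_nonpos h0 hvq (by linarith [α.2.2])
          _ = H * v ^ (α : ℝ) := by
              rw [Real.rpow_sub_one h0.ne']; field_simp
    calc ‖P k‖ ≤ H * v ^ (α : ℝ) + H * v ^ (α : ℝ) :=
          (norm_sub_le _ _).trans (add_le_add (hJH φ u hφ k x y hxy) h2)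
      _ = 2 * H * v ^ (α : ℝ) := by ring
      _ ≤ _ := by
        refine mul_le_mul_of_nonneg_left ?_ (by positivity)
        exact Real.rpow_le_rpow hv0 hvle α.2.1
  have hP0 : ∀ k, x ∉ q k → y ∉ q k → P k = 0 := fun k hx hy => by
    simp only [P]
    rw [intervalIntegral_indicator_eq (hqm k) _ hxy]
    rcases (q k ∩ Ioc x y).eq_empty_or_nonempty with h0 | ⟨z, hz, hzI⟩
    · rw [h0]; simp
    · have hsub : q k ∩ Ioc x y = q k := by
        refine inter_eq_left.2 fun t ht => ⟨?_, ?_⟩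
        · by_contra hcon
          exact hx ((hq k).out ht hz ⟨not_lt.1 hcon, hzI.1.le⟩)
        · by_contra hcon
          exact hy ((hq k).out hz ht ⟨hzI.2, (not_le.1 hcon).le⟩)
      rw [hsub]
      by_cases hw : volume.real (q k) = 0
      · have := hfullb k
        rw [hw, Real.zero_rpow hα0.ne', mul_zero] at this
        rw [norm_le_zero_iff.1 this, hw]; simp
      · have hw' : w k ≠ 0 := by simpa [w] using hw
        simp only [c]
        change _ - (w k)⁻¹ * _ * w k = 0
        field_simp
        simp
  have hone : ∀ z : ℝ, ∑ k, (q k).indicator (fun _ => (1 : ℝ)) z ≤ 1 := fun z => by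
    by_cases hz : z ∈ ⋃ k, q k
    · obtain ⟨k, hk⟩ := mem_iUnion.1 hz
      rw [Finset.sum_eq_single k, indicator_of_mem hk]
      · intro j _ hj
        exact indicator_of_notMem (fun h => Set.disjoint_left.1 (hdisj hj) h hk) _
      · simp
    · rw [Finset.sum_eq_zero fun k _ =>
        indicator_of_notMem (fun h => hz (mem_iUnion.2 ⟨k, h⟩)) _]
      exact zero_le_one
  have hB : 0 ≤ 2 * H * (y - x) ^ (α : ℝ) := by
    have := Real.rpow_nonneg (sub_nonneg.2 hxy) (α : ℝ)
    positivity
  rw [hVP]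
  calc ‖∑ k, P k‖ ≤ ∑ k, ‖P k‖ := norm_sum_le _ _
    _ ≤ ∑ k, ((q k).indicator (fun _ => (1 : ℝ)) x + (q k).indicator (fun _ => (1 : ℝ)) y) *
        (2 * H * (y - x) ^ (α : ℝ)) := by
        refine Finset.sum_le_sum fun k _ => ?_
        by_cases hx : x ∈ q k
        · rw [indicator_of_mem hx]
          refine (hPb k).trans (le_mul_of_one_le_left hB ?_)
          have : 0 ≤ (q k).indicator (fun _ => (1 : ℝ)) y := indicator_nonneg (by simp) _
          linarith
        · by_cases hy : y ∈ q k
          · rw [indicator_of_mem hy, indicator_of_notMem hx]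
            refine (hPb k).trans (le_mul_of_one_le_left hB ?_)
            simp
          · rw [hP0 k hx hy, indicator_of_notMem hx, indicator_of_notMem hy]
            simp
    _ ≤ 2 * (2 * H * (y - x) ^ (α : ℝ)) := by
        rw [← Finset.sum_mul, Finset.sum_add_distrib]
        refine mul_le_mul_of_nonneg_right ?_ hB
        linarith [hone x, hone y]
    _ = _ := by ring

end Averaging

end ExpandingMap

/-! ### Finite systems of branches with constant weights -/

namespace ExpandingMap

variable {α : unitInterval}

/-- Finitely many `C¹` monotone branches with bounded derivatives on disjoint open intervals,
carrying constant weights `c k` such that `|c k| |(F k)'| ^ α ≤ θ`. -/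
structure BranchSystem (α θ : ℝ) (κ : Type*) where
  q : κ → Set ℝ
  F : κ → ℝ → ℝ
  F' : κ → ℝ → ℝ
  c : κ → ℂ
  m : κ → ℝ
  isOpen : ∀ k, IsOpen (q k)
  ordConnected : ∀ k, (q k).OrdConnected
  subset : ∀ k, q k ⊆ Icc 0 1
  disjoint : Pairwise fun i j => Disjoint (q i) (q j)
  hasDerivAt : ∀ k, ∀ x ∈ q k, HasDerivAt (F k) (F' k x) x
  continuousOn : ∀ k, ContinuousOn (F' k) (q k)
  monotone : ∀ k, MonotoneOn (F k) (q k) ∨ AntitoneOn (F k) (q k)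
  mapsTo : ∀ k, MapsTo (F k) (q k) (Icc 0 1)
  nonneg : ∀ k, 0 ≤ m k
  le : ∀ k, ∀ x ∈ q k, |F' k x| ≤ m k
  bound : ∀ k, ‖c k‖ * m k ^ α ≤ θ

namespace BranchSystem

variable {θ : ℝ} {κ : Type*}

lemma continuousOn_F {a : ℝ} (S : BranchSystem a θ κ) (k : κ) :
    ContinuousOn (S.F k) (S.q k) := fun x hx =>
  (S.hasDerivAt k x hx).continuousAt.continuousWithinAt

/-- The dual action of a system of branches on functions. -/
def pull [Fintype κ] {a : ℝ} (S : BranchSystem a θ κ) (ψ : ℝ → ℂ) (x : ℝ) : ℂ :=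
  ∑ k, (S.q k).indicator (fun x => S.c k * ((S.F' k x : ℝ) : ℂ) * ψ (S.F k x)) x

variable [Fintype κ] {a : ℝ} (S : BranchSystem a θ κ)

lemma measurable_pull {ψ : ℝ → ℂ} (hψ : Measurable ψ) : Measurable (S.pull ψ) := by
  refine Finset.measurable_sum _ fun k _ => ?_
  have hm := (S.isOpen k).measurableSet
  refine measurable_of_restrict_of_restrict_compl hm ?_ ?_
  · have e : (S.q k).domRestrict ((S.q k).indicator
        fun x => S.c k * ((S.F' k x : ℝ) : ℂ) * ψ (S.F k x)) =
        fun x => S.c k * (((S.q k).domRestrict (S.F' k) x : ℝ) : ℂ) *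
          ψ ((S.q k).domRestrict (S.F k) x) := by
      ext x; simp
    rw [e]
    have h1 := (continuousOn_iff_continuous_domRestrict.1 (S.continuousOn k)).measurable
    have h2 := (continuousOn_iff_continuous_domRestrict.1 (S.continuousOn_F k)).measurable
    exact (measurable_const.mul (Complex.measurable_ofReal.comp h1)).mul (hψ.comp h2)
  · have e : (S.q k)ᶜ.domRestrict ((S.q k).indicator
        fun x => S.c k * ((S.F' k x : ℝ) : ℂ) * ψ (S.F k x)) = fun _ => 0 := by
      ext x; simp only [domRestrict_apply]; exact indicator_of_notMem x.2 _
    rw [e]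
    exact measurable_const

lemma norm_pull_le {ψ : ℝ → ℂ} {C : ℝ} (hψ : ∀ x, ‖ψ x‖ ≤ C) (x : ℝ) :
    ‖S.pull ψ x‖ ≤ ∑ k, ‖S.c k‖ * S.m k * C := by
  have hC : 0 ≤ C := (norm_nonneg _).trans (hψ 0)
  refine (norm_sum_le _ _).trans (Finset.sum_le_sum fun k _ => ?_)
  have h0 := S.nonneg k
  by_cases hx : x ∈ S.q k
  · rw [indicator_of_mem hx, norm_mul, norm_mul, Complex.norm_real]
    gcongr
    · exact S.le k x hx
    · exact hψ _
  · rw [indicator_of_notMem hx, norm_zero]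
    positivity

lemma pull_of_mem {ψ : ℝ → ℂ} {k : κ} {x : ℝ} (hx : x ∈ S.q k) :
    S.pull ψ x = S.c k * ((S.F' k x : ℝ) : ℂ) * ψ (S.F k x) := by
  rw [pull, Finset.sum_eq_single k, indicator_of_mem hx]
  · intro j _ hj
    exact indicator_of_notMem (fun h => Set.disjoint_left.1 (S.disjoint hj) h hx) _
  · simp

lemma pull_of_notMem {ψ : ℝ → ℂ} {x : ℝ} (hx : x ∉ ⋃ k, S.q k) : S.pull ψ x = 0 :=
  Finset.sum_eq_zero fun k _ => indicator_of_notMem (fun h => hx (mem_iUnion.2 ⟨k, h⟩)) _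

end BranchSystem

/-- `T` is the transfer operator of a finite system of branches with constant weights. -/
def IsFiniteBranch (T : BSpace α →L[ℂ] BSpace α) (θ : ℝ) : Prop :=
  ∃ (n : ℕ) (S : BranchSystem α θ (Fin n)), ∀ h (ψ : ℝ → ℂ), Measurable ψ →
    (∃ C : ℝ, ∀ x, ‖ψ x‖ ≤ C) →
    ∫ x, BSpace.toL1 (T h) x * ψ x ∂leb = ∫ x, BSpace.toL1 h x * S.pull ψ x ∂leb

/-- Reindexing the branches of a system. -/
lemma isFiniteBranch_of_fintype {κ : Type*} [Fintype κ] {θ : ℝ} (S : BranchSystem α θ κ)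
    {T : BSpace α →L[ℂ] BSpace α}
    (hT : ∀ h (ψ : ℝ → ℂ), Measurable ψ → (∃ C : ℝ, ∀ x, ‖ψ x‖ ≤ C) →
      ∫ x, BSpace.toL1 (T h) x * ψ x ∂leb = ∫ x, BSpace.toL1 h x * S.pull ψ x ∂leb) :
    IsFiniteBranch T θ := by
  let e := (Fintype.equivFin κ).symm
  refine ⟨Fintype.card κ,
    { q := fun k => S.q (e k)
      F := fun k => S.F (e k)
      F' := fun k => S.F' (e k)
      c := fun k => S.c (e k)
      m := fun k => S.m (e k)
      isOpen := fun k => S.isOpen _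
      ordConnected := fun k => S.ordConnected _
      subset := fun k => S.subset _
      disjoint := fun i j hij => S.disjoint (e.injective.ne hij)
      hasDerivAt := fun k => S.hasDerivAt _
      continuousOn := fun k => S.continuousOn _
      monotone := fun k => S.monotone _
      mapsTo := fun k => S.mapsTo _
      nonneg := fun k => S.nonneg _
      le := fun k => S.le _
      bound := fun k => S.bound _ }, fun h ψ hψ hC => ?_⟩
  rw [hT h ψ hψ hC]
  congr 1
  ext x
  congr 1
  exact (Equiv.sum_comp e fun k =>
    (S.q k).indicator (fun x => S.c k * ((S.F' k x : ℝ) : ℂ) * ψ (S.F k x)) x).symm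

lemma ordConnected_inter_preimage {q r : Set ℝ} {F : ℝ → ℝ} (hq : q.OrdConnected)
    (hr : r.OrdConnected) (hF : MonotoneOn F q ∨ AntitoneOn F q) :
    (q ∩ F ⁻¹' r).OrdConnected := by
  refine ⟨fun x hx y hy z hz => ?_⟩
  have hzq : z ∈ q := hq.out hx.1 hy.1 hz
  refine ⟨hzq, ?_⟩
  rcases hF with hF | hF
  · exact hr.out hx.2 hy.2 ⟨hF hx.1 hzq hz.1, hF hzq hy.1 hz.2⟩
  · exact hr.out hy.2 hx.2 ⟨hF hzq hy.1 hz.2, hF hx.1 hzq hz.1⟩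

/-- The composition of two systems of branches. -/
def BranchSystem.comp {a θ θ' : ℝ} {κ κ' : Type*} (S : BranchSystem a θ κ)
    (S' : BranchSystem a θ' κ') (hθ : 0 ≤ θ) : BranchSystem a (θ * θ') (κ' × κ) where
  q p := S'.q p.1 ∩ S'.F p.1 ⁻¹' S.q p.2
  F p x := S.F p.2 (S'.F p.1 x)
  F' p x := S.F' p.2 (S'.F p.1 x) * S'.F' p.1 x
  c p := S.c p.2 * S'.c p.1
  m p := S.m p.2 * S'.m p.1
  isOpen p := ContinuousOn.isOpen_inter_preimage
    (fun x hx => (S'.hasDerivAt p.1 x hx).continuousAt.continuousWithinAt) (S'.isOpen _)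
    (S.isOpen _)
  ordConnected p := ordConnected_inter_preimage (S'.ordConnected _) (S.ordConnected _)
    (S'.monotone _)
  subset p := inter_subset_left.trans (S'.subset _)
  disjoint := by
    rintro ⟨j, k⟩ ⟨j', k'⟩ hne
    refine Set.disjoint_left.2 fun x hx hx' => ?_
    by_cases hj : j = j'
    · subst hj
      have hk : k ≠ k' := fun h => hne (by rw [h])
      exact Set.disjoint_left.1 (S.disjoint hk) hx.2 hx'.2
    · exact Set.disjoint_left.1 (S'.disjoint hj) hx.1 hx'.1
  hasDerivAt p x hx := (S.hasDerivAt p.2 _ hx.2).comp x (S'.hasDerivAt p.1 x hx.1)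
  continuousOn p := by
    refine ContinuousOn.mul ?_ ((S'.continuousOn p.1).mono inter_subset_left)
    exact (S.continuousOn p.2).comp (fun x hx =>
      (S'.hasDerivAt p.1 x hx.1).continuousAt.continuousWithinAt) fun x hx => hx.2
  monotone p := by
    rcases S.monotone p.2 with h | h <;> rcases S'.monotone p.1 with h' | h'
    · exact Or.inl fun x hx y hy hxy => h hx.2 hy.2 (h' hx.1 hy.1 hxy)
    · exact Or.inr fun x hx y hy hxy => h hy.2 hx.2 (h' hx.1 hy.1 hxy)
    · exact Or.inr fun x hx y hy hxy => h hx.2 hy.2 (h' hx.1 hy.1 hxy)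
    · exact Or.inl fun x hx y hy hxy => h hy.2 hx.2 (h' hx.1 hy.1 hxy)
  mapsTo p x hx := S.mapsTo p.2 hx.2
  nonneg p := mul_nonneg (S.nonneg _) (S'.nonneg _)
  le p x hx := by
    rw [abs_mul]
    exact mul_le_mul (S.le _ _ hx.2) (S'.le _ _ hx.1) (abs_nonneg _) (S.nonneg _)
  bound p := by
    have h0 := S'.nonneg p.1
    rw [norm_mul, Real.mul_rpow (S.nonneg _) (S'.nonneg _)]
    calc ‖S.c p.2‖ * ‖S'.c p.1‖ * (S.m p.2 ^ a * S'.m p.1 ^ a) =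
        (‖S.c p.2‖ * S.m p.2 ^ a) * (‖S'.c p.1‖ * S'.m p.1 ^ a) := by ring
      _ ≤ θ * θ' := mul_le_mul (S.bound _) (S'.bound _) (by positivity) hθ

/-- Duality reverses the order of composition. By disjointness at most one branch of each system is
active at a point, so both sides reduce to a single term and the chain rule compares them. -/
lemma BranchSystem.pull_comp {a θ θ' : ℝ} {κ κ' : Type*} [Fintype κ] [Fintype κ']
    (S : BranchSystem a θ κ) (S' : BranchSystem a θ' κ') (hθ : 0 ≤ θ) (ψ : ℝ → ℂ) :
    (S.comp S' hθ).pull ψ = S'.pull (S.pull ψ) := by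
  ext x
  by_cases hx : x ∈ ⋃ k, S'.q k
  · obtain ⟨j, hj⟩ := mem_iUnion.1 hx
    rw [S'.pull_of_mem hj]
    by_cases hy : S'.F j x ∈ ⋃ k, S.q k
    · obtain ⟨k, hk⟩ := mem_iUnion.1 hy
      rw [S.pull_of_mem hk, (S.comp S' hθ).pull_of_mem (k := (j, k)) ⟨hj, hk⟩]
      simp only [comp]
      push_cast
      ring
    · rw [S.pull_of_notMem hy, (S.comp S' hθ).pull_of_notMem, mul_zero]
      intro h
      obtain ⟨p, hp⟩ := mem_iUnion.1 h
      have hpj : p.1 = j := by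
        by_contra hne
        exact Set.disjoint_left.1 (S'.disjoint hne) hp.1 hj
      have h2 : S'.F p.1 x ∈ S.q p.2 := hp.2
      rw [hpj] at h2
      exact hy (mem_iUnion.2 ⟨_, h2⟩)
  · rw [S'.pull_of_notMem hx, (S.comp S' hθ).pull_of_notMem]
    intro h
    obtain ⟨p, hp⟩ := mem_iUnion.1 h
    exact hx (mem_iUnion.2 ⟨_, hp.1⟩)

/-- Both the constant weights and the derivative bounds multiply along a composition, so `θ` is
multiplicative without loss. The number of branches grows but never enters the constants, which is
why powers keep the bound `θ ^ n`. -/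
lemma IsFiniteBranch.mul {T T' : BSpace α →L[ℂ] BSpace α} {θ θ' : ℝ} (hθ : 0 ≤ θ)
    (hT : IsFiniteBranch T θ) (hT' : IsFiniteBranch T' θ') : IsFiniteBranch (T * T') (θ * θ') := by
  obtain ⟨n, S, hS⟩ := hT
  obtain ⟨n', S', hS'⟩ := hT'
  refine isFiniteBranch_of_fintype (S.comp S' hθ) fun h ψ hψ hC => ?_
  rw [S.pull_comp S' hθ]
  have h1 : (T * T') h = T (T' h) := rfl
  obtain ⟨C, hC'⟩ := hC
  rw [h1, hS _ ψ hψ ⟨C, hC'⟩, hS' _ _ (S.measurable_pull hψ) ⟨_, S.norm_pull_le hC'⟩]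

lemma IsFiniteBranch.pow {T : BSpace α →L[ℂ] BSpace α} {θ : ℝ} (hθ : 0 ≤ θ)
    (hT : IsFiniteBranch T θ) {n : ℕ} (hn : n ≠ 0) : IsFiniteBranch (T ^ n) (θ ^ n) := by
  induction n with
  | zero => exact absurd rfl hn
  | succ n ih =>
    rcases eq_or_ne n 0 with rfl | h
    · simpa using hT
    · rw [pow_succ, pow_succ]
      exact (ih h).mul (by positivity) hT

/-- With a constant weight no Young integral is needed: on a cell the dual function is the exact
derivative of `c k * φ ∘ F k`, whose increment is at most `‖c k‖ (m k (t - s))^α ≤ θ (t - s)^α`.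
Averaging over the cells does the rest. -/
lemma IsFiniteBranch.essNormLE {T : BSpace α →L[ℂ] BSpace α} {θ : ℝ} (hα0 : 0 < (α : ℝ))
    (hθ : 0 ≤ θ) (hT : IsFiniteBranch T θ) : EssNormLE T (8 * θ) := by
  obtain ⟨n, S, hS⟩ := hT
  have hb : ∀ φ u : ℝ → ℂ, IsTest α φ u → ∃ C : ℝ, ∀ x, ‖S.pull u x‖ ≤ C := fun φ u hφ => by
    obtain ⟨C, hC⟩ := hφ.bounded
    exact ⟨_, S.norm_pull_le hC⟩
  refine essNormLE_of_dual S.ordConnected S.subset S.disjoint (J := S.pull) hθ hα0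
    (fun φ u hφ h => hS h u hφ.continuous.measurable hφ.bounded)
    (fun φ u hφ => S.measurable_pull hφ.continuous.measurable) hb
    (fun φ u hφ x hx => S.pull_of_notMem hx) fun φ u hφ k x y hxy => ?_
  obtain ⟨C, hC⟩ := hb φ u hφ
  refine norm_integral_indicator_le (S.ordConnected k)
    (S.measurable_pull hφ.continuous.measurable) hC hθ α.2.1 (fun s hs t ht hst => ?_) hxy
  have hsub : Icc s t ⊆ S.q k := (S.ordConnected k).out hs ht
  have hd : ∀ x ∈ uIcc s t, HasDerivAt (fun x => S.c k * φ (S.F k x)) (S.pull u x) x := by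
    intro x hx
    rw [uIcc_of_le hst] at hx
    rw [S.pull_of_mem (hsub hx)]
    have := ((hφ.hasDerivAt (S.F k x)).scomp x (S.hasDerivAt k x (hsub hx))).const_mul (S.c k)
    simpa [Function.comp_def, mul_assoc] using this
  have hcont : ContinuousOn (S.pull u) (Icc s t) := by
    have h1 : ContinuousOn (fun x => S.c k * ((S.F' k x : ℝ) : ℂ) * u (S.F k x)) (Icc s t) :=
      (continuousOn_const.mul (Complex.continuous_ofReal.comp_continuousOn
        ((S.continuousOn k).mono hsub))).mul
        (hφ.continuous.comp_continuousOn ((S.continuousOn_F k).mono hsub))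
    exact h1.congr fun x hx => S.pull_of_mem (hsub hx)
  rw [intervalIntegral.integral_eq_sub_of_hasDerivAt hd
    (ContinuousOn.intervalIntegrable (by rwa [uIcc_of_le hst])), ← mul_sub, norm_mul]
  have hlip : |S.F k t - S.F k s| ≤ S.m k * |t - s| :=
    (convex_Icc s t).norm_image_sub_le_of_norm_hasDerivWithin_le
      (fun x hx => (S.hasDerivAt k x (hsub hx)).hasDerivWithinAt)
      (fun x hx => S.le k x (hsub hx)) (left_mem_Icc.2 hst) (right_mem_Icc.2 hst)
  rw [abs_of_nonneg (sub_nonneg.2 hst)] at hlip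
  calc ‖S.c k‖ * ‖φ (S.F k t) - φ (S.F k s)‖ ≤ ‖S.c k‖ * (S.m k * (t - s)) ^ (α : ℝ) := by
        gcongr
        refine (hφ.holder _ (S.mapsTo k ht) _ (S.mapsTo k hs)).trans ?_
        exact Real.rpow_le_rpow (abs_nonneg _) hlip α.2.1
    _ = (‖S.c k‖ * S.m k ^ (α : ℝ)) * (t - s) ^ (α : ℝ) := by
        rw [Real.mul_rpow (S.nonneg k) (sub_nonneg.2 hst), mul_assoc]
    _ ≤ θ * (t - s) ^ (α : ℝ) :=
        mul_le_mul_of_nonneg_right (S.bound k) (Real.rpow_nonneg (sub_nonneg.2 hst) _)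

end ExpandingMap

/-! ### Choice of exponents and uniform bounds along branches -/

namespace ExpandingMap

/-- Take the largest `t` allowed by the three upper bounds, `min 1 (min (1 / r) ((1 - α) / α))`.
When the minimum is `1`, the strict inequality is `h2`; when it is `1 / r`, it is `h1`; when it is
`(1 - α) / α`, it is `hβr`. This explains the threshold for `α` and the condition on `β`. -/
lemma exists_exponent {α β r : ℝ} (hα0 : 0 < α) (hα1 : α < 1) (hβ0 : 0 < β) (hβ1 : β ≤ 1)
    (hr : 0 < r) (hβr : 1 / (r + 1) < β) (h1 : 1 - β < α)
    (h2 : (1 - β) / (1 - β * (1 - r)) < α) :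
    ∃ t : ℝ, 0 < t ∧ t ≤ 1 ∧ r * t ≤ 1 ∧ α * t ≤ 1 - α ∧
      1 - α < β * (1 - α + α * (r * t)) := by
  have h3 : 1 - β < α * (1 - β * (1 - r)) := by
    rwa [div_lt_iff₀ (by nlinarith [mul_pos hβ0 hr])] at h2
  have h4 : 1 < β * (r + 1) := by rwa [div_lt_iff₀ (by linarith)] at hβr
  have hpos : 0 < (1 - α) / α := div_pos (by linarith) hα0
  have hinv : 0 < 1 / r := by positivity
  set t := min 1 (min (1 / r) ((1 - α) / α)) with ht
  refine ⟨t, by simp only [ht, lt_min_iff]; exact ⟨one_pos, hinv, hpos⟩, min_le_left _ _,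
    ?_, ?_, ?_⟩
  · have : t ≤ 1 / r := (min_le_right _ _).trans (min_le_left _ _)
    rw [le_div_iff₀ hr] at this
    linarith
  · have : t ≤ (1 - α) / α := (min_le_right _ _).trans (min_le_right _ _)
    rw [le_div_iff₀ hα0] at this
    linarith
  · rcases min_choice 1 (min (1 / r) ((1 - α) / α)) with h | h
    · rw [ht, h]
      nlinarith
    · rcases min_choice (1 / r) ((1 - α) / α) with h' | h'
      · rw [ht, h, h', mul_one_div_cancel hr.ne']
        nlinarith
      · have e : α * (r * ((1 - α) / α)) = r * (1 - α) := by field_simp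
        rw [ht, h, h', e]
        nlinarith [mul_lt_mul_of_pos_right h4 (by linarith : 0 < 1 - α)]

/-- `K` depends only on the exponents and on `C` and `ρ`, hence serves all branches and
subintervals. The main term has the form `‖ξ z‖ * |D z| ^ α` because `z` maximises `|D|`, which
makes `|D z|` a Lipschitz constant of `f`. -/
lemma exists_norm_integral_le {α β r t C ρ : ℝ} (hα0 : 0 ≤ α) (hα1 : α ≤ 1) (hβ : 0 < β)
    (hr : 0 ≤ r) (ht0 : 0 ≤ t) (ht1 : t ≤ 1) (hrt : r * t ≤ 1) (hC : 0 ≤ C) (hρ0 : 0 ≤ ρ)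
    (hexp : 1 - α < β * (1 - α + α * (r * t))) :
    ∃ K : ℝ, 0 ≤ K ∧ ∀ {f D : ℝ → ℝ} {φ u : ℝ → ℂ} {ξ : ℝ → ℂ} {x₀ y₀ : ℝ}, x₀ ≤ y₀ →
    IsTest α φ u → (∀ x ∈ Icc x₀ y₀, HasDerivAt f (D x) x) →
    (∀ x ∈ Icc x₀ y₀, f x ∈ Icc (0 : ℝ) 1) →
    ContinuousOn D (Icc x₀ y₀) → (∀ x ∈ Icc x₀ y₀, 1 ≤ |D x|) →
    (∀ x ∈ Icc x₀ y₀, ∀ y ∈ Icc x₀ y₀, ‖ξ x - ξ y‖ ≤ C * |x - y| ^ β) →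
    (∀ x ∈ Icc x₀ y₀, ‖ξ x‖ * |D x| ≤ ρ) →
    ∃ z ∈ Icc x₀ y₀, ‖∫ x in x₀..y₀, ξ x * (u (f x) * ((D x : ℝ) : ℂ))‖ ≤
      (‖ξ z‖ * |D z| ^ α + K * ((y₀ - x₀) ^ (β * (1 - α + α * (r * t)) - α * t) *
        (∫ x in x₀..y₀, |D x| ^ r) ^ (α * t))) * (y₀ - x₀) ^ α := by
  set σ : ℝ := 1 - α + α * (r * t) with hσ
  set K : ℝ := 2 * (C ^ σ * (2 * ρ) ^ (α * (1 - r * t))) /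
        (1 - 2 ^ (1 - (β * σ + α * (1 - t)) - α * t)) with hK
  have hden : 0 < 1 - (2 : ℝ) ^ (1 - (β * σ + α * (1 - t)) - α * t) := by
    have : (2 : ℝ) ^ (1 - (β * σ + α * (1 - t)) - α * t) < 1 :=
      Real.rpow_lt_one_of_one_lt_of_neg one_lt_two (by nlinarith)
    linarith
  refine ⟨K, by positivity, ?_⟩
  intro f D φ u ξ x₀ y₀ hxy hφ hf hf01 hD hD1 hξ hρ
  obtain ⟨z, hz, hz1, hz2⟩ := exists_young hα0 hα1 hβ hr ht0 ht1 hrt hC hρ0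
    (by linarith) hxy hφ hf hf01 hD hD1 hξ hρ
  refine ⟨z, hz, ?_⟩
  have hl : 0 ≤ y₀ - x₀ := sub_nonneg.2 hxy
  have hlip : |f y₀ - f x₀| ≤ |D z| * |y₀ - x₀| :=
    (convex_Icc x₀ y₀).norm_image_sub_le_of_norm_hasDerivWithin_le
      (fun x hx => (hf x hx).hasDerivWithinAt)
      (fun x hx => hz1 x hx) (left_mem_Icc.2 hxy) (right_mem_Icc.2 hxy)
  have h1 : ‖ξ z * (φ (f y₀) - φ (f x₀))‖ ≤ ‖ξ z‖ * |D z| ^ α * (y₀ - x₀) ^ α := by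
    rw [norm_mul, mul_assoc, ← Real.mul_rpow (abs_nonneg _) hl]
    gcongr
    refine (hφ.holder _ (hf01 _ (right_mem_Icc.2 hxy)) _ (hf01 _ (left_mem_Icc.2 hxy))).trans ?_
    rw [abs_of_nonneg hl] at hlip
    exact Real.rpow_le_rpow (abs_nonneg _) hlip hα0
  have h2 : (y₀ - x₀) ^ (β * σ + α * (1 - t)) ≤
      (y₀ - x₀) ^ (β * σ - α * t) * (y₀ - x₀) ^ α := by
    rcases hl.eq_or_lt with h0 | h0
    · rw [← h0, Real.zero_rpow]
      · positivity
      · nlinarith [mul_nonneg hα0 (sub_nonneg.2 ht1)]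
    · rw [← Real.rpow_add h0]
      exact le_of_eq (congrArg _ (by ring))
  have hW : 0 ≤ ∫ x in x₀..y₀, |D x| ^ r :=
    intervalIntegral.integral_nonneg hxy fun x _ => by positivity
  have hK0 : 0 ≤ K := by positivity
  have h3 := norm_le_norm_add_norm_sub' (∫ x in x₀..y₀, ξ x * (u (f x) * ((D x : ℝ) : ℂ)))
    (ξ z * (φ (f y₀) - φ (f x₀)))
  refine h3.trans ((add_le_add h1 hz2).trans ?_)
  rw [add_mul]
  refine add_le_add le_rfl ?_
  change K * _ * _ ≤ _
  calc K * (y₀ - x₀) ^ (β * σ + α * (1 - t)) * (∫ x in x₀..y₀, |D x| ^ r) ^ (α * t)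
      ≤ K * ((y₀ - x₀) ^ (β * σ - α * t) * (y₀ - x₀) ^ α) *
        (∫ x in x₀..y₀, |D x| ^ r) ^ (α * t) := by gcongr
    _ = _ := by ring

variable {ι : Type*} {a b : ι → ℝ} {f : ℝ → ℝ}

lemma norm_integral_pullback_eq (hf : IsPiecewiseExpanding a b f) {i : ι} {x y : ℝ} (hxy : x ≤ y)
    (hsub : Icc x y ⊆ Ioo (a i) (b i)) (η ψ : ℝ → ℂ) :
    ‖∫ s in x..y, pullback a b f η ψ s‖ =
      ‖∫ s in x..y, η s * (ψ (f s) * ((deriv f s : ℝ) : ℂ))‖ := by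
  have hmem : ∀ s ∈ uIcc x y, s ∈ Ioo (a i) (b i) := fun s hs =>
    hsub (by rwa [uIcc_of_le hxy] at hs)
  have hU : ∀ s ∈ uIcc x y, s ∈ ⋃ i, Ioo (a i) (b i) := fun s hs => mem_iUnion.2 ⟨i, hmem s hs⟩
  rcases hf.deriv_sign i with h | h
  · congr 1
    refine intervalIntegral.integral_congr fun s hs => ?_
    rw [pullback, indicator_of_mem (hU s hs), abs_of_pos (h s (hmem s hs))]
    ring
  · rw [← norm_neg (∫ s in x..y, pullback a b f η ψ s), ← intervalIntegral.integral_neg]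
    congr 1
    refine intervalIntegral.integral_congr fun s hs => ?_
    rw [pullback, indicator_of_mem (hU s hs), abs_of_neg (h s (hmem s hs))]
    push_cast
    ring

lemma exists_norm_integral_pullback_le (hf : IsPiecewiseExpanding a b f)
    {α β r t C ρ : ℝ} (hα0 : 0 ≤ α)
    (hα1 : α ≤ 1) (hβ : 0 < β) (hr : 0 ≤ r) (ht0 : 0 ≤ t) (ht1 : t ≤ 1) (hrt : r * t ≤ 1)
    (hC : 0 ≤ C) (hρ0 : 0 ≤ ρ) (hexp : 1 - α < β * (1 - α + α * (r * t)))
    (hfr : IntegrableOn (fun x => |deriv f x| ^ r) (Icc 0 1)) :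
    ∃ K : ℝ, 0 ≤ K ∧ ∀ {i : ι} {φ u η : ℝ → ℂ} {x y : ℝ}, x ≤ y →
    Icc x y ⊆ Ioo (a i) (b i) → IsTest α φ u →
    (∀ s ∈ Icc x y, ∀ s' ∈ Icc x y, ‖η s - η s'‖ ≤ C * |s - s'| ^ β) →
    (∀ s ∈ Icc x y, ‖η s‖ * |deriv f s| ≤ ρ) →
    ∃ z ∈ Icc x y, ‖∫ s in x..y, pullback a b f η u s‖ ≤
      (‖η z‖ * |deriv f z| ^ α + K * ((y - x) ^ (β * (1 - α + α * (r * t)) - α * t) *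
        (∫ s in Ioo (a i) (b i), |deriv f s| ^ r) ^ (α * t))) * (y - x) ^ α := by
  obtain ⟨K, hK, h⟩ := exists_norm_integral_le hα0 hα1 hβ hr ht0 ht1 hrt hC hρ0 hexp
  refine ⟨K, hK, ?_⟩
  intro i φ u η x y hxy hsub hφ hη hρ
  obtain ⟨z, hz, hz'⟩ := h (f := f) (D := deriv f) (ξ := η) hxy hφ
    (fun s hs => hf.hasDerivAt (hsub hs))
    (fun s hs => hf.mapsTo i (hsub hs)) ((hf.continuousOn_deriv i).mono hsub)
    (fun s hs => hf.one_le_abs_deriv (hsub hs)) hη hρ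
  refine ⟨z, hz, ?_⟩
  rw [norm_integral_pullback_eq hf hxy hsub]
  refine hz'.trans ?_
  have hl : 0 ≤ y - x := sub_nonneg.2 hxy
  have hW : ∫ s in x..y, |deriv f s| ^ r ≤ ∫ s in Ioo (a i) (b i), |deriv f s| ^ r := by
    rw [intervalIntegral.integral_of_le hxy]
    refine setIntegral_mono_set (hfr.mono_set (hf.isPartition.subset i)) ?_ ?_
    · exact Filter.Eventually.of_forall fun s => by positivity
    · exact (Ioc_subset_Icc_self.trans hsub).eventuallyLE
  have hW0 : 0 ≤ ∫ s in x..y, |deriv f s| ^ r :=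
    intervalIntegral.integral_nonneg hxy fun s _ => by positivity
  gcongr

lemma summable_integral (hf : IsPartition a b) {g : ℝ → ℝ} (hg : IntegrableOn g (Icc 0 1)) :
    Summable fun i => ∫ x in Ioo (a i) (b i), g x := by
  have := hf.countable
  exact (hasSum_integral_iUnion (fun i => measurableSet_Ioo) hf.disjoint
    (hg.mono_set (iUnion_subset hf.subset))).summable

lemma add_rpow_le {p x y : ℝ} (hp : 0 ≤ p) (hx : 0 ≤ x) (hy : 0 ≤ y) :
    (x + y) ^ p ≤ 2 ^ p * (x ^ p + y ^ p) := by
  rw [mul_add, ← Real.mul_rpow zero_le_two hx, ← Real.mul_rpow zero_le_two hy]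
  rcases le_total x y with h | h
  · have := Real.rpow_le_rpow (by positivity) (by linarith : x + y ≤ 2 * y) hp
    have h0 : 0 ≤ (2 * x) ^ p := by positivity
    linarith
  · have := Real.rpow_le_rpow (by positivity) (by linarith : x + y ≤ 2 * x) hp
    have h0 : 0 ≤ (2 * y) ^ p := by positivity
    linarith

lemma summable_add_rpow {κ : Type*} {p : ℝ} (hp : 0 ≤ p) {x y : κ → ℝ} (hx : ∀ k, 0 ≤ x k)
    (hy : ∀ k, 0 ≤ y k) (h1 : Summable fun k => x k ^ p) (h2 : Summable fun k => y k ^ p) :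
    Summable fun k => (x k + y k) ^ p :=
  Summable.of_nonneg_of_le (fun k => Real.rpow_nonneg (add_nonneg (hx k) (hy k)) _)
    (fun k => add_rpow_le hp (hx k) (hy k)) ((h1.add h2).mul_left _)

/-- Lengths are at most one, so after raising to the power `1 / (1 - α)` the exponent of the length
may be lowered to `1 - s` with `s = τ / (1 - α)`. The weighted arithmetic-geometric mean inequality
then bounds each term by length plus integral, and both are summable. -/
lemma summable_length_mul (hf : IsPartition a b) {g : ℝ → ℝ}
    (hg : IntegrableOn g (Icc 0 1)) (hg0 : ∀ x, 0 ≤ g x) {α e τ : ℝ} (hα1 : α < 1) (hτ0 : 0 ≤ τ)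
    (hτ : τ ≤ 1 - α) (he : 1 - α ≤ e + τ) :
    Summable fun i => ((b i - a i) ^ e * (∫ x in Ioo (a i) (b i), g x) ^ τ) ^ (1 / (1 - α)) := by
  have h1α : 0 < 1 - α := by linarith
  have hl : Summable fun i => b i - a i := by
    have := summable_integral hf (g := fun _ => 1) (integrableOn_const (by simp))
    refine this.congr fun i => ?_
    simp [(hf.lt i).le]
  refine Summable.of_nonneg_of_le (fun i => ?_) (fun i => ?_) (hl.add (summable_integral hf hg))
  · have h0 : 0 ≤ b i - a i := sub_nonneg.2 (hf.lt i).le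
    have hW : 0 ≤ ∫ x in Ioo (a i) (b i), g x := integral_nonneg fun x => hg0 x
    positivity
  · have h0 : 0 < b i - a i := sub_pos.2 (hf.lt i)
    have h1 : b i - a i ≤ 1 := by linarith [hf.nonneg i, hf.le_one i]
    have hW : 0 ≤ ∫ x in Ioo (a i) (b i), g x := integral_nonneg fun x => hg0 x
    set W := ∫ x in Ioo (a i) (b i), g x
    set s := τ * (1 / (1 - α)) with hs
    have hs0 : 0 ≤ s := by positivity
    have hs1 : s ≤ 1 := by rw [hs, mul_one_div, div_le_one h1α]; exact hτ
    have hse : 1 - s ≤ e * (1 / (1 - α)) := by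
      have : 1 ≤ (e + τ) * (1 / (1 - α)) := by rw [mul_one_div, le_div_iff₀ h1α]; linarith
      rw [hs]; linarith
    rw [Real.mul_rpow (by positivity) (by positivity), ← Real.rpow_mul h0.le, ← Real.rpow_mul hW]
    calc (b i - a i) ^ (e * (1 / (1 - α))) * W ^ s ≤ (b i - a i) ^ (1 - s) * W ^ s := by
          gcongr ?_ * _
          exact Real.rpow_le_rpow_of_exponent_ge h0 h1 hse
      _ ≤ (1 - s) * (b i - a i) + s * W :=
          Real.geom_mean_le_arith_mean2_weighted (by linarith) hs0 h0.le hW (by ring)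
      _ ≤ b i - a i + W := by nlinarith

end ExpandingMap

/-! ### Transfer operators on `𝓑_α` by duality -/

namespace ExpandingMap

open Filter Topology

variable {α : unitInterval} {ι : Type*} {a b : ι → ℝ} {f : ℝ → ℝ}

/-- `T` is the transfer operator with weight `η`, in the sense of duality. -/
def IsDual (a b : ι → ℝ) (f : ℝ → ℝ) (η : ℝ → ℂ) (T : BSpace α →L[ℂ] BSpace α) : Prop :=
  ∀ h (ψ : ℝ → ℂ), Measurable ψ → (∃ C : ℝ, ∀ x, ‖ψ x‖ ≤ C) →
    ∫ x, BSpace.toL1 (T h) x * ψ x ∂leb = ∫ x, BSpace.toL1 h x * pullback a b f η ψ x ∂leb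

lemma exists_transfer (hf : IsPiecewiseExpanding a b f) {η : ℝ → ℂ} (hη : Measurable η)
    {ρ K : ℝ} (hρ0 : 0 ≤ ρ) (hρ : ∀ x ∈ ⋃ i, Ioo (a i) (b i), ‖η x‖ * |deriv f x| ≤ ρ)
    (hK : 0 ≤ K) (hbound : ∀ φ u : ℝ → ℂ, IsTest α φ u → ∀ x y, x ≤ y →
      ‖∫ s in x..y, pullback a b f η u s‖ ≤ K * (y - x) ^ (α : ℝ)) :
    ∃ T : BSpace α →L[ℂ] BSpace α, IsDual a b f η T ∧ ‖T‖ ≤ 2 * K ∧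
      (∀ h, ‖BSpace.toL1 (T h)‖ ≤ ρ * ‖BSpace.toL1 h‖) ∧ IsTransferOperator a b f η T := by
  obtain ⟨T, h1, h2, h3⟩ := exists_transfer_lp hf hη hρ0 hρ
  obtain ⟨T', hT', hn⟩ := BSpace.exists_restrict (α := α) T (B := 2 * K) (by positivity)
    fun h φ u hφ => by
      obtain ⟨C, hC⟩ := hφ.bounded
      rw [h1 _ u hφ.continuous.measurable ⟨C, hC⟩]
      exact BSpace.norm_integral_mul_le h (measurable_pullback hf hη hφ.continuous.measurable)
        (norm_pullback_le hρ0 hρ hC) hK fun x _ y _ hxy => hbound φ u hφ x y hxy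
  refine ⟨T', fun h ψ hψ hC => ?_, hn, fun h => ?_, fun h => ?_⟩
  · rw [hT', h1 _ ψ hψ hC]
  · rw [hT']
    exact h2 _
  · rw [hT']
    exact h3 _

lemma IsDual.sub (hf : IsPiecewiseExpanding a b f) {η η' : ℝ → ℂ} (hη : Measurable η)
    (hη' : Measurable η') {ρ ρ' : ℝ}
    (hρ0 : 0 ≤ ρ) (hρ : ∀ x ∈ ⋃ i, Ioo (a i) (b i), ‖η x‖ * |deriv f x| ≤ ρ)
    (hρ0' : 0 ≤ ρ') (hρ' : ∀ x ∈ ⋃ i, Ioo (a i) (b i), ‖η' x‖ * |deriv f x| ≤ ρ')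
    {T T' : BSpace α →L[ℂ] BSpace α} (hT : IsDual a b f η T) (hT' : IsDual a b f η' T') :
    IsDual a b f (fun x => η x - η' x) (T - T') := by
  rintro h ψ hψ ⟨C, hC⟩
  have e1 : ∫ x, BSpace.toL1 ((T - T') h) x * ψ x ∂leb =
      ∫ x, (BSpace.toL1 (T h) x * ψ x - BSpace.toL1 (T' h) x * ψ x) ∂leb := by
    refine integral_congr_ae ?_
    have : BSpace.toL1 ((T - T') h) = BSpace.toL1 (T h) - BSpace.toL1 (T' h) := by
      rw [← map_sub]; rfl
    rw [this]
    filter_upwards [Lp.coeFn_sub (BSpace.toL1 (T h)) (BSpace.toL1 (T' h))] with x hx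
    rw [hx, Pi.sub_apply, sub_mul]
  have e2 : ∀ x, BSpace.toL1 h x * pullback a b f (fun x => η x - η' x) ψ x =
      BSpace.toL1 h x * pullback a b f η ψ x - BSpace.toL1 h x * pullback a b f η' ψ x := by
    intro x
    by_cases hx : x ∈ ⋃ i, Ioo (a i) (b i)
    · simp only [pullback, indicator_of_mem hx]; ring
    · simp only [pullback, indicator_of_notMem hx]; ring
  rw [e1, integral_sub (BSpace.integrable_mul_of_bounded _ hψ hC)
    (BSpace.integrable_mul_of_bounded _ hψ hC), hT h ψ hψ ⟨C, hC⟩, hT' h ψ hψ ⟨C, hC⟩]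
  simp only [e2]
  rw [integral_sub
    (BSpace.integrable_mul_of_bounded _ (measurable_pullback hf hη hψ) (norm_pullback_le hρ0 hρ hC))
    (BSpace.integrable_mul_of_bounded _ (measurable_pullback hf hη' hψ)
      (norm_pullback_le hρ0' hρ' hC))]

lemma pullback_eq_zero {η ψ : ℝ → ℂ} {x : ℝ} (hx : η x = 0) : pullback a b f η ψ x = 0 := by
  by_cases h : x ∈ ⋃ i, Ioo (a i) (b i)
  · simp [pullback, h, hx]
  · simp [pullback, h]

/-- The transfer operator with a weight supported on a family of cells. -/
lemma exists_transfer_of_cells (hf : IsPiecewiseExpanding a b f) {η : ℝ → ℂ} (hη : Measurable η)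
    {ρ : ℝ} (hρ0 : 0 ≤ ρ) (hρ : ∀ x ∈ ⋃ i, Ioo (a i) (b i), ‖η x‖ * |deriv f x| ≤ ρ)
    (hα0 : 0 < (α : ℝ)) (hα1 : (α : ℝ) < 1)
    {κ : Type*} [Countable κ] {q : κ → Set ℝ} (hq : ∀ k, (q k).OrdConnected)
    (hdisj : Pairwise fun i j => Disjoint (q i) (q j)) (hη0 : ∀ x ∉ ⋃ k, q k, η x = 0)
    {H : κ → ℝ} (hH : ∀ k, 0 ≤ H k) (hsum : Summable fun k => H k ^ (1 / (1 - (α : ℝ))))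
    (hb : ∀ φ u : ℝ → ℂ, IsTest α φ u → ∀ k, ∀ x ∈ q k, ∀ y ∈ q k, x ≤ y →
      ‖∫ s in x..y, pullback a b f η u s‖ ≤ H k * (y - x) ^ (α : ℝ)) :
    ∃ T : BSpace α →L[ℂ] BSpace α, IsDual a b f η T ∧
      ‖T‖ ≤ 2 * (∑' k, H k ^ (1 / (1 - (α : ℝ)))) ^ (1 - (α : ℝ)) ∧
      (∀ h, ‖BSpace.toL1 (T h)‖ ≤ ρ * ‖BSpace.toL1 h‖) ∧ IsTransferOperator a b f η T := by
  refine exists_transfer hf hη hρ0 hρ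
    (Real.rpow_nonneg (tsum_nonneg fun k => Real.rpow_nonneg (hH k) _) _) fun φ u hφ x y hxy => ?_
  obtain ⟨C, hC⟩ := hφ.bounded
  have hJ := measurable_pullback hf hη hφ.continuous.measurable
  have hJC := norm_pullback_le hρ0 hρ hC
  have h1 := norm_integral_iUnion_le (fun k => (hq k).measurableSet) hdisj hJ hJC hH hα0 hα1 hsum
    hxy fun k => norm_integral_indicator_le (hq k) hJ hJC (hH k) hα0.le (hb φ u hφ k) hxy
  rwa [indicator_eq_self.2] at h1
  intro s hs
  by_contra hn
  exact hs (pullback_eq_zero (hη0 s hn))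

lemma tendsto_two_mul_rpow {e : ℝ} (he : 0 < e) :
    Tendsto (fun δ : ℝ => (2 * δ) ^ e) (𝓝[>] 0) (𝓝 0) := by
  have h : Tendsto (fun δ : ℝ => 2 * δ) (𝓝[>] 0) (𝓝 0) := by
    have : Continuous fun δ : ℝ => 2 * δ := by fun_prop
    simpa using (this.tendsto 0).mono_left nhdsWithin_le_nhds
  simpa [Real.zero_rpow he.ne'] using h.rpow_const (p := e) (Or.inr he.le)

lemma eventually_forall_of_nhdsWithin {S : Set ℝ} {s : ℝ} {P : ℝ → Prop}
    (h : ∀ᶠ z in 𝓝[S] s, P z) : ∀ᶠ δ in 𝓝[>] (0 : ℝ), ∀ z ∈ S, |z - s| < δ → P z := by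
  obtain ⟨ε, hε, h'⟩ := Metric.mem_nhdsWithin_iff.1 h
  filter_upwards [Ioo_mem_nhdsGT hε] with δ hδ z hz hzs
  exact h' ⟨by rw [Metric.mem_ball, Real.dist_eq]; exact hzs.trans hδ.2, hz⟩

end ExpandingMap

/-! ### Local approximation of the weight by constants -/

namespace ExpandingMap

open Filter Topology

variable {α : unitInterval} {ι : Type*} {a b : ι → ℝ} {f : ℝ → ℝ}

/-- Near each point of the closure of an interval of the partition, the weight is close to a
constant. -/
lemma exists_local_weight (hf : IsPiecewiseExpanding a b f) {β r t C ρ : ℝ} (hα0 : 0 < (α : ℝ))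
    (hα1 : (α : ℝ) < 1) (hβ : 0 < β) (hr : 0 ≤ r) (ht0 : 0 ≤ t) (ht1 : t ≤ 1) (hrt : r * t ≤ 1)
    (hC : 0 ≤ C) (hρ0 : 0 ≤ ρ) (hexp : 1 - (α : ℝ) < β * (1 - α + α * (r * t)))
    (hαt : α * t ≤ 1 - (α : ℝ))
    (hfr : IntegrableOn (fun x => |deriv f x| ^ r) (Icc 0 1)) {η : ℝ → ℂ} {θ θ' ε : ℝ} {i : ι}
    (hηC : ∀ x ∈ Ioo (a i) (b i), ∀ y ∈ Ioo (a i) (b i), ‖η x - η y‖ ≤ C * |x - y| ^ β)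
    (hηρ : ∀ x ∈ Ioo (a i) (b i), ‖η x‖ * |deriv f x| ≤ ρ)
    (hηθ : ∀ x ∈ Ioo (a i) (b i), ‖η x‖ * |deriv f x| ^ (α : ℝ) ≤ θ)
    (hθ0 : 0 ≤ θ) (hθ' : θ < θ') (hε : 0 < ε) {s : ℝ} (hs : s ∈ Icc (a i) (b i)) :
    ∃ δ > 0, ∃ (c : ℂ) (m : ℝ), 0 ≤ m ∧
      (c ≠ 0 → ∀ x ∈ Ioo (a i) (b i), |x - s| < δ → |deriv f x| ≤ m) ∧
      ‖c‖ * m ^ (α : ℝ) ≤ θ' ∧ ∀ φ u : ℝ → ℂ, IsTest α φ u → ∀ x y, x ≤ y →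
        Icc x y ⊆ Ioo (a i) (b i) → (∀ z ∈ Icc x y, |z - s| < δ) →
        ‖∫ w in x..y, pullback a b f (fun x => η x - c) u w‖ ≤ ε * (y - x) ^ (α : ℝ) := by
  obtain ⟨g, hgc, hg⟩ := hf.extends_inv_deriv i
  set e : ℝ := β * (1 - α + α * (r * t)) - α * t with he
  have he0 : 0 < e := by linarith
  set W : ℝ := ∫ s in Ioo (a i) (b i), |deriv f s| ^ r with hW
  have hW0 : 0 ≤ W := integral_nonneg fun x => by positivity
  have hsmall : ∀ K : ℝ, ∀ᶠ δ in 𝓝[>] (0 : ℝ), K * ((2 * δ) ^ e * W ^ ((α : ℝ) * t)) < ε / 2 := by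
    intro K
    have := ((tendsto_two_mul_rpow he0).mul_const (W ^ ((α : ℝ) * t))).const_mul K
    rw [zero_mul, mul_zero] at this
    exact this.eventually_lt_const (by positivity)
  have hgs : ∀ x ∈ Ioo (a i) (b i), |g x|⁻¹ = |deriv f x| := fun x hx => by
    rw [hg hx, abs_inv, inv_inv]
  have hlen : ∀ {δ x y : ℝ}, x ≤ y → (∀ z ∈ Icc x y, |z - s| < δ) → y - x ≤ 2 * δ :=
    fun {δ x y} hxy h => by
    have h1 := abs_lt.1 (h x (left_mem_Icc.2 hxy))
    have h2 := abs_lt.1 (h y (right_mem_Icc.2 hxy))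
    linarith
  have hgt : Tendsto (fun z => |g z|) (𝓝[Icc (a i) (b i)] s) (𝓝 |g s|) := (hgc s hs).abs
  rcases eq_or_ne (g s) 0 with h0 | h0
  -- Here `1 / f'` tends to zero at `s`. Then `‖η‖ * |f'| ^ α ≤ ρ * |f'| ^ (α - 1)` is small near
  -- `s`, and the constant `0` is a good approximation. No derivative bound exists in this case,
  -- hence the proviso `c ≠ 0`.
  · obtain ⟨K, hK, hbd⟩ := exists_norm_integral_pullback_le hf hα0.le hα1.le hβ hr ht0 ht1 hrt hC
      hρ0 hexp hfr
    have hev : ∀ᶠ z in 𝓝[Icc (a i) (b i)] s, ρ * |g z| ^ (1 - (α : ℝ)) < ε / 2 := by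
      have := (hgt.rpow_const (p := 1 - (α : ℝ)) (Or.inr (by linarith))).const_mul ρ
      rw [h0, abs_zero, Real.zero_rpow (by linarith), mul_zero] at this
      exact this.eventually_lt_const (by positivity)
    obtain ⟨δ, ⟨h1, h2⟩, hδ⟩ := (((hsmall K).and (eventually_forall_of_nhdsWithin hev)).and
      self_mem_nhdsWithin).exists
    refine ⟨δ, hδ, 0, 0, le_rfl, fun h => absurd rfl h, by simpa using hθ0.trans hθ'.le, ?_⟩
    intro φ u hφ x y hxy hsub hz
    simp only [sub_zero]
    have hl : 0 ≤ y - x := sub_nonneg.2 hxy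
    obtain ⟨z, hzm, hz'⟩ := hbd hxy hsub hφ (fun s hs s' hs' => hηC s (hsub hs) s' (hsub hs'))
      (fun s hs => hηρ s (hsub hs))
    refine hz'.trans (mul_le_mul_of_nonneg_right ?_ (by positivity))
    have h3 := h2 z (Ioo_subset_Icc_self (hsub hzm)) (hz z hzm)
    have h4 : ‖η z‖ * |deriv f z| ^ (α : ℝ) ≤ ρ * |g z| ^ (1 - (α : ℝ)) := by
      have hD := hf.one_le_abs_deriv (hsub hzm)
      have hD0 : 0 < |deriv f z| := by linarith
      have h5 : |g z| = |deriv f z|⁻¹ := by rw [← hgs z (hsub hzm), inv_inv]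
      have h6 : |deriv f z| ^ (α : ℝ) = |deriv f z| * |g z| ^ (1 - (α : ℝ)) := by
        rw [h5, Real.inv_rpow hD0.le, ← Real.rpow_neg hD0.le]
        nth_rewrite 2 [← Real.rpow_one |deriv f z|]
        rw [← Real.rpow_add hD0]
        congr 1
        ring
      rw [h6, ← mul_assoc]
      exact mul_le_mul_of_nonneg_right (hηρ z (hsub hzm)) (by positivity)
    have h7 : K * ((y - x) ^ e * W ^ ((α : ℝ) * t)) ≤ K * ((2 * δ) ^ e * W ^ ((α : ℝ) * t)) := by
      have := hlen hxy hz
      gcongr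
    linarith
  · have hgpos : 0 < |g s| := abs_pos.2 h0
    set D₀ : ℝ := |g s|⁻¹ with hD₀
    have hD₀pos : 0 < D₀ := inv_pos.2 hgpos
    -- `κ` is the tolerance in `m ^ α`: as `‖η‖ ≤ ρ`, replacing `|f'| ^ α` by `m ^ α` raises the
    -- product by at most `θ' - θ`. Adding one to `ρ` avoids a zero denominator.
    set κ : ℝ := (θ' - θ) / (ρ + 1) with hκ
    have hκ0 : 0 < κ := div_pos (by linarith) (by linarith)
    obtain ⟨m, hm1, hm2⟩ : ∃ m, m ^ (α : ℝ) < D₀ ^ (α : ℝ) + κ ∧ D₀ < m := by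
      have hc : Tendsto (fun m : ℝ => m ^ (α : ℝ)) (𝓝[>] D₀) (𝓝 (D₀ ^ (α : ℝ))) :=
        ((Real.continuousAt_rpow_const D₀ α (Or.inl hD₀pos.ne')).tendsto).mono_left
          nhdsWithin_le_nhds
      exact ((hc.eventually_lt_const (by linarith)).and self_mem_nhdsWithin).exists
    have hm0 : 0 < m := hD₀pos.trans hm2
    obtain ⟨K, hK, hbd⟩ := exists_norm_integral_pullback_le (ρ := ρ + ρ * m) hf hα0.le hα1.le hβ hr
      ht0 ht1 hrt hC (by positivity) hexp hfr
    have hinv : Tendsto (fun z => |g z|⁻¹) (𝓝[Icc (a i) (b i)] s) (𝓝 D₀) := hgt.inv₀ hgpos.ne'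
    have hev : ∀ᶠ z in 𝓝[Icc (a i) (b i)] s,
        |g z|⁻¹ < m ∧ m ^ (α : ℝ) - κ < (|g z|⁻¹) ^ (α : ℝ) :=
      (hinv.eventually_lt_const hm2).and
        ((hinv.rpow_const (p := (α : ℝ)) (Or.inl hD₀pos.ne')).eventually_const_lt (by linarith))
    have hsmall2 : ∀ᶠ δ in 𝓝[>] (0 : ℝ), C * (2 * δ) ^ β * m ^ (α : ℝ) < ε / 2 := by
      have := ((tendsto_two_mul_rpow hβ).const_mul C).mul_const (m ^ (α : ℝ))
      rw [mul_zero, zero_mul] at this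
      exact this.eventually_lt_const (by positivity)
    obtain ⟨δ, ⟨⟨h1, h2⟩, h3⟩, hδ⟩ := ((((hsmall K).and hsmall2).and
      (eventually_forall_of_nhdsWithin hev)).and self_mem_nhdsWithin).exists
    -- The constant is the value of the weight at a nearby interior point, since `s` may be an
    -- endpoint, where the hypotheses say nothing about `η`.
    obtain ⟨z₀, hz₀, hz₀s⟩ : ∃ z ∈ Ioo (a i) (b i), |z - s| < δ := by
      have hcl : s ∈ closure (Ioo (a i) (b i)) := by
        rwa [closure_Ioo (hf.isPartition.lt i).ne]
      obtain ⟨z, hz, hzs⟩ := Metric.mem_closure_iff.1 hcl δ hδ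
      exact ⟨z, hz, by rwa [dist_comm, Real.dist_eq] at hzs⟩
    have hD : ∀ z ∈ Ioo (a i) (b i), |z - s| < δ →
        |deriv f z| ≤ m ∧ m ^ (α : ℝ) - κ < |deriv f z| ^ (α : ℝ) := fun z hz hzs => by
      have := h3 z (Ioo_subset_Icc_self hz) hzs
      rw [hgs z hz] at this
      exact ⟨this.1.le, this.2⟩
    have hηle : ∀ z ∈ Ioo (a i) (b i), ‖η z‖ ≤ ρ := fun z hz =>
      (le_mul_of_one_le_right (norm_nonneg _) (hf.one_le_abs_deriv hz)).trans (hηρ z hz)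
    refine ⟨δ, hδ, η z₀, m, hm0.le, fun _ x hx hxs => (hD x hx hxs).1, ?_, ?_⟩
    · have h4 := (hD z₀ hz₀ hz₀s).2
      have h5 := hηθ z₀ hz₀
      have h6 : ‖η z₀‖ * (m ^ (α : ℝ) - |deriv f z₀| ^ (α : ℝ)) ≤ θ' - θ := by
        calc ‖η z₀‖ * (m ^ (α : ℝ) - |deriv f z₀| ^ (α : ℝ)) ≤ ‖η z₀‖ * κ :=
              mul_le_mul_of_nonneg_left (by linarith) (norm_nonneg _)
          _ ≤ (ρ + 1) * κ := mul_le_mul_of_nonneg_right (by linarith [hηle z₀ hz₀]) hκ0.le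
          _ = θ' - θ := by rw [hκ]; field_simp
      linarith
    · intro φ u hφ x y hxy hsub hz
      have hl : 0 ≤ y - x := sub_nonneg.2 hxy
      obtain ⟨z, hzm, hz'⟩ := hbd (η := fun x => η x - η z₀) hxy hsub hφ
        (fun s hs s' hs' => by
          rw [sub_sub_sub_cancel_right]; exact hηC s (hsub hs) s' (hsub hs'))
        (fun s hs => by
          calc ‖η s - η z₀‖ * |deriv f s| ≤ (‖η s‖ + ‖η z₀‖) * |deriv f s| := by
                gcongr; exact norm_sub_le _ _
            _ = ‖η s‖ * |deriv f s| + ‖η z₀‖ * |deriv f s| := by ring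
            _ ≤ ρ + ρ * m := add_le_add (hηρ s (hsub hs))
                (mul_le_mul (hηle z₀ hz₀) (hD s (hsub hs) (hz s hs)).1 (abs_nonneg _) hρ0))
      refine hz'.trans (mul_le_mul_of_nonneg_right ?_ (by positivity))
      have h4 : ‖η z - η z₀‖ * |deriv f z| ^ (α : ℝ) ≤ C * (2 * δ) ^ β * m ^ (α : ℝ) := by
        have hd : |z - z₀| ≤ 2 * δ := by
          have h5 := abs_lt.1 (hz z hzm)
          have h6 := abs_lt.1 hz₀s
          rw [abs_le]
          constructor <;> linarith
        have h7 : ‖η z - η z₀‖ ≤ C * (2 * δ) ^ β :=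
          (hηC z (hsub hzm) z₀ hz₀).trans (by gcongr)
        exact mul_le_mul h7 (Real.rpow_le_rpow (abs_nonneg _)
          (hD z (hsub hzm) (hz z hzm)).1 hα0.le) (by positivity)
          (mul_nonneg hC (Real.rpow_nonneg (by linarith [show (0:ℝ) < δ from hδ]) _))
      have h7 : K * ((y - x) ^ e * W ^ ((α : ℝ) * t)) ≤
          K * ((2 * δ) ^ e * W ^ ((α : ℝ) * t)) := by
        have := hlen hxy hz
        gcongr
      linarith

/-- Each interval of the partition can be cut into finitely many cells on which the weight is
close to a constant. -/
lemma exists_cells (hf : IsPiecewiseExpanding a b f) {β r t C ρ : ℝ} (hα0 : 0 < (α : ℝ))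
    (hα1 : (α : ℝ) < 1) (hβ : 0 < β) (hr : 0 ≤ r) (ht0 : 0 ≤ t) (ht1 : t ≤ 1) (hrt : r * t ≤ 1)
    (hC : 0 ≤ C) (hρ0 : 0 ≤ ρ) (hexp : 1 - (α : ℝ) < β * (1 - α + α * (r * t)))
    (hαt : α * t ≤ 1 - (α : ℝ))
    (hfr : IntegrableOn (fun x => |deriv f x| ^ r) (Icc 0 1)) {η : ℝ → ℂ} {θ θ' ε : ℝ} {i : ι}
    (hηC : ∀ x ∈ Ioo (a i) (b i), ∀ y ∈ Ioo (a i) (b i), ‖η x - η y‖ ≤ C * |x - y| ^ β)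
    (hηρ : ∀ x ∈ Ioo (a i) (b i), ‖η x‖ * |deriv f x| ≤ ρ)
    (hηθ : ∀ x ∈ Ioo (a i) (b i), ‖η x‖ * |deriv f x| ^ (α : ℝ) ≤ θ)
    (hθ0 : 0 ≤ θ) (hθ' : θ < θ') (hε : 0 < ε) :
    ∃ (n : ℕ) (q : Fin n → Set ℝ) (c : Fin n → ℂ) (m : Fin n → ℝ),
      (∀ k, IsOpen (q k)) ∧ (∀ k, (q k).OrdConnected) ∧ (∀ k, q k ⊆ Ioo (a i) (b i)) ∧
      (Pairwise fun j k => Disjoint (q j) (q k)) ∧ volume (Ioo (a i) (b i) \ ⋃ k, q k) = 0 ∧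
      (∀ k, 0 ≤ m k) ∧ (∀ k, c k ≠ 0 → ∀ x ∈ q k, |deriv f x| ≤ m k) ∧
      (∀ k, ‖c k‖ * m k ^ (α : ℝ) ≤ θ') ∧
      ∀ φ u : ℝ → ℂ, IsTest α φ u → ∀ k, ∀ x ∈ q k, ∀ y ∈ q k, x ≤ y →
        ‖∫ w in x..y, pullback a b f (fun x => η x - c k) u w‖ ≤ ε * (y - x) ^ (α : ℝ) := by
  have hloc := fun s : Icc (a i) (b i) => exists_local_weight hf hα0 hα1 hβ hr ht0 ht1 hrt hC hρ0
    hexp hαt hfr hηC hηρ hηθ hθ0 hθ' hε s.2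
  choose δ hδ c m hm0 hm hcm hint using hloc
  -- By compactness there is a finite subdivision with every piece inside one of the local
  -- neighbourhoods.
  obtain ⟨T, hT0, hTm, ⟨n, hn⟩, hT⟩ := exists_monotone_Icc_subset_open_cover_Icc
    (hf.isPartition.lt i).le (c := fun s => Metric.ball s (δ s)) (fun s => Metric.isOpen_ball)
    fun s _ => mem_iUnion.2 ⟨s, Metric.mem_ball_self (hδ s)⟩
  choose p hp using hT
  have hmono : Monotone fun k => (T k : ℝ) := fun j k hjk => hTm hjk
  have hsub : ∀ k, Ioo (T k : ℝ) (T (k + 1)) ⊆ Ioo (a i) (b i) := fun k =>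
    Ioo_subset_Ioo (T k).2.1 (T (k + 1)).2.2
  have hdist : ∀ k, ∀ z ∈ Ioo (T k : ℝ) (T (k + 1)), |z - p k| < δ (p k) := fun k z hz => by
    have hz' : z ∈ Icc (a i) (b i) := Ioo_subset_Icc_self (hsub k hz)
    have := hp k (show (⟨z, hz'⟩ : Icc (a i) (b i)) ∈ Icc (T k) (T (k + 1)) from
      ⟨hz.1.le, hz.2.le⟩)
    rwa [Metric.mem_ball, Subtype.dist_eq, Real.dist_eq] at this
  refine ⟨n, fun k => Ioo (T k : ℝ) (T (k + 1)), fun k => c (p k), fun k => m (p k),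
    fun k => isOpen_Ioo, fun k => ordConnected_Ioo, fun k => hsub k, ?_, ?_, fun k => hm0 _,
    fun k hc x hx => hm _ hc x (hsub k hx) (hdist k x hx), fun k => hcm _, ?_⟩
  · intro j k hjk
    exact hmono.pairwise_disjoint_on_Ioo_succ (fun h => hjk (Fin.ext h))
  -- The open cells miss only subdivision points.
  · refine measure_mono_null (t := range fun k => (T k : ℝ)) ?_
      ((countable_range _).measure_zero _)
    rintro x ⟨hx, hx'⟩
    by_contra hxr
    have key : ∀ k : ℕ, k ≤ n → (T k : ℝ) < x := by
      intro k
      induction k with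
      | zero => intro _; rw [hT0]; exact hx.1
      | succ k ih =>
        intro hk
        by_contra hle
        refine hx' (mem_iUnion.2 ⟨⟨k, hk⟩, ih (by omega), ?_⟩)
        exact lt_of_le_of_ne (not_lt.1 hle) fun h => hxr ⟨k + 1, h.symm⟩
    have := key n le_rfl
    rw [hn n le_rfl] at this
    exact absurd hx.2 (not_lt.2 this.le)
  · intro φ u hφ k x hx y hy hxy
    have hI : Icc x y ⊆ Ioo (T k : ℝ) (T (k + 1)) := ordConnected_Ioo.out hx hy
    exact hint _ φ u hφ x y hxy (hI.trans (hsub k)) fun z hz => hdist k z (hI hz)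

end ExpandingMap

/-! ### Reduction to a finite system of branches -/

namespace ExpandingMap

open Filter Topology

variable {α : unitInterval} {ι : Type*} {a b : ι → ℝ} {f : ℝ → ℝ}

lemma integral_pullback_congr {η η' : ℝ → ℂ} {x y : ℝ} (hxy : x ≤ y)
    (h : ∀ s ∈ Icc x y, η s = η' s) (ψ : ℝ → ℂ) :
    ∫ s in x..y, pullback a b f η ψ s = ∫ s in x..y, pullback a b f η' ψ s := by
  refine intervalIntegral.integral_congr fun s hs => ?_
  rw [uIcc_of_le hxy] at hs
  by_cases hU : s ∈ ⋃ i, Ioo (a i) (b i)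
  · simp only [pullback, indicator_of_mem hU, h s hs]
  · simp only [pullback, indicator_of_notMem hU]

lemma exists_sign (hf : IsPiecewiseExpanding a b f) (i : ι) :
    ∃ σ : ℝ, |σ| = 1 ∧ ∀ x ∈ Ioo (a i) (b i), |deriv f x| = σ * deriv f x := by
  rcases hf.deriv_sign i with h | h
  · exact ⟨1, abs_one, fun x hx => by rw [abs_of_pos (h x hx), one_mul]⟩
  · exact ⟨-1, by simp, fun x hx => by rw [abs_of_neg (h x hx), neg_one_mul]⟩

lemma monotoneOn_or_antitoneOn (hf : IsPiecewiseExpanding a b f) (i : ι) :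
    MonotoneOn f (Ioo (a i) (b i)) ∨ AntitoneOn f (Ioo (a i) (b i)) := by
  have hc : ContinuousOn f (Ioo (a i) (b i)) := (hf.contDiffOn i).continuousOn
  have hd : DifferentiableOn ℝ f (interior (Ioo (a i) (b i))) :=
    ((hf.contDiffOn i).differentiableOn one_ne_zero).mono interior_subset
  rcases hf.deriv_sign i with h | h
  · exact Or.inl (monotoneOn_of_deriv_nonneg (convex_Ioo _ _) hc hd
      fun x hx => (h x (interior_subset hx)).le)
  · exact Or.inr (antitoneOn_of_deriv_nonpos (convex_Ioo _ _) hc hd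
      fun x hx => (h x (interior_subset hx)).le)

/-- The family of cells inside finitely many intervals of the partition, together with the
constant weights on them, is a system of branches. -/
def cellSystem (hf : IsPiecewiseExpanding a b f) {κ : Type*} (j : κ → ι) (q : κ → Set ℝ)
    (c : κ → ℂ) (m : κ → ℝ) (σ : ι → ℝ) {α θ : ℝ} (hσ : ∀ i, |σ i| = 1)
    (hqo : ∀ k, IsOpen (q k)) (hqc : ∀ k, (q k).OrdConnected)
    (hqs : ∀ k, q k ⊆ Ioo (a (j k)) (b (j k))) (hqd : Pairwise fun k l => Disjoint (q k) (q l))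
    (hm0 : ∀ k, 0 ≤ m k) (hm : ∀ k, c k ≠ 0 → ∀ x ∈ q k, |deriv f x| ≤ m k)
    (hcm : ∀ k, ‖c k‖ * m k ^ α ≤ θ) : BranchSystem α θ {k // c k ≠ 0} where
  q k := q k
  F _ := f
  F' _ := deriv f
  -- The dual weight carries `|f'|` whereas a branch system carries the signed derivative; the
  -- constant sign on the interval is moved into the weight.
  c k := (σ (j k) : ℂ) * c k
  m k := m k
  isOpen k := hqo k
  ordConnected k := hqc k
  subset k := (hqs k).trans (hf.isPartition.subset _)
  disjoint k l hkl := hqd fun h => hkl (Subtype.ext h)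
  hasDerivAt k x hx := hf.hasDerivAt (hqs k hx)
  continuousOn k := (hf.continuousOn_deriv _).mono (hqs k)
  monotone k := (monotoneOn_or_antitoneOn hf (j k)).imp (fun h => h.mono (hqs k))
    fun h => h.mono (hqs k)
  mapsTo k := (hf.mapsTo _).mono_left (hqs k)
  nonneg k := hm0 k
  -- Cells of weight zero are excluded from the index type because `|f'|` may be unbounded on them.
  le k x hx := hm k k.2 x hx
  bound k := by
    rw [norm_mul, Complex.norm_real, Real.norm_eq_abs, hσ, one_mul]
    exact hcm k

/-- The transfer operator is, up to a small operator and a finite rank operator, the transfer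
operator of a finite system of branches with constant weights. -/
lemma exists_decomposition (hf : IsPiecewiseExpanding a b f) {β r t C ρ : ℝ} (hα0 : 0 < (α : ℝ))
    (hα1 : (α : ℝ) < 1) (hβ : 0 < β) (hr : 0 ≤ r) (ht0 : 0 ≤ t) (ht1 : t ≤ 1) (hrt : r * t ≤ 1)
    (hC : 0 ≤ C) (hρ0 : 0 ≤ ρ) (hexp : 1 - (α : ℝ) < β * (1 - α + α * (r * t)))
    (hαt : α * t ≤ 1 - (α : ℝ))
    (hfr : IntegrableOn (fun x => |deriv f x| ^ r) (Icc 0 1)) {η : ℝ → ℂ} {θ θ' ε : ℝ}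
    (hηm : Measurable η)
    (hηC : ∀ i, ∀ x ∈ Ioo (a i) (b i), ∀ y ∈ Ioo (a i) (b i), ‖η x - η y‖ ≤ C * |x - y| ^ β)
    (hηρ : ∀ i, ∀ x ∈ Ioo (a i) (b i), ‖η x‖ * |deriv f x| ≤ ρ)
    (hηθ : ∀ i, ∀ x ∈ Ioo (a i) (b i), ‖η x‖ * |deriv f x| ^ (α : ℝ) ≤ θ)
    (hθ0 : 0 ≤ θ) {H : ι → ℝ} (hH : ∀ i, 0 ≤ H i)
    (hsum : Summable fun i => H i ^ (1 / (1 - (α : ℝ))))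
    (hb : ∀ φ u : ℝ → ℂ, IsTest α φ u → ∀ i, ∀ x ∈ Ioo (a i) (b i), ∀ y ∈ Ioo (a i) (b i),
      x ≤ y → ‖∫ s in x..y, pullback a b f η u s‖ ≤ H i * (y - x) ^ (α : ℝ))
    {L : BSpace α →L[ℂ] BSpace α} (hL : IsDual a b f η L) (hε : 0 < ε) (hθ' : θ < θ') :
    ∃ A R F : BSpace α →L[ℂ] BSpace α, L = A + R + F ∧ ‖R‖ ≤ ε ∧
      (F : BSpace α →ₗ[ℂ] BSpace α).HasFiniteRange ∧ IsFiniteBranch A θ' := by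
  classical
  have hcount := hf.isPartition.countable
  have hηρU : ∀ x ∈ ⋃ i, Ioo (a i) (b i), ‖η x‖ * |deriv f x| ≤ ρ := fun x hx => by
    obtain ⟨i, hi⟩ := mem_iUnion.1 hx
    exact hηρ i x hi
  have hmem_unique : ∀ {x : ℝ} {i j : ι}, x ∈ Ioo (a i) (b i) → x ∈ Ioo (a j) (b j) → i = j :=
    fun {x i j} hi hj => by
      by_contra h
      exact Set.disjoint_left.1 (hf.isPartition.disjoint h) hi hj
  -- The tail of the convergent `ℓ^{1/(1-α)}` sum makes the branches outside `I₀` an operator `R₁`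
  -- of norm below `ε / 2`.
  obtain ⟨I₀, hI₀⟩ : ∃ I₀ : Finset ι, 2 * (∑' k : {i // i ∉ I₀}, H k ^ (1 / (1 - (α : ℝ)))) ^
      (1 - (α : ℝ)) < ε / 2 := by
    have := ((tendsto_tsum_compl_atTop_zero fun i => H i ^ (1 / (1 - (α : ℝ)))).rpow_const
      (p := 1 - (α : ℝ)) (Or.inr (by linarith))).const_mul 2
    rw [Real.zero_rpow (by linarith), mul_zero] at this
    exact (this.eventually_lt_const (by positivity)).exists
  set V : Set ℝ := ⋃ k : {i // i ∉ I₀}, Ioo (a k) (b k) with hV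
  have hVm : MeasurableSet V := measurableSet_iUnion_Ioo (fun k : {i // i ∉ I₀} => a k) fun k => b k
  set η₁ : ℝ → ℂ := V.indicator η with hη₁
  have hη₁ρ : ∀ x ∈ ⋃ i, Ioo (a i) (b i), ‖η₁ x‖ * |deriv f x| ≤ ρ := fun x hx =>
    (mul_le_mul_of_nonneg_right (norm_indicator_le_norm_self _ _) (abs_nonneg _)).trans (hηρU x hx)
  obtain ⟨R₁, hR₁, hR₁n, -⟩ := exists_transfer_of_cells (α := α) hf (hηm.indicator hVm) hρ0 hη₁ρ
    hα0 hα1 (q := fun k : {i // i ∉ I₀} => Ioo (a k) (b k)) (fun k => ordConnected_Ioo)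
    (fun k l hkl => hf.isPartition.disjoint fun h => hkl (Subtype.ext h))
    (fun x hx => indicator_of_notMem hx _) (H := fun k => H k) (fun k => hH k)
    (hsum.subtype _) fun φ u hφ k x hx y hy hxy => by
      rw [integral_pullback_congr hxy (η' := η)]
      · exact hb φ u hφ k x hx y hy hxy
      · exact fun s hs => indicator_of_mem
          (mem_iUnion.2 ⟨k, ordConnected_Ioo.out hx hy hs⟩) _
  -- The tolerance `ε / 16` becomes `8 * (ε / 16) = ε / 2` after averaging over the cells.
  have hcells := fun i => exists_cells hf hα0 hα1 hβ hr ht0 ht1 hrt hC hρ0 hexp hαt hfr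
    (hηC i) (hηρ i) (hηθ i) hθ0 hθ' (by positivity : 0 < ε / 16)
  choose n Q c' m' hQo hQc hQs hQd hQn hm'0 hm' hcm' hint using hcells
  choose σ hσ1 hσ using exists_sign hf
  let κ := Σ i : {i // i ∈ I₀}, Fin (n i)
  let j : κ → ι := fun k => k.1
  let q : κ → Set ℝ := fun k => Q k.1 k.2
  let c : κ → ℂ := fun k => c' k.1 k.2
  let m : κ → ℝ := fun k => m' k.1 k.2
  have hqs : ∀ k, q k ⊆ Ioo (a (j k)) (b (j k)) := fun k => hQs _ _
  have hqd : Pairwise fun k l => Disjoint (q k) (q l) := by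
    rintro ⟨i, k⟩ ⟨i', k'⟩ hne
    by_cases h : i = i'
    · subst h
      exact hQd _ fun hk : k = k' => hne (congrArg (Sigma.mk i) hk)
    · exact (hf.isPartition.disjoint fun h' => h (Subtype.ext h')).mono (hQs _ _) (hQs _ _)
  set η₂ : ℝ → ℂ := fun x => ∑ k, (q k).indicator (fun x => η x - c k) x with hη₂
  have hη₂_mem : ∀ k, ∀ x ∈ q k, η₂ x = η x - c k := fun k x hx => by
    simp only [hη₂]
    rw [Finset.sum_eq_single k, indicator_of_mem hx]
    · exact fun l _ hl => indicator_of_notMem (fun h => Set.disjoint_left.1 (hqd hl) h hx) _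
    · simp
  have hη₂_notMem : ∀ x ∉ ⋃ k, q k, η₂ x = 0 := fun x hx =>
    Finset.sum_eq_zero fun k _ => indicator_of_notMem (fun h => hx (mem_iUnion.2 ⟨k, h⟩)) _
  have hη₂m : Measurable η₂ := Finset.measurable_sum _ fun k _ =>
    (hηm.sub_const _).indicator (hQo _ _).measurableSet
  set ρ₂ : ℝ := ρ + ∑ k, ‖c k‖ * m k with hρ₂
  have hcm0 : ∀ k, 0 ≤ ‖c k‖ * m k := fun k => mul_nonneg (norm_nonneg _) (hm'0 _ _)
  have hρ₂0 : 0 ≤ ρ₂ := add_nonneg hρ0 (Finset.sum_nonneg fun k _ => hcm0 k)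
  have hη₂ρ : ∀ x ∈ ⋃ i, Ioo (a i) (b i), ‖η₂ x‖ * |deriv f x| ≤ ρ₂ := fun x hx => by
    by_cases hxq : x ∈ ⋃ k, q k
    · obtain ⟨k, hk⟩ := mem_iUnion.1 hxq
      rw [hη₂_mem k x hk]
      have h1 : ‖c k‖ * |deriv f x| ≤ ‖c k‖ * m k := by
        rcases eq_or_ne (c k) 0 with h | h
        · simp [h]
        · exact mul_le_mul_of_nonneg_left (hm' _ _ h x hk) (norm_nonneg _)
      have h2 : ‖c k‖ * m k ≤ ∑ k, ‖c k‖ * m k :=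
        Finset.single_le_sum (fun k _ => hcm0 k) (Finset.mem_univ k)
      calc ‖η x - c k‖ * |deriv f x| ≤ (‖η x‖ + ‖c k‖) * |deriv f x| :=
            mul_le_mul_of_nonneg_right (norm_sub_le _ _) (abs_nonneg _)
        _ ≤ ρ₂ := by rw [add_mul]; linarith [hηρU x hx]
    · rw [hη₂_notMem x hxq, norm_zero, zero_mul]
      exact hρ₂0
  have hb₂ : ∀ φ u : ℝ → ℂ, IsTest α φ u → ∀ k, ∀ x ∈ q k, ∀ y ∈ q k, x ≤ y →
      ‖∫ s in x..y, pullback a b f η₂ u s‖ ≤ ε / 16 * (y - x) ^ (α : ℝ) :=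
    fun φ u hφ k x hx y hy hxy => by
      rw [integral_pullback_congr hxy (η' := fun x => η x - c k)]
      · exact hint _ φ u hφ _ x hx y hy hxy
      · exact fun s hs => hη₂_mem k s ((hQc _ _).out hx hy hs)
  obtain ⟨R₂, hR₂, -⟩ := exists_transfer_of_cells (α := α) hf hη₂m hρ₂0 hη₂ρ hα0 hα1
    (q := q) (fun k => hQc _ _) hqd hη₂_notMem (H := fun _ => ε / 16) (fun _ => by positivity)
    (hasSum_fintype _).summable hb₂
  -- The direct norm bound for `R₂` would grow with the number of cells, which itself depends on
  -- `ε`. The averaging bound does not, at the price of a finite-rank term.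
  obtain ⟨B, F, hBF, hB, hF⟩ : EssNormLE R₂ (8 * (ε / 16)) :=
    essNormLE_of_dual (q := q) (J := pullback a b f η₂) (fun k => hQc _ _)
      (fun k => (hqs k).trans (hf.isPartition.subset _)) hqd (by positivity) hα0
      (fun φ u hφ h => hR₂ h u hφ.continuous.measurable hφ.bounded)
      (fun φ u hφ => measurable_pullback hf hη₂m hφ.continuous.measurable)
      (fun φ u hφ => by
        obtain ⟨C, hC⟩ := hφ.bounded
        exact ⟨_, norm_pullback_le hρ₂0 hη₂ρ hC⟩)
      (fun φ u hφ x hx => pullback_eq_zero (hη₂_notMem x hx))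
      (fun φ u hφ k x y hxy => by
        obtain ⟨C, hC⟩ := hφ.bounded
        exact norm_integral_indicator_le (hQc _ _)
          (measurable_pullback hf hη₂m hφ.continuous.measurable)
          (norm_pullback_le hρ₂0 hη₂ρ hC) (by positivity) hα0.le (hb₂ φ u hφ k) hxy)
  -- Almost everywhere, the weight left over equals `c k` on the cell `k` and zero outside the
  -- cells.
  refine ⟨L - R₁ - R₂, R₁ + B, F, ?_, ?_, hF, ?_⟩
  · rw [hBF]; abel
  · refine (norm_add_le _ _).trans ?_
    linarith
  have hη₁' : ∀ x ∈ ⋃ i, Ioo (a i) (b i), ‖η x - η₁ x‖ * |deriv f x| ≤ ρ := fun x hx => by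
    by_cases hxV : x ∈ V
    · rw [hη₁, indicator_of_mem hxV, sub_self, norm_zero, zero_mul]
      exact hρ0
    · rw [hη₁, indicator_of_notMem hxV, sub_zero]
      exact hηρU x hx
  have hη₁m : Measurable fun x => η x - η₁ x := hηm.sub (hηm.indicator hVm)
  have hdual₁ : IsDual a b f (fun x => η x - η₁ x) (L - R₁) :=
    hL.sub hf hηm (hηm.indicator hVm) hρ0 hηρU hρ0 hη₁ρ hR₁
  have hdual : IsDual a b f (fun x => η x - η₁ x - η₂ x) (L - R₁ - R₂) :=
    hdual₁.sub hf hη₁m hη₂m hρ0 hη₁' hρ₂0 hη₂ρ hR₂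
  let S : BranchSystem α θ' {k // c k ≠ 0} := cellSystem hf j q c m σ hσ1 (fun k => hQo _ _)
    (fun k => hQc _ _) hqs hqd (fun k => hm'0 _ _) (fun k => hm' _ _) (fun k => hcm' _ _)
  refine isFiniteBranch_of_fintype S fun h ψ hψ hψC => ?_
  rw [hdual h ψ hψ hψC]
  have hnull : ∀ᵐ x ∂leb, ∀ i, x ∈ Ioo (a i) (b i) → x ∈ ⋃ k, Q i k := by
    refine ae_all_iff.2 fun i => ae_restrict_of_ae ?_
    filter_upwards [measure_eq_zero_iff_ae_notMem.1 (hQn i)] with x hx hxi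
    by_contra hxq
    exact hx ⟨hxi, hxq⟩
  refine integral_congr_ae ?_
  filter_upwards [hnull] with x hx
  congr 1
  by_cases hxU : x ∈ ⋃ i, Ioo (a i) (b i)
  · obtain ⟨i, hi⟩ := mem_iUnion.1 hxU
    by_cases hiI : i ∈ I₀
    · obtain ⟨l, hl⟩ := mem_iUnion.1 (hx i hi)
      let k : κ := ⟨⟨i, hiI⟩, l⟩
      have hk : x ∈ q k := hl
      have hxV : x ∉ V := fun h => by
        obtain ⟨i', hi'⟩ := mem_iUnion.1 h
        exact i'.2 (hmem_unique hi' hi ▸ hiI)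
      have hw : η x - η₁ x - η₂ x = c k := by
        rw [hη₂_mem k x hk, hη₁, indicator_of_notMem hxV]; ring
      by_cases hck : c k = 0
      · rw [pullback_eq_zero (η := fun x => η x - η₁ x - η₂ x) (hw.trans hck), S.pull_of_notMem]
        intro h
        obtain ⟨k', hk'⟩ := mem_iUnion.1 h
        refine Set.disjoint_left.1 (hqd (i := k') (j := k) fun e => k'.2 ?_) hk' hk
        rw [e, hck]
      · rw [S.pull_of_mem (k := ⟨k, hck⟩) hk, pullback, indicator_of_mem hxU, hw, hσ i x hi]
        change _ = (σ i : ℂ) * c k * ((deriv f x : ℝ) : ℂ) * ψ (f x)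
        push_cast
        ring
    · have hxV : x ∈ V := mem_iUnion.2 ⟨⟨i, hiI⟩, hi⟩
      have hxq : ∀ k, x ∉ q k := fun k hk => hiI (hmem_unique hi (hqs k hk) ▸ k.1.2)
      rw [S.pull_of_notMem, pullback_eq_zero]
      · rw [hη₂_notMem x (by simpa using hxq), hη₁, indicator_of_mem hxV]; ring
      · exact fun h => by
          obtain ⟨k, hk⟩ := mem_iUnion.1 h
          exact hxq k hk
  · rw [S.pull_of_notMem, pullback, indicator_of_notMem hxU]
    exact fun h => by
      obtain ⟨k, hk⟩ := mem_iUnion.1 h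
      exact hxU (mem_iUnion.2 ⟨_, hqs k hk⟩)

end ExpandingMap

namespace ExpandingMap

open Filter Topology

/-! ### Spectral bounds on `𝓑_α` -/

section Spectrum

variable {α : unitInterval}

instance : Nontrivial (BSpace α) := by
  obtain ⟨e, he⟩ := exists_indicator (α := α) (q := Icc 0 1) ordConnected_Icc subset_rfl
  refine ⟨e, 0, fun h => ?_⟩
  have h1 := he fun _ => 1
  have h2 : ∫ x, BSpace.toL1 e x * 1 ∂leb = 0 := by
    rw [h, map_zero]
    refine integral_eq_zero_of_ae ?_
    filter_upwards [Lp.coeFn_zero ℂ 1 leb] with x hx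
    rw [mul_one]
    exact hx
  rw [h2] at h1
  simp at h1

lemma norm_toL1_pow_le {L : BSpace α →L[ℂ] BSpace α} {ρ : ℝ} (hρ : 0 ≤ ρ)
    (hL : ∀ h, ‖BSpace.toL1 (L h)‖ ≤ ρ * ‖BSpace.toL1 h‖) (n : ℕ) (h : BSpace α) :
    ‖BSpace.toL1 ((L ^ n) h)‖ ≤ ρ ^ n * ‖BSpace.toL1 h‖ := by
  induction n with
  | zero => simp
  | succ n ih =>
    rw [pow_succ', pow_succ', mul_assoc]
    exact (hL _).trans (mul_le_mul_of_nonneg_left ih hρ)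

variable {L : BSpace α →L[ℂ] BSpace α} {θ : ℝ}

lemma exists_pow_essNormLE (hα0 : 0 < (α : ℝ)) (hθ0 : 0 ≤ θ)
    (hdec : ∀ ε > 0, ∀ θ' > θ, ∃ A R F : BSpace α →L[ℂ] BSpace α, L = A + R + F ∧ ‖R‖ ≤ ε ∧
      (F : BSpace α →ₗ[ℂ] BSpace α).HasFiniteRange ∧ IsFiniteBranch A θ') {z : ℂ}
    (hz : θ < ‖z‖) : ∃ n : ℕ, n ≠ 0 ∧ ∃ t < ‖z‖ ^ n, EssNormLE (L ^ n) t := by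
  refine exists_essNormLE_pow hθ0 (fun ε hε θ' hθ' => ?_) hz
  obtain ⟨A, R, F, h1, h2, h3, h4⟩ := hdec ε hε θ' hθ'
  have hθ'0 : 0 ≤ θ' := hθ0.trans (le_of_lt hθ')
  exact ⟨A, R, F, h1, h2, h3, fun n hn =>
    (h4.pow hθ'0 hn).essNormLE hα0 (pow_nonneg hθ'0 n)⟩

lemma essSpectralRadius_le (hα0 : 0 < (α : ℝ)) (hθ0 : 0 ≤ θ)
    (hdec : ∀ ε > 0, ∀ θ' > θ, ∃ A R F : BSpace α →L[ℂ] BSpace α, L = A + R + F ∧ ‖R‖ ≤ ε ∧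
      (F : BSpace α →ₗ[ℂ] BSpace α).HasFiniteRange ∧ IsFiniteBranch A θ') :
    essSpectralRadius L ≤ ENNReal.ofReal θ := by
  refine iSup₂_le fun z hz => ?_
  rw [← ofReal_norm]
  refine ENNReal.ofReal_le_ofReal (not_lt.1 fun h => hz ?_)
  obtain ⟨n, -, t, ht, hLt⟩ := exists_pow_essNormLE hα0 hθ0 hdec h
  exact isFredholm_of_essNormLE_pow hLt ht

/-- Let `‖z‖ > ρ ≥ θ`. By the Fredholm alternative a spectral value `z` would give a nonzero
solution of `L ^ n x = z ^ n • x`. Taking `L¹` norms contradicts the bound `ρ ^ n`, since the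
inclusion in `L¹` is injective. -/
lemma spectralRadius_le (hα0 : 0 < (α : ℝ)) (hθ0 : 0 ≤ θ)
    (hdec : ∀ ε > 0, ∀ θ' > θ, ∃ A R F : BSpace α →L[ℂ] BSpace α, L = A + R + F ∧ ‖R‖ ≤ ε ∧
      (F : BSpace α →ₗ[ℂ] BSpace α).HasFiniteRange ∧ IsFiniteBranch A θ') {ρ : ℝ} (hθρ : θ ≤ ρ)
    (hL : ∀ h, ‖BSpace.toL1 (L h)‖ ≤ ρ * ‖BSpace.toL1 h‖) :
    spectralRadius ℂ L ≤ ENNReal.ofReal ρ := by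
  refine iSup₂_le fun z hz => ?_
  rw [← enorm_eq_nnnorm, ← ofReal_norm]
  refine ENNReal.ofReal_le_ofReal (not_lt.1 fun h => ?_)
  have hρ0 := hθ0.trans hθρ
  obtain ⟨n, hn, t, ht, hLt⟩ := exists_pow_essNormLE hα0 hθ0 hdec (hθρ.trans_lt h)
  refine notMem_spectrum_of_essNormLE_pow hLt ht (fun x hx => ?_) hz
  have h1 := norm_toL1_pow_le hρ0 hL n x
  rw [hx, map_smul, norm_smul, norm_pow] at h1
  have h2 : ρ ^ n < ‖z‖ ^ n := pow_lt_pow_left₀ h hρ0 hn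
  refine BSpace.toL1_injective ?_
  rw [map_zero, ← norm_le_zero_iff]
  by_contra h3
  nlinarith [not_le.1 h3]

end Spectrum

/-! ### Bounds on the weight and on the branches -/

section Weight

variable {ι : Type*} {a b : ι → ℝ} {f : ℝ → ℝ} {ξ : ℝ → ℂ}

lemma norm_weightPow (f : ℝ → ℝ) (ξ : ℝ → ℂ) (t x : ℝ) :
    ‖weightPow f ξ t x‖ = ‖ξ x‖ * |deriv f x| ^ t := by
  rw [weightPow, norm_mul, Complex.norm_cpow_real, Complex.norm_real, Real.norm_eq_abs]

lemma continuousOn_of_holder {β C : ℝ} (hβ : 0 < β) {s : Set ℝ}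
    (h : ∀ x ∈ s, ∀ y ∈ s, ‖ξ x - ξ y‖ ≤ C * |x - y| ^ β) : ContinuousOn ξ s := by
  intro x hx
  refine tendsto_iff_norm_sub_tendsto_zero.2 (squeeze_zero' (.of_forall fun y => norm_nonneg _)
    (g := fun y => C * |y - x| ^ β) ?_ ?_)
  · filter_upwards [self_mem_nhdsWithin] with y hy using h y hy x hx
  · have h1 : Tendsto (fun y => |y - x|) (𝓝[s] x) (𝓝 0) := by
      have : Continuous fun y : ℝ => |y - x| := by fun_prop
      simpa using (this.tendsto x).mono_left nhdsWithin_le_nhds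
    simpa [Real.zero_rpow hβ.ne'] using (h1.rpow_const (p := β) (Or.inr hβ.le)).const_mul C

/-- The set where a continuous function exceeds `c` is open, and an open null set is empty.
Essential suprema thus become pointwise bounds on each branch. -/
lemma le_of_ae_le {g : ℝ → ℝ} {x₀ y₀ c : ℝ} (hsub : Ioo x₀ y₀ ⊆ Icc 0 1)
    (hg : ContinuousOn g (Ioo x₀ y₀)) (h : ∀ᵐ x ∂leb, g x ≤ c) : ∀ x ∈ Ioo x₀ y₀, g x ≤ c := by
  have hopen : IsOpen (Ioo x₀ y₀ ∩ g ⁻¹' Ioi c) := hg.isOpen_inter_preimage isOpen_Ioo isOpen_Ioi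
  have hnull : volume (Ioo x₀ y₀ ∩ g ⁻¹' Ioi c) = 0 := by
    rw [ae_restrict_iff' measurableSet_Icc] at h
    refine measure_mono_null ?_ (ae_iff.1 h)
    exact fun x hx hn => not_lt.2 (hn (hsub hx.1)) hx.2
  intro x hx
  by_contra hn
  have : x ∈ Ioo x₀ y₀ ∩ g ⁻¹' Ioi c := ⟨hx, not_le.1 hn⟩
  rw [(hopen.measure_eq_zero_iff volume).1 hnull] at this
  exact this

lemma measurable_indicator_weight
    (hξ : ∀ i, ContinuousOn ξ (Ioo (a i) (b i))) :
    Measurable ((⋃ i, Ioo (a i) (b i)).indicator ξ) := by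
  have hc : ContinuousOn ξ (⋃ i, Ioo (a i) (b i)) := fun x hx => by
    obtain ⟨i, hi⟩ := mem_iUnion.1 hx
    exact ((hξ i).continuousAt (isOpen_Ioo.mem_nhds hi)).continuousWithinAt
  classical
  rw [← piecewise_eq_indicator]
  exact hc.measurable_piecewise continuousOn_const (measurableSet_iUnion_Ioo a b)

/-- Interpolation between `|ξ| |f'| ^ γ` and `|ξ f'|`. -/
lemma exists_summable_bound {α γ ρ : ℝ} (hα : γ < α) (hα1 : α < 1) (hρ : 0 ≤ ρ)
    (hξρ : ∀ i, ∀ x ∈ Ioo (a i) (b i), ‖ξ x‖ * |deriv f x| ≤ ρ)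
    (hf1 : ∀ i, ∀ x ∈ Ioo (a i) (b i), 1 ≤ |deriv f x|)
    (hsum : (∑' i, ⨆ z ∈ Ioo (a i) (b i), ‖weightPow f ξ γ z‖ₑ ^ (1 / (1 - γ))) < ∞) :
    ∃ N : ι → ℝ, (∀ i, 0 ≤ N i) ∧ (Summable fun i => N i ^ (1 / (1 - α))) ∧
      ∀ i, ∀ x ∈ Ioo (a i) (b i), ‖ξ x‖ * |deriv f x| ^ α ≤ N i := by
  set S : ι → ℝ≥0∞ := fun i => ⨆ z ∈ Ioo (a i) (b i), ‖weightPow f ξ γ z‖ₑ ^ (1 / (1 - γ))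
  have hStop : ∀ i, S i ≠ ∞ := ENNReal.ne_top_of_tsum_ne_top hsum.ne
  have hSsum : Summable fun i => (S i).toReal := ENNReal.summable_toReal hsum.ne
  have h1γ : 0 < 1 - γ := by linarith
  have h1α : 0 < 1 - α := by linarith
  -- `l` is the interpolation weight for which `α = γ * l + (1 - l)`. It also sends the exponent `1
  -- / (1 - γ)` of the hypothesis to the required `1 / (1 - α)`.
  set l : ℝ := (1 - α) / (1 - γ) with hl
  have hl0 : 0 ≤ l := by positivity
  have hl1 : l ≤ 1 := (div_le_one h1γ).2 (by linarith)
  refine ⟨fun i => (S i).toReal ^ (1 - α) * ρ ^ (1 - l), fun i => by positivity, ?_, ?_⟩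
  · refine (hSsum.mul_right ((ρ ^ (1 - l)) ^ (1 / (1 - α)))).congr fun i => ?_
    rw [Real.mul_rpow (by positivity) (by positivity), ← Real.rpow_mul ENNReal.toReal_nonneg,
      mul_one_div_cancel h1α.ne', Real.rpow_one]
  · intro i x hx
    have hS : ‖ξ x‖ * |deriv f x| ^ γ ≤ (S i).toReal ^ (1 - γ) := by
      rw [← norm_weightPow]
      have h1 : ‖weightPow f ξ γ x‖ₑ ^ (1 / (1 - γ)) ≤ S i :=
        le_iSup₂ (f := fun z (_ : z ∈ Ioo (a i) (b i)) => ‖weightPow f ξ γ z‖ₑ ^ (1 / (1 - γ))) x hx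
      have h2 := ENNReal.toReal_mono (hStop i) h1
      rw [← ENNReal.toReal_rpow, toReal_enorm] at h2
      calc ‖weightPow f ξ γ x‖ = (‖weightPow f ξ γ x‖ ^ (1 / (1 - γ))) ^ (1 - γ) := by
            rw [← Real.rpow_mul (norm_nonneg _), one_div_mul_cancel h1γ.ne', Real.rpow_one]
        _ ≤ _ := Real.rpow_le_rpow (by positivity) h2 h1γ.le
    have hD := hf1 i x hx
    have hD0 : 0 < |deriv f x| := by linarith
    have hξ0 := norm_nonneg (ξ x)
    have h3 : ‖ξ x‖ * |deriv f x| ^ α =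
        (‖ξ x‖ * |deriv f x| ^ γ) ^ l * (‖ξ x‖ * |deriv f x|) ^ (1 - l) := by
      rcases hξ0.eq_or_lt with h0 | h0
      · rw [← h0, zero_mul, zero_mul, zero_mul]
        rw [Real.zero_rpow (div_pos h1α h1γ).ne', zero_mul]
      · rw [Real.mul_rpow h0.le (by positivity), Real.mul_rpow h0.le hD0.le, ← Real.rpow_mul hD0.le]
        have e1 : α = γ * l + (1 - l) := by
          rw [hl]; field_simp; ring
        have e2 : ‖ξ x‖ = ‖ξ x‖ ^ l * ‖ξ x‖ ^ (1 - l) := by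
          rw [← Real.rpow_add h0, add_sub_cancel, Real.rpow_one]
        have e3 : |deriv f x| ^ α = |deriv f x| ^ (γ * l) * |deriv f x| ^ (1 - l) := by
          rw [← Real.rpow_add hD0, ← e1]
        rw [e3]
        nth_rewrite 1 [e2]
        ring
    rw [h3]
    calc (‖ξ x‖ * |deriv f x| ^ γ) ^ l * (‖ξ x‖ * |deriv f x|) ^ (1 - l)
        ≤ ((S i).toReal ^ (1 - γ)) ^ l * ρ ^ (1 - l) := by
          gcongr
          exact hξρ i x hx
      _ = (S i).toReal ^ (1 - α) * ρ ^ (1 - l) := by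
          rw [← Real.rpow_mul ENNReal.toReal_nonneg, hl, mul_div_cancel₀ _ h1γ.ne']

/-- The bounds on the branches of the transfer operator. -/
lemma exists_branch_bound (hf : IsPiecewiseExpanding a b f) {α β r t C ρ : ℝ} (hα0 : 0 < α)
    (hα1 : α < 1) (hβ : 0 < β) (hr : 0 ≤ r) (ht0 : 0 ≤ t) (ht1 : t ≤ 1) (hrt : r * t ≤ 1)
    (hC : 0 ≤ C) (hρ0 : 0 ≤ ρ) (hexp : 1 - α < β * (1 - α + α * (r * t)))
    (hαt : α * t ≤ 1 - α)
    (hfr : IntegrableOn (fun x => |deriv f x| ^ r) (Icc 0 1)) {η : ℝ → ℂ}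
    (hηC : ∀ i, ∀ x ∈ Ioo (a i) (b i), ∀ y ∈ Ioo (a i) (b i), ‖η x - η y‖ ≤ C * |x - y| ^ β)
    (hηρ : ∀ i, ∀ x ∈ Ioo (a i) (b i), ‖η x‖ * |deriv f x| ≤ ρ) {N : ι → ℝ} (hN : ∀ i, 0 ≤ N i)
    (hNsum : Summable fun i => N i ^ (1 / (1 - α)))
    (hηN : ∀ i, ∀ x ∈ Ioo (a i) (b i), ‖η x‖ * |deriv f x| ^ α ≤ N i) :
    ∃ H : ι → ℝ, (∀ i, 0 ≤ H i) ∧ (Summable fun i => H i ^ (1 / (1 - α))) ∧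
      ∀ φ u : ℝ → ℂ, IsTest α φ u → ∀ i, ∀ x ∈ Ioo (a i) (b i), ∀ y ∈ Ioo (a i) (b i),
        x ≤ y → ‖∫ s in x..y, pullback a b f η u s‖ ≤ H i * (y - x) ^ α := by
  obtain ⟨K, hK, hbd⟩ := exists_norm_integral_pullback_le hf hα0.le hα1.le hβ hr ht0 ht1 hrt hC
    hρ0 hexp hfr
  set e : ℝ := β * (1 - α + α * (r * t)) - α * t with he
  have he0 : 0 < e := by linarith
  set Z : ι → ℝ := fun i => (b i - a i) ^ e *
    (∫ s in Ioo (a i) (b i), |deriv f s| ^ r) ^ (α * t) with hZ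
  have hW0 : ∀ i, 0 ≤ ∫ s in Ioo (a i) (b i), |deriv f s| ^ r := fun i =>
    integral_nonneg fun s => by positivity
  have hZ0 : ∀ i, 0 ≤ Z i := fun i => mul_nonneg
    (Real.rpow_nonneg (sub_nonneg.2 (hf.isPartition.lt i).le) _) (Real.rpow_nonneg (hW0 i) _)
  have hZsum : Summable fun i => Z i ^ (1 / (1 - α)) :=
    summable_length_mul hf.isPartition hfr (fun x => by positivity) hα1 (by positivity) hαt
      (by linarith)
  -- `N i` bounds the value at the sample point and `K * Z i` the Young error over the full branch.
  refine ⟨fun i => N i + K * Z i, fun i => add_nonneg (hN i) (mul_nonneg hK (hZ0 i)), ?_, ?_⟩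
  · refine summable_add_rpow (one_div_nonneg.2 (by linarith)) hN (fun i => mul_nonneg hK (hZ0 i))
      hNsum ?_
    refine (hZsum.mul_left (K ^ (1 / (1 - α)))).congr fun i => ?_
    rw [Real.mul_rpow hK (hZ0 i)]
  · intro φ u hφ i x hx y hy hxy
    have hsub : Icc x y ⊆ Ioo (a i) (b i) := ordConnected_Ioo.out hx hy
    obtain ⟨z, hz, hz'⟩ := hbd hxy hsub hφ (fun s hs s' hs' => hηC i s (hsub hs) s' (hsub hs'))
      fun s hs => hηρ i s (hsub hs)
    have hl : 0 ≤ y - x := sub_nonneg.2 hxy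
    refine hz'.trans (mul_le_mul_of_nonneg_right ?_ (by positivity))
    refine add_le_add (hηN i z (hsub hz)) (mul_le_mul_of_nonneg_left ?_ hK)
    have := hW0 i
    have h1 : y - x ≤ b i - a i := by linarith [hx.1, hy.2]
    simp only [hZ]
    gcongr

end Weight

end ExpandingMap

end

/-! ### Assembly of the main theorem -/

theorem theorem1 {ι : Type*} (a b : ι → ℝ) (f : ℝ → ℝ) (ξ : ℝ → ℂ) (β γ r : ℝ)
    (hf : ExpandingMap.IsPiecewiseExpanding a b f)
    (hβ0 : 0 < β) (hβ1 : β ≤ 1)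
    (hξ : ExpandingMap.IsPiecewiseHolder a b β ξ)
    (hr : 0 ≤ r)
    (hfr : IntegrableOn (fun x => |deriv f x| ^ r) (Icc 0 1))
    (hξf : MemLp (fun x => ξ x * ((deriv f x : ℝ) : ℂ)) ∞ ExpandingMap.leb)
    (hγ0 : 0 ≤ γ) (hγ1 : γ < 1)
    (hsum : (∑' i, ⨆ z ∈ Ioo (a i) (b i),
      ‖ExpandingMap.weightPow f ξ γ z‖ₑ ^ (1 / (1 - γ))) < ∞)
    (hβr : 1 / (r + 1) < β)
    (α : unitInterval) (hα1 : (α : ℝ) < 1)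
    (hα : max γ (max (1 - β) ((1 - β) / (1 - β * (1 - r)))) < (α : ℝ)) :
    ∃ L : ExpandingMap.BSpace α →L[ℂ] ExpandingMap.BSpace α,
      ExpandingMap.IsTransferOperator a b f ξ L ∧
      spectralRadius ℂ L ≤ eLpNorm (fun x => ξ x * ((deriv f x : ℝ) : ℂ)) ∞ ExpandingMap.leb ∧
      ExpandingMap.essSpectralRadius L ≤
        min (eLpNorm (fun x => ξ x * ((deriv f x : ℝ) : ℂ)) ∞ ExpandingMap.leb)
          (8 * eLpNorm (ExpandingMap.weightPow f ξ α) ∞ ExpandingMap.leb) := by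
  open ExpandingMap in
  rw [max_lt_iff, max_lt_iff] at hα
  obtain ⟨hγα, hβα, hβrα⟩ := hα
  have hα0 : 0 < (α : ℝ) := by linarith
  -- For `r = 0` the condition on `β` would read `β > 1`.
  have hr0 : 0 < r := by
    rcases hr.eq_or_lt with h | h
    · rw [← h] at hβr
      norm_num at hβr
      linarith
    · exact h
  obtain ⟨t, ht0, ht1, hrt, hαt, hexp⟩ := exists_exponent hα0 hα1 hβ0 hβ1 hr0 hβr hβα hβrα
  have := hf.isPartition.countable
  set U : Set ℝ := ⋃ i, Ioo (a i) (b i) with hU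
  obtain ⟨C₀, hC₀⟩ := hξ
  set C : ℝ := max C₀ 0
  have hξC : ∀ i, ∀ x ∈ Ioo (a i) (b i), ∀ y ∈ Ioo (a i) (b i),
      ‖ξ x - ξ y‖ ≤ C * |x - y| ^ β := fun i x hx y hy =>
    (hC₀ i x hx y hy).trans (mul_le_mul_of_nonneg_right (le_max_left _ _) (by positivity))
  have hξc : ∀ i, ContinuousOn ξ (Ioo (a i) (b i)) := fun i => continuousOn_of_holder hβ0 (hξC i)
  set ρ : ℝ := (eLpNorm (fun x => ξ x * ((deriv f x : ℝ) : ℂ)) ∞ leb).toReal with hρ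
  have hρe : ENNReal.ofReal ρ = eLpNorm (fun x => ξ x * ((deriv f x : ℝ) : ℂ)) ∞ leb :=
    ENNReal.ofReal_toReal hξf.2.ne
  have hle : eLpNorm (weightPow f ξ α) ∞ leb ≤
      eLpNorm (fun x => ξ x * ((deriv f x : ℝ) : ℂ)) ∞ leb := by
    refine eLpNorm_mono_ae ?_
    filter_upwards [hf.isPartition.ae_mem] with x hx
    obtain ⟨i, hi⟩ := mem_iUnion.1 hx
    rw [norm_weightPow, norm_mul, Complex.norm_real, Real.norm_eq_abs]
    exact mul_le_mul_of_nonneg_left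
      (Real.rpow_le_self_of_one_le (hf.one_le_abs_deriv hi) hα1.le) (norm_nonneg _)
  have hfin : eLpNorm (weightPow f ξ α) ∞ leb ≠ ∞ := (hle.trans_lt hξf.2).ne
  set θ : ℝ := (eLpNorm (weightPow f ξ α) ∞ leb).toReal with hθ
  have hθe : ENNReal.ofReal θ = eLpNorm (weightPow f ξ α) ∞ leb := ENNReal.ofReal_toReal hfin
  have hρ0 : 0 ≤ ρ := ENNReal.toReal_nonneg
  have hθ0 : 0 ≤ θ := ENNReal.toReal_nonneg
  have hθρ : θ ≤ ρ := ENNReal.toReal_mono hξf.2.ne hle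
  have hsup : ∀ g : ℝ → ℂ, eLpNorm g ∞ leb ≠ ∞ → ∀ᵐ x ∂leb, ‖g x‖ ≤ (eLpNorm g ∞ leb).toReal := by
    intro g hg
    rw [eLpNorm_exponent_top] at hg ⊢
    filter_upwards [ae_le_eLpNormEssSup (f := g) (μ := leb)] with x hx
    rw [← toReal_enorm]
    exact ENNReal.toReal_mono hg hx
  have hξρ : ∀ i, ∀ x ∈ Ioo (a i) (b i), ‖ξ x‖ * |deriv f x| ≤ ρ := fun i => by
    refine le_of_ae_le (hf.isPartition.subset i)
      ((hξc i).norm.mul (hf.continuousOn_deriv i).abs) ?_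
    filter_upwards [hsup _ hξf.2.ne] with x hx
    rwa [norm_mul, Complex.norm_real, Real.norm_eq_abs] at hx
  have hξθ : ∀ i, ∀ x ∈ Ioo (a i) (b i), ‖ξ x‖ * |deriv f x| ^ (α : ℝ) ≤ θ := fun i => by
    refine le_of_ae_le (hf.isPartition.subset i) ((hξc i).norm.mul
      ((hf.continuousOn_deriv i).abs.rpow_const fun x _ => Or.inr hα0.le)) ?_
    filter_upwards [hsup _ hfin] with x hx
    rwa [norm_weightPow] at hx
  obtain ⟨N, hN, hNsum, hξN⟩ := exists_summable_bound hγα hα1 hρ0 hξρ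
    (fun i x hx => hf.one_le_abs_deriv hx) hsum
  -- Nothing is known about `ξ` outside the open intervals, not even measurability. Cutting it off
  -- there does not change the operator, whose sum runs only over preimages in `U`.
  set η : ℝ → ℂ := U.indicator ξ with hη
  have hηξ : ∀ i, ∀ x ∈ Ioo (a i) (b i), η x = ξ x := fun i x hx =>
    indicator_of_mem (mem_iUnion.2 ⟨i, hx⟩) _
  have hηm : Measurable η := measurable_indicator_weight hξc
  have hηC : ∀ i, ∀ x ∈ Ioo (a i) (b i), ∀ y ∈ Ioo (a i) (b i),
      ‖η x - η y‖ ≤ C * |x - y| ^ β := fun i x hx y hy => by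
    rw [hηξ i x hx, hηξ i y hy]; exact hξC i x hx y hy
  have hηρ : ∀ i, ∀ x ∈ Ioo (a i) (b i), ‖η x‖ * |deriv f x| ≤ ρ := fun i x hx => by
    rw [hηξ i x hx]; exact hξρ i x hx
  have hηθ : ∀ i, ∀ x ∈ Ioo (a i) (b i), ‖η x‖ * |deriv f x| ^ (α : ℝ) ≤ θ := fun i x hx => by
    rw [hηξ i x hx]; exact hξθ i x hx
  have hηN : ∀ i, ∀ x ∈ Ioo (a i) (b i), ‖η x‖ * |deriv f x| ^ (α : ℝ) ≤ N i := fun i x hx => by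
    rw [hηξ i x hx]; exact hξN i x hx
  obtain ⟨H, hH, hHsum, hHb⟩ := exists_branch_bound hf hα0 hα1 hβ0 hr ht0.le ht1 hrt
    (le_max_right C₀ 0) hρ0 hexp hαt hfr hηC hηρ hN hNsum hηN
  obtain ⟨L, hLd, -, hLρ, hLt⟩ := exists_transfer_of_cells (α := α) hf hηm hρ0
    (fun x hx => by
      obtain ⟨i, hi⟩ := mem_iUnion.1 hx
      exact hηρ i x hi) hα0 hα1 (fun i => ordConnected_Ioo) hf.isPartition.disjoint
    (fun x hx => indicator_of_notMem hx _) hH hHsum hHb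
  have hdec : ∀ ε > 0, ∀ θ' > θ, ∃ A R F : BSpace α →L[ℂ] BSpace α, L = A + R + F ∧ ‖R‖ ≤ ε ∧
      (F : BSpace α →ₗ[ℂ] BSpace α).HasFiniteRange ∧ IsFiniteBranch A θ' := fun ε hε θ' hθ' =>
    exists_decomposition hf hα0 hα1 hβ0 hr ht0.le ht1 hrt (le_max_right C₀ 0) hρ0 hexp hαt hfr
      hηm hηC hηρ hηθ hθ0 hH hHsum hHb hLd hε hθ'
  refine ⟨L, fun h => ?_, ?_, ?_⟩
  · filter_upwards [hLt h] with x hx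
    refine hx.congr_fun ?_
    rintro ⟨y, hy, -⟩
    rw [hη, indicator_of_mem hy]
  · rw [← hρe]
    exact spectralRadius_le hα0 hθ0 hdec hθρ hLρ
  · have hess : essSpectralRadius L ≤ eLpNorm (weightPow f ξ α) ∞ leb := by
      rw [← hθe]
      exact essSpectralRadius_le hα0 hθ0 hdec
    -- The bound `θ` proved for the essential spectral radius is stronger than both entries: `θ ≤ ρ`
    -- because `|f'| ≥ 1`, and `θ ≤ 8 * θ`.
    refine le_min (hess.trans hle) (hess.trans ?_)
    exact le_mul_of_one_le_left zero_le (by norm_num)
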